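/- A symmetric multicategory $Q$ (with a category of objects) consists of a small category $o(Q)$ of objects; for objects $x_1,\dots,x_k,x$ a set $Q(x_1,\dots,x_k;x)$ of arrows; for each object-morphism $f\colon x\to y$ an arrow $\iota(f)\in Q(x;y)$; composites $f\circ(g_1,\dots,g_k)$; and an action $f\mapsto f\sigma$ of permutations on the inputs. These satisfy the unit laws for $1_x=\iota(1_x)$, associativity, compatibility of composition with the symmetric action (in the outer and in the inner variables), and $\iota(fg)=\iota(f)\circ\iota(g)$. Let $\mathrm{elt}(Q)$ be the category whose objects are the arrows of $Q$ and whose morphisms $\alpha\to\beta$ are given by object-morphisms $f_1,\dots,f_m,f$ and a permutation $\sigma$ such that $\beta=(\iota(f)\circ\alpha\circ(\iota(f_1),\dots,\iota(f_m)))\sigma$. Call $Q$ tidy if it is freely symmetric ($f\sigma=f$ implies $\sigma=1$) and $o(Q)$ is equivalent to a discrete category. Slice. $Q^+$ is the symmetric multicategory with $o(Q^+)=\mathrm{elt}(Q)$ in which an arrow $(f_1,\dots,f_n)\to f$ is a configuration for composing $f_1,\dots,f_n$ to give $f$: a planar tree with nodes labelled by arrows of $Q$ and edges labelled by object-morphisms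 of $Q$, a bijection between the nodes and $\{1,\dots,n\}$ such that the node with number $i$ is labelled by $f_i$, and a permutation of the leaves, such that the resulting composite in $Q$ is $f$. The arrow $\iota(\varphi)$ is the one-node tree with edges labelled by the components of $\varphi$, composition is substitution of trees for nodes, and the symmetric action permutes the numbering of the nodes. If $Q$ is tidy, then so is $Q^+$. The monad $\zeta(Q)$. A category is cartesian if it has finite limits. A monad on such a category is cartesian if its functor part preserves pullbacks and the naturality squares of its unit and multiplication are pullbacks. $\mathbf{CartMonad}$ has as objects the pairs $(\mathcal E,T)$ of a cartesian category and a cartesian monad on it. A morphism $(U,\phi)\colon(\mathcal E_1,T_1)\to(\mathcal E_2,T_2)$ is a cartesian monad opfunctor: a pullback-preserving functor $U\colon\mathcal E_1\to\mathcal E_2$ with a natural transformation $\phi\colon UT_1\to T_2U$ whose naturality squares are pullbacks, such that $\phi\circ U\eta_1=\eta_2U$ and $\phi\circ U\mu_1=\mu_2U\circ T_2\phi\circ\phi T_1$. For tidy $Q$ let $S$ be the set of isomorphism classes of objects of $Q$. Then $\zeta(Q)=(\mathbf{Set}/S,T_Q)$, where $T_Q(X\to S)$ is the set of isomorphism classes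 of source-labelled arrows (arrows of $Q$ each of whose inputs is labelled by an element of $X$ lying over the class of that input), taken in $\mathrm{elt}(Q)\times_{\mathcal F S}\mathcal F X$ with $\mathcal F$ the free symmetric strict monoidal category, and lying over $S$ by the class of the target. The unit is given by identities labelled by a single element, and the multiplication by composition in $Q$. This is a cartesian monad. Free operads. For a cartesian monad $(\mathcal E,T)$, an $(\mathcal E,T)$-operad is an $(\mathcal E,T)$-multicategory with terminal objects-object: an object $d\colon C_1\to T1$ of $\mathcal E/T1$ with identities $1\to C_1$ and composition $TC_1\times_{T1}C_1\to C_1$ over $T1$ (the object $TC_1\times_{T1}C_1$ being mapped to $T1$ by $\mu_1\circ Td$ on the first factor, and $1$ by $\eta_1$), satisfying the identity and associative laws. Morphisms of operads are maps over $T1$ that preserve identities and composition. When the forgetful functor from $(\mathcal E,T)$-operads to $\mathcal E/T1$ has a left adjoint, the induced monad on $\mathcal E/T1$ is the free $(\mathcal E,T)$-operad monad, written $(\mathcal E,T)'$. Theorem. Let $Q$ be a tidy symmetric multicategory. Then the forgetful functor from $(\mathbf{Set}/S,T_Q)$-operads to $(\mathbf{Set}/S)/T_Q1$ has a left adjoint;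 and, for every choice of left adjoint, the free operad monad $\zeta(Q)'$ is a cartesian monad, and $$\zeta(Q)'\cong\zeta(Q^+)$$ in $\mathbf{CartMonad}$. -/

import Mathlib

open CategoryTheory Limits

universe u v w

namespace Opetopic

/-- Concatenation of the finite lists `z 0, z 1, …, z (n-1)`, a list being a function on `Fin`. -/
def concat {X : Type*} {n : ℕ} {m : Fin n → ℕ} (z : ∀ i, Fin (m i) → X) :
    Fin (∑ i, m i) → X :=
  fun p => z (finSigmaFinEquiv.symm p).1 (finSigmaFinEquiv.symm p).2

theorem concat_apply {X : Type*} {n : ℕ} {m : Fin n → ℕ} (z : ∀ i, Fin (m i) → X)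
    (i : Fin n) (j : Fin (m i)) : concat z (finSigmaFinEquiv ⟨i, j⟩) = z i j := by
  have : (fun s : Σ i, Fin (m i) => z s.1 s.2) (finSigmaFinEquiv.symm (finSigmaFinEquiv ⟨i, j⟩))
      = z i j := by rw [Equiv.symm_apply_apply]
  exact this

/-- The permutation `ρ(σ)` moving the blocks of a concatenated list as `σ` moves `k` objects. -/
def blockPerm {k : ℕ} (σ : Equiv.Perm (Fin k)) (m : Fin k → ℕ) :
    Fin (∑ i, m (σ i)) ≃ Fin (∑ i, m i) :=
  finSigmaFinEquiv.symm.trans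
    ((Equiv.sigmaCongrLeft (β := fun i => Fin (m i)) σ).trans finSigmaFinEquiv)

theorem concat_blockPerm {X : Type*} {k : ℕ} (σ : Equiv.Perm (Fin k)) {m : Fin k → ℕ}
    (z : ∀ i, Fin (m i) → X) (p : Fin (∑ i, m (σ i))) :
    concat (fun i => z (σ i)) p = concat z (blockPerm σ m p) := by
  obtain ⟨⟨i, j⟩, rfl⟩ := finSigmaFinEquiv.surjective p
  rw [concat_apply]
  have : blockPerm σ m (finSigmaFinEquiv ⟨i, j⟩) = finSigmaFinEquiv ⟨σ i, j⟩ := by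
    simp [blockPerm]
  rw [this, concat_apply]

/-- The permutation juxtaposing the permutations `σ i`. -/
def juxtPerm {k : ℕ} {m : Fin k → ℕ} (σ : ∀ i, Equiv.Perm (Fin (m i))) :
    Equiv.Perm (Fin (∑ i, m i)) :=
  finSigmaFinEquiv.symm.trans ((Equiv.sigmaCongrRight σ).trans finSigmaFinEquiv)

/-- The data of a symmetric multicategory with a category of objects. -/
structure SymMulticatData where
  /-- the object-category -/
  Obj : Type u
  [cat : SmallCategory Obj]
  /-- `Hom (x₁,…,x_k) x` is the set of arrows from the list `x₁,…,x_k` to `x` -/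
  Hom : ∀ {k : ℕ}, (Fin k → Obj) → Obj → Type u
  /-- the arrow `ι(f)` given by an object-morphism `f` -/
  ι : ∀ {x y : Obj}, (x ⟶ y) → Hom (fun _ : Fin 1 => x) y
  /-- the composite `f ∘ (g₁,…,g_k)` -/
  comp : ∀ {k : ℕ} {x : Fin k → Obj} {y : Obj} (_ : Hom x y) {m : Fin k → ℕ}
    {z : ∀ i, Fin (m i) → Obj} (_ : ∀ i, Hom (z i) (x i)), Hom (concat z) y
  /-- the symmetric action `f ↦ fσ` -/
  act : ∀ {k : ℕ} {x : Fin k → Obj} {y : Obj} (_ : Hom x y) (σ : Equiv.Perm (Fin k)),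
    Hom (x ∘ σ) y

attribute [instance] SymMulticatData.cat

namespace SymMulticatData

variable (Q : SymMulticatData.{u})

/-- Arrows with unspecified source and target, i.e. elements of `a(Q)`. -/
structure Arrow where
  {arity : ℕ}
  {src : Fin arity → Q.Obj}
  {tgt : Q.Obj}
  arr : Q.Hom src tgt

variable {Q}

/-- The symmetric action for a bijection between two lists of (necessarily equal) lengths. -/
def re {k n : ℕ} {x : Fin n → Q.Obj} {y : Q.Obj} {x' : Fin k → Q.Obj} (e : Fin k ≃ Fin n)
    (h : ∀ i, x' i = x (e i)) (f : Q.Hom x y) : Q.Hom x' y := by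
  obtain rfl : k = n := by simpa using Fintype.card_congr e
  obtain rfl : x' = x ∘ e := funext h
  exact Q.act f e

end SymMulticatData

open SymMulticatData in
/-- A symmetric multicategory with a category of objects. Equality of elements of `Q.Arrow`
includes equality of their sources and targets. -/
structure SymMulticat extends SymMulticatData.{u} where
  id_comp : ∀ {k : ℕ} {x : Fin k → Obj} {y : Obj} (f : Hom x y),
    (⟨comp (ι (𝟙 y)) (fun _ => f)⟩ : toSymMulticatData.Arrow) = ⟨f⟩
  comp_id : ∀ {k : ℕ} {x : Fin k → Obj} {y : Obj} (f : Hom x y),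
    (⟨comp f (fun i => ι (𝟙 (x i)))⟩ : toSymMulticatData.Arrow) = ⟨f⟩
  assoc : ∀ {k : ℕ} {x : Fin k → Obj} {y : Obj} (f : Hom x y) {m : Fin k → ℕ}
    {z : ∀ i, Fin (m i) → Obj} (g : ∀ i, Hom (z i) (x i)) {l : ∀ i, Fin (m i) → ℕ}
    {w : ∀ i j, Fin (l i j) → Obj} (h : ∀ i j, Hom (w i j) (z i j)),
    (⟨comp f (fun i => comp (g i) (h i))⟩ : toSymMulticatData.Arrow) =
      ⟨comp (comp f g) (fun p => h (finSigmaFinEquiv.symm p).1 (finSigmaFinEquiv.symm p).2)⟩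
  act_one : ∀ {k : ℕ} {x : Fin k → Obj} {y : Obj} (f : Hom x y), act f 1 = f
  act_act : ∀ {k : ℕ} {x : Fin k → Obj} {y : Obj} (f : Hom x y) (σ σ' : Equiv.Perm (Fin k)),
    act (act f σ) σ' = act f (σ * σ')
  act_comp : ∀ {k : ℕ} {x : Fin k → Obj} {y : Obj} (f : Hom x y) {m : Fin k → ℕ}
    {z : ∀ i, Fin (m i) → Obj} (g : ∀ i, Hom (z i) (x i)) (σ : Equiv.Perm (Fin k)),
    comp (act f σ) (fun i => g (σ i)) =
      re (Q := toSymMulticatData) (blockPerm σ m) (concat_blockPerm σ z) (comp f g)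
  comp_act : ∀ {k : ℕ} {x : Fin k → Obj} {y : Obj} (f : Hom x y) {m : Fin k → ℕ}
    {z : ∀ i, Fin (m i) → Obj} (g : ∀ i, Hom (z i) (x i)) (σ : ∀ i, Equiv.Perm (Fin (m i))),
    (⟨comp f (fun i => act (g i) (σ i))⟩ : toSymMulticatData.Arrow) =
      ⟨act (comp f g) (juxtPerm σ)⟩
  ι_comp : ∀ {x y z : Obj} (f : y ⟶ z) (g : x ⟶ y),
    (⟨ι (g ≫ f)⟩ : toSymMulticatData.Arrow) = ⟨comp (ι f) (fun _ => ι g)⟩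

end Opetopic

namespace Opetopic

theorem finSigma_lt_fst {n : ℕ} {m : Fin n → ℕ} {i i' : Fin n} (j : Fin (m i)) (j' : Fin (m i'))
    (h : i < i') :
    (finSigmaFinEquiv ⟨i, j⟩ : Fin (∑ i, m i)) < finSigmaFinEquiv ⟨i', j'⟩ := by
  rw [Fin.lt_def, finSigmaFinEquiv_apply, finSigmaFinEquiv_apply]
  let M : ℕ → ℕ := fun a => if h : a < n then m ⟨a, h⟩ else 0
  have key : ∀ k : Fin n, ∑ a : Fin k.1, m (Fin.castLE k.2.le a) = ∑ a ∈ Finset.range k.1, M a := by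
    intro k
    rw [← Fin.sum_univ_eq_sum_range]
    refine Finset.sum_congr rfl fun a _ => ?_
    have : (a : ℕ) < n := a.2.trans k.2
    simp only [M, this, dif_pos]; rfl
  have h1 := key i
  have h2 := key i'
  dsimp only at h1 h2 ⊢
  rw [h1, h2]
  have h3 : ∑ a ∈ Finset.range (i.1 + 1), M a ≤ ∑ a ∈ Finset.range i'.1, M a :=
    Finset.sum_le_sum_of_subset (Finset.range_mono h)
  rw [Finset.sum_range_succ] at h3
  have h4 : M i.1 = m i := by simp [M]
  have := j.2
  omega

theorem finSigma_lt_snd {n : ℕ} {m : Fin n → ℕ} {i : Fin n} {j j' : Fin (m i)} (h : j < j') :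
    (finSigmaFinEquiv ⟨i, j⟩ : Fin (∑ i, m i)) < finSigmaFinEquiv ⟨i, j'⟩ := by
  rw [Fin.lt_def, finSigmaFinEquiv_apply, finSigmaFinEquiv_apply]
  exact Nat.add_lt_add_left h _

theorem eq_finCongr_of_strictMono {a b : ℕ} (h : a = b) (f : Fin a → Fin b) (hf : StrictMono f)
    (x : Fin a) : f x = finCongr h x := by
  subst h
  have : (hf.orderIsoOfSurjective f
    (Finite.injective_iff_surjective.1 hf.injective)) = OrderIso.refl _ := Subsingleton.elim _ _
  exact congrArg (fun g : Fin a ≃o Fin a => g x) this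

theorem finSigma_assoc_lt {n : ℕ} {m : Fin n → ℕ} {l : ∀ i, Fin (m i) → ℕ}
    (a b : Σ i, Fin (m i)) (k : Fin (l a.1 a.2)) (k' : Fin (l b.1 b.2))
    (h : (finSigmaFinEquiv a : Fin (∑ i, m i)) < finSigmaFinEquiv b) :
    (finSigmaFinEquiv ⟨a.1, finSigmaFinEquiv ⟨a.2, k⟩⟩ : Fin (∑ i, ∑ j, l i j)) <
      finSigmaFinEquiv ⟨b.1, finSigmaFinEquiv ⟨b.2, k'⟩⟩ := by
  obtain ⟨i, j⟩ := a
  obtain ⟨i', j'⟩ := b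
  rcases lt_trichotomy i i' with h1 | h1 | h1
  · exact finSigma_lt_fst _ _ h1
  · subst h1
    rcases lt_trichotomy j j' with h2 | h2 | h2
    · exact finSigma_lt_snd (finSigma_lt_fst _ _ h2)
    · subst h2
      exact absurd h (lt_irrefl _)
    · exact absurd h (finSigma_lt_snd h2).asymm
  · exact absurd h (finSigma_lt_fst _ _ h1).asymm

/-- Both bracketings of an iterated concatenation put the same item at the same place. -/
theorem finSigma_assoc {n : ℕ} {m : Fin n → ℕ} {l : ∀ i, Fin (m i) → ℕ}
    (hN : ∑ p : Fin (∑ i, m i), l (finSigmaFinEquiv.symm p).1 (finSigmaFinEquiv.symm p).2 =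
      ∑ i, ∑ j, l i j)
    (q : Fin (∑ i, m i)) (k : Fin (l (finSigmaFinEquiv.symm q).1 (finSigmaFinEquiv.symm q).2)) :
    finCongr hN (finSigmaFinEquiv (n := fun p : Fin (∑ i, m i) =>
        l (finSigmaFinEquiv.symm p).1 (finSigmaFinEquiv.symm p).2) ⟨q, k⟩) =
      finSigmaFinEquiv ⟨(finSigmaFinEquiv.symm q).1,
        finSigmaFinEquiv ⟨(finSigmaFinEquiv.symm q).2, k⟩⟩ := by
  let L : Fin (∑ i, m i) → ℕ := fun p =>
    l (finSigmaFinEquiv.symm p).1 (finSigmaFinEquiv.symm p).2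
  let F : Fin (∑ p, L p) → Fin (∑ i, ∑ j, l i j) := fun x =>
    (fun s : Σ p, Fin (L p) => (finSigmaFinEquiv ⟨(finSigmaFinEquiv.symm s.1).1,
      finSigmaFinEquiv ⟨(finSigmaFinEquiv.symm s.1).2, s.2⟩⟩ : Fin (∑ i, ∑ j, l i j)))
        (finSigmaFinEquiv.symm x)
  have hF : ∀ p (k : Fin (L p)), F (finSigmaFinEquiv ⟨p, k⟩) =
      finSigmaFinEquiv ⟨(finSigmaFinEquiv.symm p).1,
        finSigmaFinEquiv ⟨(finSigmaFinEquiv.symm p).2, k⟩⟩ := by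
    intro p k
    simp only [F]
    rw [Equiv.symm_apply_apply]
  have hmono : StrictMono F := by
    intro x y hxy
    obtain ⟨⟨p, k⟩, rfl⟩ := finSigmaFinEquiv.surjective x
    obtain ⟨⟨p', k'⟩, rfl⟩ := finSigmaFinEquiv.surjective y
    rw [hF, hF]
    rcases lt_trichotomy p p' with h | h | h
    · exact finSigma_assoc_lt (finSigmaFinEquiv.symm p) (finSigmaFinEquiv.symm p') k k'
        (by simpa using h)
    · subst h
      rcases lt_trichotomy k k' with h | h | h
      · exact finSigma_lt_snd (finSigma_lt_snd h)
      · subst h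
        exact absurd hxy (lt_irrefl _)
      · exact absurd hxy (finSigma_lt_snd h).asymm
    · exact absurd hxy (finSigma_lt_fst _ _ h).asymm
  rw [← hF, eq_finCongr_of_strictMono hN F hmono]

theorem finSigma_assoc_sum {n : ℕ} {m : Fin n → ℕ} (l : ∀ i, Fin (m i) → ℕ) :
    ∑ p : Fin (∑ i, m i), l (finSigmaFinEquiv.symm p).1 (finSigmaFinEquiv.symm p).2 =
      ∑ i, ∑ j, l i j := by
  rw [← Fintype.sum_sigma (fun s : Σ i, Fin (m i) => l s.1 s.2)]
  exact Equiv.sum_comp finSigmaFinEquiv.symm (fun s : Σ i, Fin (m i) => l s.1 s.2)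

theorem concat_concat {X : Type*} {n : ℕ} {m : Fin n → ℕ} {l : ∀ i, Fin (m i) → ℕ}
    (z : ∀ i j, Fin (l i j) → X)
    (hN : ∑ p : Fin (∑ i, m i), l (finSigmaFinEquiv.symm p).1 (finSigmaFinEquiv.symm p).2 =
      ∑ i, ∑ j, l i j) (q) :
    concat (fun p : Fin (∑ i, m i) => z (finSigmaFinEquiv.symm p).1 (finSigmaFinEquiv.symm p).2) q
      = concat (fun i => concat (z i)) (finCongr hN q) := by
  obtain ⟨⟨p, k⟩, rfl⟩ := finSigmaFinEquiv.surjective q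
  rw [concat_apply, finSigma_assoc, concat_apply, concat_apply]

theorem fin_one_concat {X : Type*} {k : ℕ} (x : Fin k → X) (hk : ∑ _i : Fin 1, k = k)
    (i : Fin (∑ _i : Fin 1, k)) : concat (fun _ : Fin 1 => x) i = x (finCongr hk i) := by
  obtain ⟨⟨a, j⟩, rfl⟩ := finSigmaFinEquiv.surjective i
  rw [concat_apply]
  congr 1
  apply Fin.ext
  have := finSigmaFinEquiv_one (n := fun _ => k) ⟨a, j⟩
  simp [this]

theorem concat_fin_one {X : Type*} {k : ℕ} (x : Fin k → X) (hk : ∑ _i : Fin k, 1 = k)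
    (i : Fin (∑ _i : Fin k, 1)) :
    concat (fun i : Fin k => fun _ : Fin 1 => x i) i = x (finCongr hk i) := by
  obtain ⟨⟨a, j⟩, rfl⟩ := finSigmaFinEquiv.surjective i
  rw [concat_apply]
  congr 1
  apply Fin.ext
  simp [finSigmaFinEquiv_apply]

namespace SymMulticat

open SymMulticatData

variable {Q : SymMulticat.{u}}

theorem re_self {k : ℕ} {x : Fin k → Q.Obj} {y : Q.Obj} (σ : Equiv.Perm (Fin k))
    (f : Q.Hom x y) : re σ (fun _ => rfl) f = Q.act f σ := rfl

theorem re_refl {k : ℕ} {x : Fin k → Q.Obj} {y : Q.Obj}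
    (h : ∀ i, x i = x (Equiv.refl (Fin k) i)) (f : Q.Hom x y) :
    re (Equiv.refl _) h f = f := by
  have : re (Equiv.refl _) h f = Q.act f 1 := rfl
  rw [this, Q.act_one]

theorem re_re {k n l : ℕ} {x : Fin n → Q.Obj} {y : Q.Obj} {x' : Fin k → Q.Obj}
    {x'' : Fin l → Q.Obj} (e : Fin k ≃ Fin n) (h : ∀ i, x' i = x (e i)) (f : Q.Hom x y)
    (e' : Fin l ≃ Fin k) (h' : ∀ i, x'' i = x' (e' i)) :
    re e' h' (re e h f) = re (e'.trans e) (fun i => (h' i).trans (h _)) f := by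
  obtain rfl : k = n := by simpa using Fintype.card_congr e
  obtain rfl : l = k := by simpa using Fintype.card_congr e'
  obtain rfl : x' = x ∘ e := funext h
  obtain rfl : x'' = (x ∘ e) ∘ e' := funext h'
  exact Q.act_act f e e'

theorem re_cast_eq {k n : ℕ} {x : Fin n → Q.Obj} {y : Q.Obj} {x' : Fin k → Q.Obj}
    (f : Q.Hom x y) (f' : Q.Hom x' y) (hk : k = n) (h : ∀ i, x' i = x (finCongr hk i))
    (hf : (⟨f'⟩ : Q.Arrow) = ⟨f⟩) : f' = re (finCongr hk) h f := by
  subst hk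
  obtain rfl : x' = x := funext h
  have h1 : f' = f := by simpa using hf
  subst h1
  exact (re_refl _ _).symm

/-- Arrows with a finite list of named inputs. -/
structure RawBag {A : Type w} (zs : A → Q.Obj) (y : Q.Obj) where
  {n : ℕ}
  nm : Fin n → A
  arr : Q.Hom (zs ∘ nm) y

variable {A : Type w} {B : Type v}

instance bagSetoid (zs : A → Q.Obj) (y : Q.Obj) : Setoid (RawBag zs y) where
  r a b := ∃ e : Fin b.n ≃ Fin a.n, ∃ h : ∀ i, b.nm i = a.nm (e i),
    b.arr = re e (fun i => congrArg zs (h i)) a.arr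
  iseqv :=
    { refl := fun a => ⟨Equiv.refl _, fun _ => rfl, (re_refl _ _).symm⟩
      symm := by
        rintro a b ⟨e, h, hf⟩
        refine ⟨e.symm, fun i => by simp [h], ?_⟩
        rw [hf, re_re]
        have h1 : e.symm.trans e = Equiv.refl _ := by simp
        generalize_proofs h2
        revert h2
        rw [h1]
        intro h2
        exact (re_refl _ _).symm
      trans := by
        rintro a b c ⟨e, h, hf⟩ ⟨e', h', hf'⟩
        refine ⟨e'.trans e, fun i => by simp [h, h'], ?_⟩
        rw [hf', hf, re_re] }

/-- Arrows with a finite multiset of named inputs, `zs a` being the object at an input named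
`a`. -/
def Bag (zs : A → Q.Obj) (y : Q.Obj) : Type _ := Quotient (bagSetoid zs y)

namespace Bag

/-- The class of an arrow whose inputs are named by `nm`. -/
def mk (zs : A → Q.Obj) {y : Q.Obj} {n : ℕ} (nm : Fin n → A) (f : Q.Hom (zs ∘ nm) y) :
    Bag zs y := Quotient.mk _ ⟨nm, f⟩

theorem mk_eq_mk {zs : A → Q.Obj} {y : Q.Obj} {n n' : ℕ} {nm : Fin n → A} {nm' : Fin n' → A}
    {f : Q.Hom (zs ∘ nm) y} {f' : Q.Hom (zs ∘ nm') y} :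
    mk zs nm f = mk zs nm' f' ↔ ∃ e : Fin n' ≃ Fin n, ∃ h : ∀ i, nm' i = nm (e i),
      f' = re e (fun i => congrArg zs (h i)) f := Quotient.eq

theorem mk_re {zs : A → Q.Obj} {y : Q.Obj} {n n' : ℕ} (nm : Fin n → A) (nm' : Fin n' → A)
    (f : Q.Hom (zs ∘ nm) y) (e : Fin n' ≃ Fin n) (h : ∀ i, (zs ∘ nm') i = (zs ∘ nm) (e i))
    (hn : ∀ i, nm' i = nm (e i)) : mk zs nm' (re e h f) = mk zs nm f :=
  (mk_eq_mk.2 ⟨e, hn, rfl⟩).symm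

theorem mk_congr {zs : A → Q.Obj} {y : Q.Obj} {n n' : ℕ} {nm : Fin n → A} {nm' : Fin n' → A}
    {f : Q.Hom (zs ∘ nm) y} {f' : Q.Hom (zs ∘ nm') y} (hk : n' = n)
    (h : ∀ i, nm' i = nm (finCongr hk i)) (hf : (⟨f'⟩ : Q.Arrow) = ⟨f⟩) :
    mk zs nm' f' = mk zs nm f := by
  rw [re_cast_eq f f' hk (fun i => congrArg zs (h i)) hf]
  exact mk_re _ _ _ _ _ h

theorem exists_rep {zs : A → Q.Obj} {y : Q.Obj} (b : Bag zs y) :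
    ∃ (n : ℕ) (nm : Fin n → A) (f : Q.Hom (zs ∘ nm) y), b = mk zs nm f := by
  induction b using Quotient.ind with
  | _ a => exact ⟨_, a.nm, a.arr, rfl⟩

/-- The arrow `f` whose inputs are named by their positions. -/
def of {k : ℕ} {x : Fin k → Q.Obj} {y : Q.Obj} (f : Q.Hom x y) : Bag x y := mk x id f

/-- Composition of arrows with named inputs. -/
noncomputable def bind {ws : A → Q.Obj} {zs : B → Q.Obj} {y : Q.Obj} (b : Bag ws y)
    (U : ∀ a, Bag zs (ws a)) : Bag zs y :=
  Quotient.lift (s := bagSetoid ws y)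
    (fun b => mk zs (concat fun i => (Quotient.out (U (b.nm i))).nm)
      (Q.comp b.arr fun i => (Quotient.out (U (b.nm i))).arr))
    (by
      rintro ⟨nm, f⟩ ⟨nm', f'⟩ ⟨e, h, hf⟩
      rename_i k k'
      dsimp only at e h hf ⊢
      obtain rfl : k' = k := by simpa using Fintype.card_congr e
      obtain rfl : nm' = nm ∘ e := funext h
      obtain rfl : f' = Q.act f e := hf
      symm
      have h1 := Q.act_comp f (fun i => (Quotient.out (U (nm i))).arr) e
      exact (congrArg (mk zs (concat fun i => (Quotient.out (U (nm (e i)))).nm)) h1).trans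
        (mk_re (concat fun i => (Quotient.out (U (nm i))).nm) _ _ _ _
          (concat_blockPerm e fun i => (Quotient.out (U (nm i))).nm))) b

theorem bind_mk_out {ws : A → Q.Obj} {zs : B → Q.Obj} {y : Q.Obj} {n : ℕ} (nm : Fin n → A)
    (f : Q.Hom (ws ∘ nm) y) (U : ∀ a, Bag zs (ws a)) :
    bind (mk ws nm f) U = mk zs (concat fun i => (Quotient.out (U (nm i))).nm)
      (Q.comp f fun i => (Quotient.out (U (nm i))).arr) := rfl

theorem mk_comp_re {xs : Type*} {ws : xs → Q.Obj} {zs : B → Q.Obj} {y : Q.Obj} {n : ℕ}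
    {nm : Fin n → xs} (f : Q.Hom (ws ∘ nm) y) {m m' : Fin n → ℕ}
    (nm' : ∀ i, Fin (m i) → B) (nm'' : ∀ i, Fin (m' i) → B)
    (g : ∀ i, Q.Hom (zs ∘ nm' i) (ws (nm i))) (g' : ∀ i, Q.Hom (zs ∘ nm'' i) (ws (nm i)))
    (h : ∀ i, mk zs (nm' i) (g i) = mk zs (nm'' i) (g' i)) :
    mk zs (concat nm') (Q.comp f g) = mk zs (concat nm'') (Q.comp f g') := by
  choose e he hg using fun i => mk_eq_mk.1 (h i)
  obtain rfl : m' = m := funext fun i => by simpa using Fintype.card_congr (e i)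
  obtain rfl : nm'' = fun i => nm' i ∘ e i := funext fun i => funext (he i)
  obtain rfl : g' = fun i => Q.act (g i) (e i) := funext hg
  have h1 := Q.comp_act f g e
  have key : ∀ p, concat (fun i => nm' i ∘ e i) p = concat nm' (juxtPerm e p) := by
    intro p
    obtain ⟨⟨i, j⟩, rfl⟩ := finSigmaFinEquiv.surjective p
    rw [concat_apply]
    have : juxtPerm e (finSigmaFinEquiv ⟨i, j⟩) = finSigmaFinEquiv ⟨i, e i j⟩ := by
      simp [juxtPerm]
    rw [this, concat_apply]; rfl
  have h2 := mk_re (zs := zs) (concat nm') (concat fun i => nm' i ∘ e i) (Q.comp f g) (juxtPerm e)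
    (fun i => congrArg zs (key i)) key
  rw [← h2]
  symm
  refine mk_congr rfl (fun _ => rfl) ?_
  refine h1.trans ?_
  have h3 : ∀ {x' : Fin (∑ i, m' i) → Q.Obj} (hx : ∀ i, x' i = (zs ∘ concat nm') (juxtPerm e i)),
      (⟨Q.act (Q.comp f g) (juxtPerm e)⟩ : Q.Arrow) = ⟨re (juxtPerm e) hx (Q.comp f g)⟩ := by
    intro x' hx
    obtain rfl : x' = _ := funext hx
    rfl
  exact h3 _

theorem bind_mk {ws : A → Q.Obj} {zs : B → Q.Obj} {y : Q.Obj} {n : ℕ} (nm : Fin n → A)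
    (f : Q.Hom (ws ∘ nm) y) (U : ∀ a, Bag zs (ws a)) {m : Fin n → ℕ}
    (nm' : ∀ i, Fin (m i) → B) (g : ∀ i, Q.Hom (zs ∘ nm' i) (ws (nm i)))
    (h : ∀ i, U (nm i) = mk zs (nm' i) (g i)) :
    bind (mk ws nm f) U = mk zs (concat nm') (Q.comp f g) := by
  rw [bind_mk_out]
  refine mk_comp_re f _ _ _ _ fun i => ?_
  rw [← h]
  exact Quotient.out_eq _

/-- The object-morphism `a`, its input being named by `l`. -/
def var {zs : A → Q.Obj} {y : Q.Obj} (l : A) (a : zs l ⟶ y) : Bag zs y :=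
  mk zs (fun _ : Fin 1 => l) (Q.ι a)

theorem pure_bind {zs : A → Q.Obj} {ws : B → Q.Obj} (l : B) (U : ∀ a, Bag zs (ws a)) :
    bind (var l (𝟙 (ws l))) U = U l := by
  obtain ⟨n, nm, f, hf⟩ := exists_rep (U l)
  have := bind_mk (fun _ : Fin 1 => l) (Q.ι (𝟙 (ws l))) U (fun _ => nm) (fun _ => f)
    (fun _ => hf)
  rw [var, this, hf]
  exact mk_congr (by simp) (fun i => fin_one_concat nm (by simp) i) (Q.id_comp f)

theorem bind_pure {zs : A → Q.Obj} {y : Q.Obj} (b : Bag zs y) :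
    bind b (fun a => var a (𝟙 (zs a))) = b := by
  obtain ⟨n, nm, f, rfl⟩ := exists_rep b
  rw [bind_mk nm f _ (fun i _ => nm i) (fun i => Q.ι (𝟙 (zs (nm i)))) (fun _ => rfl)]
  exact mk_congr (by simp) (fun i => concat_fin_one nm (by simp) i) (Q.comp_id f)

theorem bind_assoc {C : Type*} {ws : A → Q.Obj} {zs : B → Q.Obj} {vs : C → Q.Obj} {y : Q.Obj}
    (b : Bag ws y) (U : ∀ a, Bag zs (ws a)) (V : ∀ c, Bag vs (zs c)) :
    bind (bind b U) V = bind b (fun a => bind (U a) V) := by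
  obtain ⟨n, nm, f, rfl⟩ := exists_rep b
  choose m nm' g hg using fun i => exists_rep (U (nm i))
  choose l nm'' h hh using fun i j => exists_rep (V (nm' i j))
  have h1 : ∀ i, bind (U (nm i)) V = mk vs (concat (nm'' i)) (Q.comp (g i) (h i)) := fun i => by
    rw [hg i]; exact bind_mk _ _ _ _ _ (hh i)
  rw [bind_mk nm f (fun a => bind (U a) V) _ _ h1, bind_mk nm f U nm' g hg,
    bind_mk (concat nm') (Q.comp f g) V
      (fun p => nm'' (finSigmaFinEquiv.symm p).1 (finSigmaFinEquiv.symm p).2)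
      (fun p => h (finSigmaFinEquiv.symm p).1 (finSigmaFinEquiv.symm p).2)
      (fun p => hh (finSigmaFinEquiv.symm p).1 (finSigmaFinEquiv.symm p).2)]
  exact mk_congr (finSigma_assoc_sum l) (fun i => concat_concat nm'' _ i) (Q.assoc f g h).symm

theorem var_var {ws : A → Q.Obj} {y y' : Q.Obj} (l : A) (a : ws l ⟶ y) (b : y ⟶ y') :
    var l (a ≫ b) = bind (var (zs := fun _ : Unit => y) () b) (fun _ => var (zs := ws) l a) := by
  have h := bind_mk (ws := fun _ : Unit => y) (fun _ : Fin 1 => ()) (Q.ι b)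
    (fun _ => var (zs := ws) l a) (fun _ _ => l) (fun _ => Q.ι a) (fun _ => rfl)
  refine Eq.trans ?_ h.symm
  exact mk_congr (by simp) (fun i => rfl) (Q.ι_comp b a)

/-- Composition with an object-morphism at the target. -/
noncomputable def push {zs : A → Q.Obj} {y y' : Q.Obj} (a : y ⟶ y') (b : Bag zs y) : Bag zs y' :=
  bind (var (zs := fun _ : Unit => y) () a) (fun _ => b)

theorem push_var {zs : A → Q.Obj} {y y' : Q.Obj} (l : A) (a : zs l ⟶ y) (b : y ⟶ y') :
    push b (var (zs := zs) l a) = var l (a ≫ b) := (var_var l a b).symm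

theorem push_id {zs : A → Q.Obj} {y : Q.Obj} (b : Bag zs y) : push (𝟙 y) b = b :=
  pure_bind (ws := fun _ : Unit => y) () (fun _ => b)

theorem bind_push {ws : A → Q.Obj} {zs : B → Q.Obj} {y y' : Q.Obj} (a : y ⟶ y') (b : Bag ws y)
    (U : ∀ a, Bag zs (ws a)) : bind (push a b) U = push a (bind b U) := bind_assoc _ _ _

theorem push_push {zs : A → Q.Obj} {y y' y'' : Q.Obj} (a : y ⟶ y') (a' : y' ⟶ y'')
    (b : Bag zs y) : push a' (push a b) = push (a ≫ a') b := by
  unfold push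
  rw [var_var, bind_assoc]

theorem bind_var {ws : A → Q.Obj} {zs : B → Q.Obj} {y : Q.Obj} (l : A) (a : ws l ⟶ y)
    (U : ∀ a, Bag zs (ws a)) : bind (var l a) U = push a (U l) := by
  rw [← Category.id_comp a, ← push_var, bind_push, pure_bind, Category.id_comp]

theorem push_mk {zs : A → Q.Obj} {y y' : Q.Obj} (a : y ⟶ y') {n : ℕ} (nm : Fin n → A)
    (f : Q.Hom (zs ∘ nm) y) :
    push a (mk zs nm f) = mk zs (concat fun _ => nm) (Q.comp (Q.ι a) fun _ => f) :=
  bind_mk (ws := fun _ : Unit => y) (fun _ : Fin 1 => ()) (Q.ι a) (fun _ => mk zs nm f)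
    (fun _ => nm) (fun _ => f) (fun _ => rfl)

end Bag

end SymMulticat

end Opetopic

namespace Opetopic
namespace SymMulticat
open SymMulticatData

variable {Q : SymMulticat.{u}}

/-- `f = gσ` for the permutation `σ` of the inputs determined by `nm`: input `i` of `f` is the
(unique) input of `g` named `i`. -/
def IsPermuted {k n : ℕ} {x : Fin k → Q.Obj} {y : Q.Obj} (nm : Fin n → Fin k)
    (g : Q.Hom (x ∘ nm) y) (f : Q.Hom x y) : Prop :=
  ∃ (σ : Fin k ≃ Fin n) (h : ∀ i, i = nm (σ i)), f = re σ (fun i => congrArg x (h i)) g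

theorem isPermuted_iff {k n : ℕ} {x : Fin k → Q.Obj} {y : Q.Obj} {nm : Fin n → Fin k}
    {g : Q.Hom (x ∘ nm) y} {f : Q.Hom x y} : IsPermuted nm g f ↔ Bag.mk x nm g = Bag.of f :=
  Bag.mk_eq_mk.symm

variable (Q) in
/-- The objects of the category `elt(Q)`: arrows of `Q` with their source and target. -/
abbrev Elt : Type u := Q.toSymMulticatData.Arrow

/-- A morphism `(σ, f₁,…,f_m; f) : α ⟶ β` of `elt(Q)`: object-morphisms `f_j` and `f`, and a
permutation `σ`, such that `β = (ι(f) ∘ α ∘ (ι(f₁),…,ι(f_m)))σ`. Here `perm` is the inverse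
of `σ`. -/
@[ext]
structure EltHom (α β : Elt Q) where
  perm : Fin α.arity ≃ Fin β.arity
  srcMap : ∀ j, β.src (perm j) ⟶ α.src j
  tgtMap : α.tgt ⟶ β.tgt
  isPermuted : IsPermuted (x := β.src)
    (concat fun _ : Fin 1 => concat fun j => fun _ : Fin 1 => perm j)
    (Q.comp (Q.ι tgtMap) fun _ => Q.comp α.arr fun j => Q.ι (srcMap j)) β.arr

theorem bag_node {A : Type w} {zs : A → Q.Obj} {α : Elt Q} {y : Q.Obj} (a : α.tgt ⟶ y)
    {m : Fin α.arity → ℕ} (nm : ∀ i, Fin (m i) → A) (g : ∀ i, Q.Hom (zs ∘ nm i) (α.src i)) :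
    Bag.mk zs (concat fun _ : Fin 1 => concat nm)
      (Q.comp (Q.ι a) fun _ => Q.comp α.arr g) =
    Bag.push a (Bag.bind (Bag.of α.arr) fun i => Bag.mk zs (nm i) (g i)) := by
  have h : Bag.bind (Bag.of α.arr) (fun i => Bag.mk zs (nm i) (g i)) = _ :=
    Bag.bind_mk id α.arr _ nm g (fun _ => rfl)
  rw [h]
  exact (Bag.push_mk a _ _).symm

theorem EltHom.bag {α β : Elt Q} (φ : EltHom α β) :
    Bag.push φ.tgtMap (Bag.bind (Bag.of α.arr) fun j => Bag.var (φ.perm j) (φ.srcMap j)) =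
      Bag.of β.arr := by
  rw [← isPermuted_iff.1 φ.isPermuted]
  exact (bag_node φ.tgtMap (zs := β.src) (fun j _ => φ.perm j) fun j => Q.ι (φ.srcMap j)).symm

theorem isPermuted_of_bag {α β : Elt Q} (perm : Fin α.arity ≃ Fin β.arity)
    (srcMap : ∀ j, β.src (perm j) ⟶ α.src j) (tgtMap : α.tgt ⟶ β.tgt)
    (h : Bag.push tgtMap (Bag.bind (Bag.of α.arr) fun j => Bag.var (perm j) (srcMap j)) =
      Bag.of β.arr) : IsPermuted (x := β.src)
    (concat fun _ : Fin 1 => concat fun j => fun _ : Fin 1 => perm j)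
    (Q.comp (Q.ι tgtMap) fun _ => Q.comp α.arr fun j => Q.ι (srcMap j)) β.arr := by
  refine isPermuted_iff.2 (Eq.trans ?_ h)
  exact bag_node tgtMap (zs := β.src) (fun j _ => perm j) fun j => Q.ι (srcMap j)

/-- The category `elt(Q)`. -/
instance : SmallCategory (Elt Q) where
  Hom := EltHom
  id α := ⟨Equiv.refl _, fun j => 𝟙 _, 𝟙 _, isPermuted_of_bag _ _ _ (by
    rw [Bag.push_id]; exact Bag.bind_pure _)⟩
  comp {α β γ} φ ψ := ⟨φ.perm.trans ψ.perm, fun j => ψ.srcMap (φ.perm j) ≫ φ.srcMap j,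
    φ.tgtMap ≫ ψ.tgtMap, isPermuted_of_bag _ _ _ (by
      rw [← ψ.bag, ← φ.bag, Bag.bind_push, Bag.push_push, Bag.bind_assoc]
      congr 2
      funext j
      rw [Bag.bind_var, Bag.push_var]
      rfl)⟩
  id_comp φ := by
    refine EltHom.ext ?_ ?_ ?_
    · rfl
    · exact heq_of_eq (funext fun j => Category.comp_id _)
    · exact Category.id_comp _
  comp_id φ := by
    refine EltHom.ext ?_ ?_ ?_
    · rfl
    · exact heq_of_eq (funext fun j => Category.id_comp _)
    · exact Category.comp_id _
  assoc φ ψ χ := by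
    refine EltHom.ext ?_ ?_ ?_
    · rfl
    · exact heq_of_eq (funext fun j => (Category.assoc _ _ _).symm)
    · exact Category.assoc _ _ _

/-- Planar trees whose nodes are labelled by arrows of `Q` and whose edges are labelled by
object-morphisms of `Q`. Every node has a name `b : B`, and is labelled by `fs b`; every leaf has
a name `l : A`, and its label has domain `zs l`. The root edge has a label with codomain `y`.
A tree is either a single edge, or a node with the edge coming out of it, and with a tree for
each of the edges going into it. -/
inductive Tree {A B : Type} (fs : B → Elt Q) (zs : A → Q.Obj) : Q.Obj → Type u
  | edge {y : Q.Obj} (l : A) (a : zs l ⟶ y) : Tree fs zs y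
  | node {y : Q.Obj} (b : B) (g : Elt Q) (hg : g = fs b) (a : g.tgt ⟶ y)
      (ch : ∀ i : Fin g.arity, Tree fs zs (g.src i)) : Tree fs zs y

namespace Tree

variable {A B B' B'' : Type} {fs : B → Elt Q} {zs : A → Q.Obj} {y : Q.Obj}

/-- The number of leaves. -/
def numLeaves : ∀ {y : Q.Obj}, Tree fs zs y → ℕ
  | _, edge _ _ => 1
  | _, node _ _ _ _ ch => ∑ _i : Fin 1, ∑ i, (ch i).numLeaves

/-- The names of the leaves in their planar order. -/
def leafName : ∀ {y : Q.Obj} (T : Tree fs zs y), Fin T.numLeaves → A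
  | _, edge l _ => fun _ => l
  | _, node _ _ _ _ ch => concat fun _ : Fin 1 => concat fun i => (ch i).leafName

/-- The multiset of the names of the nodes. -/
def nodes : ∀ {y : Q.Obj}, Tree fs zs y → Multiset B
  | _, edge _ _ => 0
  | _, node b _ _ _ ch => b ::ₘ ∑ i, (ch i).nodes

/-- The composite in `Q` of the labels of nodes and edges, according to their positions. -/
def eval : ∀ {y : Q.Obj} (T : Tree fs zs y), Q.Hom (zs ∘ T.leafName) y
  | _, edge _ a => Q.ι a
  | _, node _ g _ a ch => Q.comp (Q.ι a) fun _ : Fin 1 => Q.comp g.arr fun i => (ch i).eval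

/-- Composing the label of the root edge with an object-morphism. -/
def postcomp : ∀ {y y' : Q.Obj}, Tree fs zs y → (y ⟶ y') → Tree fs zs y'
  | _, _, edge l a, c => edge l (a ≫ c)
  | _, _, node b g hg a ch, c => node b g hg (a ≫ c) ch

/-- Grafting trees onto the leaves of a tree. -/
def graft {A' : Type} {ws : A' → Q.Obj} :
    ∀ {y : Q.Obj}, Tree fs ws y → (∀ l, Tree fs zs (ws l)) → Tree fs zs y
  | _, edge l a, U => (U l).postcomp a
  | _, node b g hg a ch, U => node b g hg a fun i => (ch i).graft U

/-- Replacing every node by a tree whose leaves are named by the inputs of the node. -/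
def subst {gs : B' → Elt Q} (R : ∀ b (g : Elt Q), g = fs b → Tree gs g.src g.tgt) :
    ∀ {y : Q.Obj}, Tree fs zs y → Tree gs zs y
  | _, edge l a => edge l a
  | _, node b g hg a ch => ((R b g hg).graft fun i => (ch i).subst R).postcomp a

/-- Renaming the nodes. -/
def rename {gs : B' → Elt Q} (φ : B → B') (h : ∀ b, fs b = gs (φ b)) :
    ∀ {y : Q.Obj}, Tree fs zs y → Tree gs zs y
  | _, edge l a => edge l a
  | _, node b g hg a ch => node (φ b) g (hg.trans (h b)) a fun i => (ch i).rename φ h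

theorem postcomp_edge' {y y' : Q.Obj} (l : A) (a : zs l ⟶ y) (c : y ⟶ y') :
    (edge (fs := fs) l a).postcomp c = edge l (a ≫ c) := rfl

theorem postcomp_node' {y y' : Q.Obj} (b : B) (g : Elt Q) (hg : g = fs b) (a : g.tgt ⟶ y)
    (ch : ∀ i : Fin g.arity, Tree fs zs (g.src i)) (c : y ⟶ y') :
    (node b g hg a ch).postcomp c = node b g hg (a ≫ c) ch := rfl

theorem postcomp_id : ∀ {y : Q.Obj} (T : Tree fs zs y), T.postcomp (𝟙 y) = T
  | _, edge _ _ => by simp [postcomp_edge']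
  | _, node _ _ _ _ _ => by simp [postcomp_node']

theorem postcomp_postcomp : ∀ {y y' y'' : Q.Obj} (T : Tree fs zs y) (a : y ⟶ y') (b : y' ⟶ y''),
    (T.postcomp a).postcomp b = T.postcomp (a ≫ b)
  | _, _, _, edge _ _, _, _ => by simp [postcomp_edge']
  | _, _, _, node _ _ _ _ _, _, _ => by simp [postcomp_node']

theorem postcomp_graft {A' : Type} {ws : A' → Q.Obj} {y y' : Q.Obj} (T : Tree fs ws y)
    (U : ∀ l, Tree fs zs (ws l)) (a : y ⟶ y') :
    (T.postcomp a).graft U = (T.graft U).postcomp a := by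
  cases T <;> simp [postcomp_edge', postcomp_node', graft, postcomp_postcomp]

theorem graft_graft {A' A'' : Type} {ws : A' → Q.Obj} {vs : A'' → Q.Obj} {y : Q.Obj}
    (T : Tree fs ws y) (U : ∀ l, Tree fs zs (ws l)) (V : ∀ l, Tree fs vs (zs l)) :
    (T.graft U).graft V = T.graft fun l => (U l).graft V := by
  induction T with
  | edge l a => simp [graft, postcomp_graft]
  | node b g hg a ch ih => simp [graft, ih]

theorem graft_edge {y : Q.Obj} (T : Tree fs zs y) : T.graft (fun l => edge l (𝟙 _)) = T := by
  induction T with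
  | edge l a => simp [graft, postcomp_edge']
  | node b g hg a ch ih => simp [graft, ih]

section
variable {gs : B' → Elt Q} {hs : B'' → Elt Q}

theorem postcomp_subst (R : ∀ b (g : Elt Q), g = fs b → Tree gs g.src g.tgt) {y y' : Q.Obj}
    (T : Tree fs zs y) (a : y ⟶ y') : (T.postcomp a).subst R = (T.subst R).postcomp a := by
  cases T <;> simp [postcomp_edge', postcomp_node', subst, postcomp_postcomp]

theorem graft_subst {A' : Type} {ws : A' → Q.Obj}
    (R : ∀ b (g : Elt Q), g = fs b → Tree gs g.src g.tgt) {y : Q.Obj}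
    (T : Tree fs ws y) (U : ∀ l, Tree fs zs (ws l)) :
    (T.graft U).subst R = (T.subst R).graft fun l => (U l).subst R := by
  induction T with
  | edge l a => simp [graft, subst, postcomp_subst]
  | node b g hg a ch ih => simp [graft, subst, ih, postcomp_graft, graft_graft]

theorem subst_subst (R : ∀ b (g : Elt Q), g = fs b → Tree gs g.src g.tgt)
    (S : ∀ b (g : Elt Q), g = gs b → Tree hs g.src g.tgt) {y : Q.Obj} (T : Tree fs zs y) :
    (T.subst R).subst S = T.subst fun b g hg => (R b g hg).subst S := by
  induction T with
  | edge l a => simp [subst]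
  | node b g hg a ch ih => simp [subst, ih, postcomp_subst, graft_subst]

theorem rename_subst (φ : B → B') (h : ∀ b, fs b = gs (φ b))
    (S : ∀ b (g : Elt Q), g = gs b → Tree hs g.src g.tgt) {y : Q.Obj} (T : Tree fs zs y) :
    (T.rename φ h).subst S = T.subst fun b g hg => S (φ b) g (hg.trans (h b)) := by
  induction T with
  | edge l a => simp [subst, rename]
  | node b g hg a ch ih => simp [subst, rename, ih]

theorem rename_rename (φ : B → B') (h : ∀ b, fs b = gs (φ b)) (φ' : B' → B'')
    (h' : ∀ b, gs b = hs (φ' b)) {y : Q.Obj} (T : Tree fs zs y) :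
    (T.rename φ h).rename φ' h' = T.rename (φ' ∘ φ) (fun b => (h b).trans (h' _)) := by
  induction T with
  | edge l a => simp [rename]
  | node b g hg a ch ih => simp [rename, ih]

theorem rename_congr (φ ψ : B → B') (h : ∀ b, fs b = gs (φ b)) (hφ : ∀ b, φ b = ψ b)
    {y : Q.Obj} (T : Tree fs zs y) :
    T.rename φ h = T.rename ψ (fun b => hφ b ▸ h b) := by
  obtain rfl : φ = ψ := funext hφ
  rfl

theorem rename_id (h : ∀ b, fs b = fs (id b)) {y : Q.Obj} (T : Tree fs zs y) :
    T.rename id h = T := by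
  induction T with
  | edge l a => simp [rename]
  | node b g hg a ch ih => simp [rename, ih]

theorem rename_postcomp (φ : B → B') (h : ∀ b, fs b = gs (φ b)) {y y' : Q.Obj}
    (T : Tree fs zs y) (a : y ⟶ y') :
    (T.postcomp a).rename φ h = (T.rename φ h).postcomp a := by
  cases T <;> simp [postcomp_edge', postcomp_node', rename]

theorem rename_graft {A' : Type} {ws : A' → Q.Obj} (φ : B → B') (h : ∀ b, fs b = gs (φ b))
    {y : Q.Obj} (T : Tree fs ws y) (U : ∀ l, Tree fs zs (ws l)) :
    (T.graft U).rename φ h = (T.rename φ h).graft fun l => (U l).rename φ h := by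
  induction T with
  | edge l a => simp [graft, rename, rename_postcomp]
  | node b g hg a ch ih => simp [graft, rename, ih]

theorem subst_rename (φ : B' → B'') (h : ∀ b, gs b = hs (φ b))
    (R : ∀ b (g : Elt Q), g = fs b → Tree gs g.src g.tgt) {y : Q.Obj} (T : Tree fs zs y) :
    (T.subst R).rename φ h = T.subst fun b g hg => (R b g hg).rename φ h := by
  induction T with
  | edge l a => simp [subst, rename]
  | node b g hg a ch ih => simp [subst, ih, rename_postcomp, rename_graft]

/-- A tree with a single node. -/
def single (b : B) (g : Elt Q) (hg : g = fs b) {y : Q.Obj} (a : g.tgt ⟶ y)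
    (nm : Fin g.arity → A) (c : ∀ i, zs (nm i) ⟶ g.src i) : Tree fs zs y :=
  node b g hg a fun i => edge (nm i) (c i)

theorem subst_single (T : Tree fs zs y) (φ : B → B') (h : ∀ b, fs b = gs (φ b)) :
    T.subst (fun b g hg => single (φ b) g (hg.trans (h b)) (𝟙 _) id (fun _ => 𝟙 _)) =
      T.rename φ h := by
  induction T with
  | edge l a => simp [subst, rename]
  | node b g hg a ch ih => 
    simp [subst, rename, single, graft, postcomp_node', postcomp_id]
    exact funext ih

end

/-- The composite of a tree, as an arrow with named inputs. -/
def ev (T : Tree fs zs y) : Bag zs y := Bag.mk zs T.leafName T.eval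

theorem ev_edge (l : A) (a : zs l ⟶ y) : ev (edge (fs := fs) l a) = Bag.var l a := rfl

theorem ev_node (b : B) (g : Elt Q) (hg : g = fs b) (a : g.tgt ⟶ y)
    (ch : ∀ i : Fin g.arity, Tree fs zs (g.src i)) :
    ev (node b g hg a ch) = Bag.push a (Bag.bind (Bag.of g.arr) fun i => (ch i).ev) :=
  bag_node a (fun i => (ch i).leafName) fun i => (ch i).eval

theorem ev_postcomp {y' : Q.Obj} (T : Tree fs zs y) (a : y ⟶ y') :
    (T.postcomp a).ev = Bag.push a T.ev := by
  cases T <;> simp [postcomp_edge', postcomp_node', ev_edge, ev_node, Bag.push_var, Bag.push_push]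

theorem ev_graft {A' : Type} {ws : A' → Q.Obj} (T : Tree fs ws y) (U : ∀ l, Tree fs zs (ws l)) :
    (T.graft U).ev = Bag.bind T.ev fun l => (U l).ev := by
  induction T with
  | edge l a => simp [graft, ev_edge, ev_postcomp, Bag.bind_var]
  | node b g hg a ch ih => simp [graft, ih, ev_node, Bag.bind_push, Bag.bind_assoc]

theorem ev_subst {gs : B' → Elt Q} (R : ∀ b (g : Elt Q), g = fs b → Tree gs g.src g.tgt)
    (hR : ∀ b g hg, (R b g hg).ev = Bag.of g.arr) (T : Tree fs zs y) :
    (T.subst R).ev = T.ev := by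
  induction T with
  | edge l a => rfl
  | node b g hg a ch ih => simp [subst, ev_postcomp, ev_graft, ih, ev_node, hR]

theorem ev_rename {gs : B' → Elt Q} (φ : B → B') (h : ∀ b, fs b = gs (φ b)) (T : Tree fs zs y) :
    (T.rename φ h).ev = T.ev := by
  induction T with
  | edge l a => rfl
  | node b g hg a ch ih => simp [rename, ih, ev_node]

theorem nodes_postcomp {y' : Q.Obj} (T : Tree fs zs y) (a : y ⟶ y') :
    (T.postcomp a).nodes = T.nodes := by
  cases T <;> simp [postcomp_edge', postcomp_node', nodes]

theorem nodes_rename {gs : B' → Elt Q} (φ : B → B') (h : ∀ b, fs b = gs (φ b))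
    (T : Tree fs zs y) : (T.rename φ h).nodes = T.nodes.map φ := by
  induction T with
  | edge l a => simp [rename, nodes]
  | node b g hg a ch ih =>
    simp only [rename, nodes, ih, Multiset.map_cons]
    congr 1
    exact (map_sum (Multiset.mapAddMonoidHom φ) _ _).symm

theorem sum_concat {M : Type*} [AddCommMonoid M] {A' : Type*} {n : ℕ} {m : Fin n → ℕ}
    (z : ∀ i, Fin (m i) → A') (F : A' → M) :
    ∑ p, F (concat z p) = ∑ i, ∑ j, F (z i j) := by
  rw [← Equiv.sum_comp finSigmaFinEquiv, Fintype.sum_sigma]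
  simp only [concat_apply]

theorem nodes_graft {A' : Type} {ws : A' → Q.Obj} (T : Tree fs ws y)
    (U : ∀ l, Tree fs zs (ws l)) :
    (T.graft U).nodes = T.nodes + ∑ p, (U (T.leafName p)).nodes := by
  induction T with
  | edge l a =>
    have : ∑ p : Fin 1, (U ((edge (fs := fs) l a).leafName p)).nodes = (U l).nodes := by
      rw [Fin.sum_univ_one]; rfl
    simp only [graft, nodes_postcomp, nodes, zero_add]
    exact this.symm
  | node b g hg a ch ih =>
    have h1 : ∑ p, (U ((node b g hg a ch).leafName p)).nodes =
        ∑ i, ∑ p, (U ((ch i).leafName p)).nodes := by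
      have := sum_concat (fun _ : Fin 1 => concat fun i => (ch i).leafName)
        (fun l => (U l).nodes)
      refine this.trans ?_
      simp only [Finset.univ_unique, Finset.sum_const, Finset.card_singleton, one_smul]
      exact sum_concat (fun i => (ch i).leafName) (fun l => (U l).nodes)
    rw [h1]
    simp only [graft, nodes, ih, Finset.sum_add_distrib, Multiset.cons_add]

end Tree

/-- If each leaf name occurs exactly once, sums over leaves are sums over names. -/
theorem sum_leaves {M : Type*} [AddCommMonoid M] {B : Type} {fs : B → Elt Q} {f : Elt Q}
    (T : Tree fs f.src f.tgt) (h : IsPermuted T.leafName T.eval f.arr) (F : Fin f.arity → M) :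
    ∑ p, F (T.leafName p) = ∑ i, F i := by
  obtain ⟨σ, hσ, -⟩ := h
  rw [← Equiv.sum_comp σ]
  exact Finset.sum_congr rfl fun i _ => by rw [← hσ i]

/-- Configurations for composing the arrows `fs 0, …, fs (n-1)` to yield `f`: trees `T` with
nodes labelled by the `fs i`, with a bijection `τ` from the nodes to `Fin n` (the name of a node)
such that the node `N` is labelled by `fs (τ N)`, and with a permutation of the leaves (given by
their names, which are the inputs of `f`), such that the resulting composite is `f`. -/
@[ext]
structure Config {n : ℕ} (fs : Fin n → Elt Q) (f : Elt Q) where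
  tree : Tree fs f.src f.tgt
  nodes_eq : tree.nodes = Finset.univ.val
  isPermuted : IsPermuted tree.leafName tree.eval f.arr

end SymMulticat
end Opetopic

namespace Opetopic
namespace SymMulticat
open SymMulticatData

variable {Q : SymMulticat.{u}}

theorem Tree.rename_eq_self {A B : Type} {fs : B → Elt Q} {zs : A → Q.Obj} {y : Q.Obj}
    (φ : B → B) (h : ∀ b, fs b = fs (φ b)) (hφ : ∀ b, φ b = b) (T : Tree fs zs y) :
    T.rename φ h = T := by
  obtain rfl : φ = id := funext hφ
  exact rename_id _ _

namespace Config

variable {n : ℕ} {fs : Fin n → Elt Q} {f : Elt Q}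

theorem ev_eq (C : Config fs f) : C.tree.ev = Bag.of f.arr := isPermuted_iff.1 C.isPermuted

theorem perm_val {k n : ℕ} (e : Fin k ≃ Fin n) :
    (Finset.univ : Finset (Fin k)).val.map e = (Finset.univ : Finset (Fin n)).val := by
  have := congrArg Finset.val (Finset.univ_map_equiv_to_embedding e)
  simp [← this]

/-- Renaming the nodes of a configuration. -/
def rename {k : ℕ} {gs : Fin k → Elt Q} (C : Config fs f) (e : Fin n ≃ Fin k)
    (h : ∀ i, fs i = gs (e i)) : Config gs f where
  tree := C.tree.rename e h
  nodes_eq := by rw [Tree.nodes_rename, C.nodes_eq, perm_val]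
  isPermuted := by
    rw [isPermuted_iff]
    exact (Tree.ev_rename e h C.tree).trans C.ev_eq

/-- The configuration with a single node, labelled by `α`, whose edges are labelled by the
components of an isomorphism. -/
def ofHom {α β : Elt Q} (φ : α ⟶ β) : Config (fun _ : Fin 1 => α) β where
  tree := Tree.node 0 α rfl φ.tgtMap fun i => Tree.edge (φ.perm i) (φ.srcMap i)
  nodes_eq := by simp [Tree.nodes]
  isPermuted := φ.isPermuted

/-- The tree `T`, as a tree with leaves named by the inputs of `g = f`, and with renamed nodes. -/
def treeAt {B : Type} {gs : B → Elt Q} (C : Config fs f) (φ : Fin n → B)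
    (h : ∀ i, fs i = gs (φ i)) (g : Elt Q) (hg : g = f) : Tree gs g.src g.tgt :=
  hg ▸ C.tree.rename φ h

theorem treeAt_ev {B : Type} {gs : B → Elt Q} (C : Config fs f) (φ : Fin n → B)
    (h : ∀ i, fs i = gs (φ i)) (g : Elt Q) (hg : g = f) :
    (C.treeAt φ h g hg).ev = Bag.of g.arr := by
  subst hg
  exact (Tree.ev_rename φ h C.tree).trans C.ev_eq

theorem treeAt_nodes {B : Type} {gs : B → Elt Q} (C : Config fs f) (φ : Fin n → B)
    (h : ∀ i, fs i = gs (φ i)) (g : Elt Q) (hg : g = f) :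
    (C.treeAt φ h g hg).nodes = (Finset.univ : Finset (Fin n)).val.map φ := by
  subst hg
  exact (Tree.nodes_rename φ h C.tree).trans (by rw [C.nodes_eq])

theorem treeAt_rename {B B' : Type} {gs : B → Elt Q} {hs : B' → Elt Q} (C : Config fs f)
    (φ : Fin n → B) (h : ∀ i, fs i = gs (φ i)) (g : Elt Q) (hg : g = f) (ψ : B → B')
    (h' : ∀ b, gs b = hs (ψ b)) :
    (C.treeAt φ h g hg).rename ψ h' =
      C.treeAt (ψ ∘ φ) (fun i => (h i).trans (h' _)) g hg := by
  subst hg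
  exact Tree.rename_rename _ _ _ _ _

theorem treeAt_congr {B : Type} {gs : B → Elt Q} (C : Config fs f)
    (φ ψ : Fin n → B) (h : ∀ i, fs i = gs (φ i)) (g : Elt Q) (hg : g = f)
    (hφ : ∀ i, φ i = ψ i) :
    C.treeAt φ h g hg = C.treeAt ψ (fun i => hφ i ▸ h i) g hg := by
  obtain rfl : φ = ψ := funext hφ
  rfl

theorem nodes_subst {B B' : Type} {gs : B → Elt Q} {hs : B' → Elt Q} {A : Type}
    {zs : A → Q.Obj} {y : Q.Obj} (T : Tree gs zs y)
    (R : ∀ b (g : Elt Q), g = gs b → Tree hs g.src g.tgt)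
    (hR : ∀ b g hg, (R b g hg).ev = Bag.of g.arr) (N : B → Multiset B')
    (hN : ∀ b g hg, (R b g hg).nodes = N b) :
    (T.subst R).nodes = (T.nodes.map N).sum := by
  induction T with
  | edge l a => simp [Tree.subst, Tree.nodes]
  | node b g hg a ch ih =>
    simp only [Tree.subst, Tree.nodes, Tree.nodes_postcomp, Tree.nodes_graft, ih, hN,
      Multiset.map_cons, Multiset.sum_cons]
    congr 1
    rw [sum_leaves (R b g hg) (isPermuted_iff.2 (hR b g hg))
      (fun i => ((ch i).nodes.map N).sum)]
    exact (map_sum ((Multiset.sumAddMonoidHom).comp (Multiset.mapAddMonoidHom N)) _ _).symm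

theorem concat_val {n : ℕ} (m : Fin n → ℕ) :
    ((Finset.univ : Finset (Fin n)).val.map fun i => (Finset.univ : Finset (Fin (m i))).val.map
      fun j => finSigmaFinEquiv ⟨i, j⟩).sum = (Finset.univ : Finset (Fin (∑ i, m i))).val := by
  have h1 := congrArg Finset.val (Finset.univ_map_equiv_to_embedding
    (finSigmaFinEquiv (m := n) (n := m)))
  rw [← h1, Finset.map_val, ← Finset.univ_sigma_univ]
  simp only [Finset.sigma, Multiset.sigma, Multiset.map_bind, Multiset.map_map]
  rfl

/-- Composition of configurations: every node of `C` is replaced by a tree. -/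
def comp {m : Fin n → ℕ} {gs : ∀ i, Fin (m i) → Elt Q} (C : Config fs f)
    (D : ∀ i, Config (gs i) (fs i)) : Config (concat gs) f where
  tree := C.tree.subst fun b g hg =>
    (D b).treeAt (fun j => finSigmaFinEquiv ⟨b, j⟩) (fun j => (concat_apply gs b j).symm) g hg
  nodes_eq := by
    rw [nodes_subst _ _ (fun b g hg => treeAt_ev _ _ _ _ _)
      (fun i => (Finset.univ : Finset (Fin (m i))).val.map fun j => finSigmaFinEquiv ⟨i, j⟩)
      (fun b g hg => treeAt_nodes _ _ _ _ _), C.nodes_eq, concat_val]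
  isPermuted := by
    rw [isPermuted_iff]
    exact (Tree.ev_subst _ (fun b g hg => treeAt_ev _ _ _ _ _) C.tree).trans C.ev_eq

end Config

variable (Q) in
/-- The data of the slice of `Q`. -/
def sliceData : SymMulticatData.{u} where
  Obj := Elt Q
  Hom fs f := Config fs f
  ι φ := Config.ofHom φ
  comp C _ _ D := Config.comp C D
  act C σ := C.rename σ.symm fun i => by simp

theorem sliceData_re {k n : ℕ} {fs : Fin n → Elt Q} {f : Elt Q} {gs : Fin k → Elt Q}
    (e : Fin k ≃ Fin n) (h : ∀ i, gs i = fs (e i)) (C : Config fs f) :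
    re (Q := sliceData Q) e h C = C.rename e.symm fun i => by simp [h] := by
  obtain rfl : k = n := by simpa using Fintype.card_congr e
  obtain rfl : gs = fs ∘ e := funext h
  rfl

theorem slice_arrow_ext {k n : ℕ} {fs : Fin n → Elt Q} {f : Elt Q} {gs : Fin k → Elt Q}
    (C : Config gs f) (D : Config fs f) (hk : k = n) (h : ∀ i, gs i = fs (finCongr hk i))
    (hT : C.tree.rename (finCongr hk) h = D.tree) :
    (Arrow.mk (Q := sliceData Q) C) = Arrow.mk (Q := sliceData Q) D := by
  subst hk
  obtain rfl : gs = fs := funext h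
  have h1 : C.tree = D.tree := by
    rw [← hT]
    exact (Tree.rename_id (fun _ => rfl) _).symm
  have h2 : C = D := Config.ext h1
  rw [h2]

theorem finCongr_one {k : ℕ} (hk : ∑ _i : Fin 1, k = k) (j : Fin k) :
    finCongr hk (finSigmaFinEquiv ⟨0, j⟩) = j := by
  refine (fin_one_concat (id : Fin k → Fin k) hk _).symm.trans ?_
  rw [concat_apply]; rfl

theorem finCongr_const_one {k : ℕ} (hk : ∑ _i : Fin k, 1 = k) (i : Fin k) (j : Fin 1) :
    finCongr hk (finSigmaFinEquiv ⟨i, j⟩) = i := by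
  refine (concat_fin_one (id : Fin k → Fin k) hk _).symm.trans ?_
  rw [concat_apply]; rfl

theorem slice_id_comp {k : ℕ} {fs : Fin k → Elt Q} {f : Elt Q} (C : Config fs f)
    (hk : ∑ _i : Fin 1, k = k) (h) :
    (Config.comp (Config.ofHom (𝟙 f)) fun _ => C).tree.rename (finCongr hk) h = C.tree := by
  have h1 : (Config.comp (Config.ofHom (𝟙 f)) fun _ => C).tree =
      ((C.tree.rename (fun j => finSigmaFinEquiv ⟨(0 : Fin 1), j⟩)
        (fun j => (concat_apply (fun _ => fs) 0 j).symm)).graft fun i =>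
          Tree.edge i (𝟙 (f.src i))).postcomp (𝟙 f.tgt) := rfl
  rw [h1, Tree.postcomp_id, Tree.graft_edge, Tree.rename_rename]
  exact Tree.rename_eq_self _ _ (fun j => finCongr_one hk j) _

theorem slice_comp_id {k : ℕ} {fs : Fin k → Elt Q} {f : Elt Q} (C : Config fs f)
    (hk : ∑ _i : Fin k, 1 = k) (h) :
    (Config.comp C fun i => Config.ofHom (𝟙 (fs i))).tree.rename (finCongr hk) h = C.tree := by
  have h1 : (Config.comp C fun i => Config.ofHom (𝟙 (fs i))).tree =
      C.tree.subst fun b g hg => Tree.single (finSigmaFinEquiv ⟨b, 0⟩) g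
        (hg.trans (concat_apply (fun i (_ : Fin 1) => fs i) b 0).symm) (𝟙 _) id fun _ => 𝟙 _ := by
    change Tree.subst _ _ = _
    congr 1
    funext b g hg
    subst hg
    rfl
  rw [h1, Tree.subst_single _ (fun b => finSigmaFinEquiv ⟨b, 0⟩)
    (fun b => (concat_apply (fun i (_ : Fin 1) => fs i) b 0).symm), Tree.rename_rename]
  exact Tree.rename_eq_self _ _ (fun j => finCongr_const_one hk j 0) _

theorem slice_assoc {n : ℕ} {fs : Fin n → Elt Q} {f : Elt Q} (C : Config fs f) {m : Fin n → ℕ}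
    {gs : ∀ i, Fin (m i) → Elt Q} (D : ∀ i, Config (gs i) (fs i)) {l : ∀ i, Fin (m i) → ℕ}
    {hs : ∀ i j, Fin (l i j) → Elt Q} (E : ∀ i j, Config (hs i j) (gs i j)) (hk) (h) :
    (Config.comp (Config.comp C D) fun p =>
      E (finSigmaFinEquiv.symm p).1 (finSigmaFinEquiv.symm p).2).tree.rename (finCongr hk) h =
    (Config.comp C fun i => Config.comp (D i) (E i)).tree := by
  have key : ∀ s t : Σ i, Fin (m i), s = t → ∀ (g : Elt Q) hg hg' h h',
      (E s.1 s.2).treeAt (gs := concat fun i => concat (hs i))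
        (fun k => finSigmaFinEquiv ⟨s.1, finSigmaFinEquiv ⟨s.2, k⟩⟩) h g hg =
      (E t.1 t.2).treeAt (fun k => finSigmaFinEquiv ⟨t.1, finSigmaFinEquiv ⟨t.2, k⟩⟩) h' g hg' := by
    rintro s _ rfl g hg hg' h h'
    rfl
  change ((C.tree.subst _).subst _).rename _ _ = C.tree.subst _
  rw [Tree.subst_subst, Tree.subst_rename]
  congr 1
  funext b g hg
  subst hg
  change (((D b).tree.rename _ _).subst _).rename _ _ = ((D b).tree.subst _).rename _ _
  rw [Tree.rename_subst, Tree.subst_rename, Tree.subst_rename]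
  congr 1
  funext j g hg
  refine Eq.trans ?_ (Config.treeAt_rename _ _ _ _ _ _ _).symm
  refine (Config.treeAt_rename (E _ _) _ _ g _ _ _).trans ?_
  refine (Config.treeAt_congr _ _ _ _ _ _
    (fun k => finSigma_assoc hk (finSigmaFinEquiv ⟨b, j⟩) k)).trans ?_
  exact key _ _ (Equiv.symm_apply_apply _ _) _ _ _ _ _

theorem slice_act_comp {k : ℕ} {fs : Fin k → Elt Q} {f : Elt Q} (C : Config fs f) {m : Fin k → ℕ}
    {gs : ∀ i, Fin (m i) → Elt Q} (D : ∀ i, Config (gs i) (fs i)) (σ : Equiv.Perm (Fin k)) (h h') :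
    (Config.comp (C.rename (gs := fs ∘ σ) σ.symm h) fun i => D (σ i)).tree =
      ((Config.comp C D).rename (gs := concat fun i => gs (σ i)) (blockPerm σ m).symm h').tree := by
  change (C.tree.rename _ _).subst _ = (C.tree.subst _).rename _ _
  rw [Tree.rename_subst, Tree.subst_rename]
  congr 1
  funext b g hg
  obtain ⟨b, rfl⟩ := σ.surjective b
  rw [Config.treeAt_rename]
  have hb : ∀ j, (blockPerm σ m).symm (finSigmaFinEquiv ⟨σ b, j⟩) = finSigmaFinEquiv ⟨b, j⟩ := by
    intro j
    rw [Equiv.symm_apply_eq]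
    simp [blockPerm]
  refine Eq.trans ?_ (Config.treeAt_congr (D (σ b)) _ _ _ _ _ hb).symm
  have key : ∀ c, c = b → ∀ hg hg' h1 h2, (D (σ c)).treeAt (gs := concat fun i => gs (σ i))
      (fun j => finSigmaFinEquiv ⟨c, j⟩) h1 g hg =
      (D (σ b)).treeAt (fun j => finSigmaFinEquiv ⟨b, j⟩) h2 g hg' := by
    rintro _ rfl hg hg' h1 h2
    rfl
  exact key _ (by simp) _ _ _ _

theorem slice_comp_act {k : ℕ} {fs : Fin k → Elt Q} {f : Elt Q} (C : Config fs f) {m : Fin k → ℕ}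
    {gs : ∀ i, Fin (m i) → Elt Q} (D : ∀ i, Config (gs i) (fs i))
    (σ : ∀ i, Equiv.Perm (Fin (m i)))
    (h : ∀ i j, gs i j = (gs i ∘ σ i) ((σ i).symm j)) (h' h'') :
    (Config.comp C fun i => (D i).rename (gs := gs i ∘ σ i) (σ i).symm (h i)).tree.rename
      (finCongr rfl) h'' =
      ((Config.comp C D).rename (gs := concat gs ∘ juxtPerm σ) (juxtPerm σ).symm h').tree := by
  change (C.tree.subst _).rename _ _ = (C.tree.subst _).rename _ _
  rw [Tree.subst_rename, Tree.subst_rename]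
  congr 1
  funext b g hg
  refine Eq.trans ?_ (Config.treeAt_rename _ _ _ _ _ _ _).symm
  refine (Config.treeAt_rename _ _ _ _ _ _ _).trans ?_
  have hb : ∀ j, (juxtPerm σ).symm (finSigmaFinEquiv ⟨b, j⟩) =
      finSigmaFinEquiv ⟨b, (σ b).symm j⟩ := by
    intro j
    rw [Equiv.symm_apply_eq]
    simp [juxtPerm]
  refine Eq.trans ?_ (Config.treeAt_congr (D b) _ _ _ _ _ hb).symm
  subst hg
  exact Tree.rename_rename _ _ _ _ _

theorem slice_ι_comp {f g h : Elt Q} (ψ : f ⟶ g) (φ : g ⟶ h) (hk) (h1) :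
    (Config.ofHom (ψ ≫ φ)).tree.rename (finCongr hk) h1 =
      (Config.comp (Config.ofHom φ) fun _ => Config.ofHom ψ).tree := by
  have h0 : finCongr hk 0 = finSigmaFinEquiv ⟨0, 0⟩ := by
    apply Fin.ext
    simp [finSigmaFinEquiv_one (n := fun _ : Fin 1 => 1)]
  change Tree.node (finCongr hk 0) f _ _ _ = Tree.node (finSigmaFinEquiv ⟨0, 0⟩) f _ _ _
  congr 1

variable (Q) in
/-- The Baez–Dolan slice `Q⁺`. -/
def slice : SymMulticat.{u} where
  toSymMulticatData := sliceData Q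
  id_comp {k x y} f := by
    refine slice_arrow_ext (Config.comp (Config.ofHom (𝟙 y)) fun _ => f) f (by simp)
      (fun i => fin_one_concat _ _ i) ?_
    exact slice_id_comp f _ _
  comp_id {k x y} f := by
    refine slice_arrow_ext (Config.comp f fun i => Config.ofHom (𝟙 (x i))) f (by simp)
      (fun i => concat_fin_one _ _ i) ?_
    exact slice_comp_id f _ _
  assoc {k x y} f {m z} g {l w} h := by
    refine (slice_arrow_ext (Config.comp (Config.comp f g)
      (fun p => h (finSigmaFinEquiv.symm p).1 (finSigmaFinEquiv.symm p).2))
      (Config.comp f (fun i => Config.comp (g i) (h i))) (finSigma_assoc_sum l)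
      (fun i => concat_concat w _ i) ?_).symm
    exact slice_assoc f g h _ _
  act_one f := Config.ext (Tree.rename_id _ _)
  act_act f σ σ' := Config.ext (Tree.rename_rename _ _ _ _ _)
  act_comp {k x y} f {m z} g σ := by
    refine Eq.trans ?_ (sliceData_re _ _ (Config.comp f g)).symm
    refine Config.ext ?_
    exact slice_act_comp f g σ _ _
  comp_act {k x y} f {m z} g σ := by
    refine slice_arrow_ext (Config.comp f fun i => (g i).rename (σ i).symm _)
      ((Config.comp f g).rename (juxtPerm σ).symm _) rfl ?_ ?_
    · intro p
      obtain ⟨⟨i, j⟩, rfl⟩ := finSigmaFinEquiv.surjective p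
      have h1 : juxtPerm σ (finSigmaFinEquiv ⟨i, j⟩) = finSigmaFinEquiv ⟨i, σ i j⟩ := by
        simp [juxtPerm]
      rw [concat_apply]
      change _ = concat z (juxtPerm σ (finSigmaFinEquiv ⟨i, j⟩))
      rw [h1, concat_apply]
      rfl
    · exact slice_comp_act f g σ _ _ _
  ι_comp φ ψ := by
    refine slice_arrow_ext (Config.ofHom (ψ ≫ φ))
      (Config.comp (Config.ofHom φ) fun _ => Config.ofHom ψ) (by simp)
      (fun i => rfl) ?_
    exact slice_ι_comp ψ φ _ _

end SymMulticat
end Opetopic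

namespace Opetopic

theorem equiv_discrete_iff {C : Type u} [SmallCategory C] :
    (∃ S : Type u, Nonempty (C ≌ Discrete S)) ↔
      (∀ x y : C, Subsingleton (x ⟶ y)) ∧ ∀ x y : C, (x ⟶ y) → Nonempty (y ⟶ x) := by
  constructor
  · rintro ⟨S, ⟨e⟩⟩
    refine ⟨fun x y => ⟨fun a b => e.functor.map_injective (Subsingleton.elim _ _)⟩, fun x y a => ?_⟩
    exact ⟨e.functor.preimage (Discrete.eqToHom (Discrete.eq_of_hom (e.functor.map a)).symm)⟩
  · rintro ⟨h1, h2⟩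
    let F : C ⥤ Discrete (Quotient (isIsomorphicSetoid C)) :=
      { obj := fun x => ⟨Quotient.mk _ x⟩
        map := fun {x y} a => Discrete.eqToHom (Quotient.sound (s := isIsomorphicSetoid C)
          ⟨⟨a, (h2 x y a).some, Subsingleton.elim _ _, Subsingleton.elim _ _⟩⟩)
        map_id := fun _ => Subsingleton.elim _ _
        map_comp := fun _ _ => Subsingleton.elim _ _ }
    have : F.Faithful := ⟨fun _ => Subsingleton.elim _ _⟩
    have : F.Full := ⟨fun {x y} a => ⟨(Quotient.exact (s := isIsomorphicSetoid C)
      (Discrete.eq_of_hom a)).some.hom, Subsingleton.elim _ _⟩⟩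
    have : F.EssSurj := ⟨fun s => by
      obtain ⟨s⟩ := s
      induction s using Quotient.ind with
      | _ x => exact ⟨x, ⟨Iso.refl _⟩⟩⟩
    have : F.IsEquivalence := {}
    exact ⟨_, ⟨F.asEquivalence⟩⟩

namespace SymMulticat
open SymMulticatData

/-- `Q` is freely symmetric: no nontrivial permutation fixes an arrow. -/
def FreelySymmetric (Q : SymMulticat.{u}) : Prop :=
  ∀ {k : ℕ} {x : Fin k → Q.Obj} {y : Q.Obj} (f : Q.Hom x y) (σ : Equiv.Perm (Fin k)),
    (⟨Q.act f σ⟩ : Q.Arrow) = ⟨f⟩ → σ = 1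

/-- `Q` is tidy: it is freely symmetric and its category of objects is equivalent to a discrete
one. -/
structure IsTidy (Q : SymMulticat.{u}) : Prop where
  freelySymmetric : Q.FreelySymmetric
  discrete : ∃ S : Type u, Nonempty (Q.Obj ≌ Discrete S)

variable {Q : SymMulticat.{u}}

variable (Q) in
/-- The set `S` of isomorphism classes of objects: the discrete category equivalent to `o(Q)`. -/
def ObjClass : Type u := Quotient (isIsomorphicSetoid Q.Obj)

/-- The isomorphism class of an object. -/
def cls (x : Q.Obj) : ObjClass Q := Quotient.mk _ x

/-- A representative of an isomorphism class of objects. -/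
noncomputable def rep (s : ObjClass Q) : Q.Obj := Quotient.out s

theorem cls_rep (s : ObjClass Q) : cls (rep s) = s := Quotient.out_eq s

/-- An isomorphism between objects with the same class. -/
noncomputable def conn {x y : Q.Obj} (h : cls x = cls y) : x ⟶ y :=
  (Quotient.exact (s := isIsomorphicSetoid Q.Obj) h).some.hom

theorem cls_eq_of_hom (hQ : Q.IsTidy) {x y : Q.Obj} (a : x ⟶ y) : cls x = cls y := by
  obtain ⟨h1, h2⟩ := equiv_discrete_iff.1 hQ.discrete
  exact Quotient.sound (s := isIsomorphicSetoid Q.Obj)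
    ⟨⟨a, (h2 x y a).some, Subsingleton.elim _ _, Subsingleton.elim _ _⟩⟩

theorem hom_unique (hQ : Q.IsTidy) {x y : Q.Obj} (a b : x ⟶ y) : a = b :=
  ((equiv_discrete_iff.1 hQ.discrete).1 x y).elim a b

theorem arrow_re {k : ℕ} {x x' : Fin k → Q.Obj} {y : Q.Obj} (e : Fin k ≃ Fin k)
    (h : ∀ i, x' i = x (e i)) (f : Q.Hom x y) :
    (⟨re e h f⟩ : Q.Arrow) = ⟨Q.act f e⟩ := by
  obtain rfl : x' = x ∘ e := funext h
  rfl

theorem arr_inj {R : SymMulticatData.{u}} {k : ℕ} {x : Fin k → R.Obj} {y : R.Obj}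
    {f g : R.Hom x y} (h : (⟨f⟩ : R.Arrow) = ⟨g⟩) : f = g := by simpa using h

theorem re_arrow_congr {k n : ℕ} {x x' : Fin n → Q.Obj} {w : Fin k → Q.Obj} {y : Q.Obj}
    (e : Fin k ≃ Fin n) (h : ∀ i, w i = x (e i)) (h' : ∀ i, w i = x' (e i)) (f : Q.Hom x y)
    (f' : Q.Hom x' y) (hx : x = x') (hf : (⟨f⟩ : Q.Arrow) = ⟨f'⟩) : re e h f = re e h' f' := by
  subst hx
  have : f = f' := by simpa using hf
  rw [this]

theorem names_eq (hQ : Q.IsTidy) {A : Type w} {zs : A → Q.Obj} {y : Q.Obj} {n : ℕ}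
    {nm nm' : Fin n → A} {f : Q.Hom (zs ∘ nm) y} {f' : Q.Hom (zs ∘ nm') y}
    (hf : (⟨f⟩ : Q.Arrow) = ⟨f'⟩) (h : Bag.mk zs nm f = Bag.mk zs nm' f') : nm = nm' := by
  obtain ⟨e, he, h1⟩ := Bag.mk_eq_mk.1 h
  have h2 : e = 1 := by
    refine hQ.freelySymmetric f e ?_
    rw [← arrow_re e (fun i => congrArg zs (he i)) f, ← h1, hf]
  subst h2
  exact (funext he).symm

/-- The positions of the inputs of `ι(f) ∘ α ∘ (ι(f₁),…,ι(f_m))`. -/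
def pos (n : ℕ) : Fin (∑ _i : Fin 1, ∑ _j : Fin n, 1) → Fin n :=
  concat fun _ : Fin 1 => concat fun j => fun _ : Fin 1 => j

theorem pos_comp {X : Type*} {n : ℕ} (z : Fin n → X) :
    z ∘ pos n = concat fun _ : Fin 1 => concat fun j => fun _ : Fin 1 => z j := rfl

theorem pos_bijective (n : ℕ) : Function.Bijective (pos n) := by
  have h1 : ∑ _i : Fin 1, ∑ _j : Fin n, 1 = ∑ _j : Fin n, 1 := by simp
  have h2 : ∑ _j : Fin n, 1 = n := by simp
  have h : pos n = finCongr (h1.trans h2) := by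
    funext i
    refine (fin_one_concat _ h1 i).trans ?_
    exact concat_fin_one (id : Fin n → Fin n) h2 _
  rw [h]
  exact Equiv.bijective _

/-- An arrow composed with object-morphisms at the source and target. -/
def conj (α : Elt Q) {z : Fin α.arity → Q.Obj} {y : Q.Obj} (c : ∀ j, z j ⟶ α.src j)
    (a : α.tgt ⟶ y) : Q.Hom (z ∘ pos α.arity) y :=
  Q.comp (Q.ι a) fun _ => Q.comp α.arr fun j => Q.ι (c j)

theorem bag_conj {A : Type w} {zs : A → Q.Obj} (α : Elt Q) {y : Q.Obj} (nm : Fin α.arity → A)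
    (c : ∀ j, zs (nm j) ⟶ α.src j) (a : α.tgt ⟶ y) :
    Bag.mk zs (nm ∘ pos α.arity) (conj α (z := zs ∘ nm) c a) =
      Bag.push a (Bag.bind (Bag.of α.arr) fun j => Bag.var (nm j) (c j)) :=
  bag_node a (zs := zs) (fun j _ => nm j) fun j => Q.ι (c j)

theorem arrow_conj (hQ : Q.IsTidy) (α : Elt Q) {z z' : Fin α.arity → Q.Obj} {y : Q.Obj}
    (c : ∀ j, z j ⟶ α.src j) (c' : ∀ j, z' j ⟶ α.src j) (a a' : α.tgt ⟶ y)
    (h : ∀ j, z j = z' j) : (⟨conj α c a⟩ : Q.Arrow) = ⟨conj α c' a'⟩ := by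
  obtain rfl : z = z' := funext h
  obtain rfl : c = c' := funext fun j => hom_unique hQ _ _
  obtain rfl : a = a' := hom_unique hQ _ _
  rfl

theorem eltHom_ext (hQ : Q.IsTidy) {α β : Elt Q} (φ ψ : α ⟶ β) (h : φ.perm = ψ.perm) : φ = ψ := by
  obtain ⟨p, s, t, hp⟩ := φ
  obtain ⟨p', s', t', hp'⟩ := ψ
  dsimp only at h
  subst h
  obtain rfl : s = s' := funext fun j => hom_unique hQ _ _
  obtain rfl : t = t' := hom_unique hQ _ _
  rfl

theorem elt_hom_unique (hQ : Q.IsTidy) {α β : Elt Q} (φ ψ : α ⟶ β) : φ = ψ := by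
  refine eltHom_ext hQ φ ψ ?_
  let zs : Fin β.arity → Q.Obj := fun i => rep (cls (β.src i))
  let κ : ∀ i, zs i ⟶ β.src i := fun i => conn (cls_rep _)
  have key : ∀ χ : α ⟶ β, Bag.mk zs (χ.perm ∘ pos α.arity)
      (conj α (z := zs ∘ χ.perm) (fun j => κ (χ.perm j) ≫ χ.srcMap j) χ.tgtMap) =
      Bag.bind (Bag.of β.arr) fun i => Bag.var i (κ i) := by
    intro χ
    rw [bag_conj, ← EltHom.bag χ, Bag.bind_push, Bag.bind_assoc]
    congr 2
    funext j
    rw [Bag.bind_var, Bag.push_var]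
  have h := names_eq (zs := zs) (nm := φ.perm ∘ pos α.arity) (nm' := ψ.perm ∘ pos α.arity) hQ
    (arrow_conj hQ α _ _ _ _ fun j => ?_) ((key φ).trans (key ψ).symm)
  · refine Equiv.ext fun j => ?_
    obtain ⟨i, rfl⟩ := (pos_bijective _).2 j
    exact congrFun h i
  · change rep _ = rep _
    rw [cls_eq_of_hom hQ (φ.srcMap j), cls_eq_of_hom hQ (ψ.srcMap j)]

/-- The objects of `elt(Q) ×_{FS} FX`: arrows of `Q` whose inputs are labelled by compatible
elements of `X`. -/
structure LabArrow (X : Over (ObjClass Q)) where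
  arrow : Elt Q
  lab : Fin arrow.arity → X.left
  compat : ∀ j, X.hom (lab j) = cls (arrow.src j)

/-- The category `elt(Q) ×_{FS} FX`, where `FX` is the free symmetric strict monoidal category on
the discrete category `X`. -/
instance (X : Over (ObjClass Q)) : SmallCategory (LabArrow X) where
  Hom L M := { φ : L.arrow ⟶ M.arrow // ∀ j, M.lab (φ.perm j) = L.lab j }
  id L := ⟨𝟙 _, fun _ => rfl⟩
  comp φ ψ := ⟨φ.1 ≫ ψ.1, fun j => (ψ.2 _).trans (φ.2 j)⟩
  id_comp φ := Subtype.ext (Category.id_comp _)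
  comp_id φ := Subtype.ext (Category.comp_id _)
  assoc φ ψ χ := Subtype.ext (Category.assoc _ _ _)

namespace LabArrow

variable {X : Over (ObjClass Q)}

/-- The arrow with its inputs moved to representatives of their classes, named by labels. -/
noncomputable def nrm (L : LabArrow X) {y : Q.Obj} (h : L.arrow.tgt ⟶ y) :
    Bag (fun x : X.left => rep (X.hom x)) y :=
  Bag.push h (Bag.bind (Bag.of L.arrow.arr) fun j =>
    Bag.var (L.lab j) (conn ((cls_rep _).trans (L.compat j))))

theorem nrm_push (L : LabArrow X) {y y' : Q.Obj} (h : L.arrow.tgt ⟶ y) (a : y ⟶ y') :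
    Bag.push a (L.nrm h) = L.nrm (h ≫ a) := Bag.push_push _ _ _

theorem nrm_eq_of_hom (hQ : Q.IsTidy) {L M : LabArrow X} (φ : L ⟶ M) {y : Q.Obj}
    (h : L.arrow.tgt ⟶ y) (h' : M.arrow.tgt ⟶ y) : L.nrm h = M.nrm h' := by
  unfold nrm
  rw [← EltHom.bag φ.1, Bag.bind_push, Bag.push_push, Bag.bind_assoc, hom_unique hQ h]
  congr 2
  funext j
  rw [Bag.bind_var, Bag.push_var]
  have key : ∀ (x x' : X.left) (hx : x' = x) (y : Q.Obj) (a : rep (X.hom x) ⟶ y)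
      (b : rep (X.hom x') ⟶ y), Bag.var (zs := fun x : X.left => rep (X.hom x)) x a =
        Bag.var x' b := by
    rintro x _ rfl y a b
    rw [hom_unique hQ a b]
  exact key _ _ (φ.2 j) _ _ _

theorem hom_of_nrm_eq (hQ : Q.IsTidy) {L M : LabArrow X} {y : Q.Obj}
    (h : L.arrow.tgt ⟶ y) (h' : M.arrow.tgt ⟶ y) (hN : L.nrm h = M.nrm h') :
    Nonempty (L ⟶ M) := by
  let zs : X.left → Q.Obj := fun x => rep (X.hom x)
  have c : ∀ (N : LabArrow X) j, zs (N.lab j) ⟶ N.arrow.src j :=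
    fun N j => conn ((cls_rep _).trans (N.compat j))
  have e1 : ∀ (N : LabArrow X) (a : N.arrow.tgt ⟶ y), N.nrm a =
      Bag.mk zs (N.lab ∘ pos _) (conj N.arrow (z := zs ∘ N.lab) (c N) a) := by
    intro N a
    rw [bag_conj]
    unfold nrm
    congr 2
    funext j
    congr 1
    exact hom_unique hQ _ _
  rw [e1, e1] at hN
  obtain ⟨e, he, hf⟩ := Bag.mk_eq_mk.1 hN
  let P : ∀ n, Fin (∑ _i : Fin 1, ∑ _j : Fin n, 1) ≃ Fin n :=
    fun n => Equiv.ofBijective _ (pos_bijective n)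
  let p : Fin L.arrow.arity ≃ Fin M.arrow.arity := (P _).symm.trans (e.symm.trans (P _))
  have hp : ∀ i, p (pos _ (e i)) = pos _ i := by
    intro i
    have : pos _ (e i) = P _ (e i) := rfl
    rw [this]
    simp only [p, Equiv.trans_apply, Equiv.symm_apply_apply]
    rfl
  have hlab : ∀ j, M.lab (p j) = L.lab j := by
    intro j
    obtain ⟨i, rfl⟩ := (pos_bijective _).2 j
    obtain ⟨i, rfl⟩ := e.surjective i
    rw [hp]
    exact he i
  let c' : ∀ j, zs (M.lab (p j)) ⟶ L.arrow.src j := fun j =>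
    eqToHom (congrArg zs (hlab j)) ≫ c L j
  have hM : Bag.mk (zs ∘ M.lab) (pos _) (conj M.arrow (z := zs ∘ M.lab) (c M) h') =
      Bag.mk (zs ∘ M.lab) (p ∘ pos _) (conj L.arrow (z := (zs ∘ M.lab) ∘ p) c' h) := by
    refine (Bag.mk_eq_mk.2 ⟨e, fun i => (hp i).symm, ?_⟩).symm
    rw [hf]
    exact re_arrow_congr e _ _ _ _ (funext fun i => congrArg zs (hlab _).symm)
      (arrow_conj hQ _ _ _ _ _ fun j => congrArg zs (hlab j).symm)
  obtain ⟨a⟩ := (equiv_discrete_iff.1 hQ.discrete).2 _ _ h'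
  have b : ∀ j, M.arrow.src j ⟶ zs (M.lab j) :=
    fun j => conn ((M.compat j).symm.trans (cls_rep _).symm)
  have back : Bag.of M.arrow.arr = Bag.push a
      (Bag.bind (Bag.mk (zs ∘ M.lab) (pos _) (conj M.arrow (z := zs ∘ M.lab) (c M) h'))
        fun j => Bag.var j (b j)) := by
    have h1 := bag_conj (zs := zs ∘ M.lab) M.arrow id (c M) h'
    refine Eq.trans ?_ (congrArg (fun t => Bag.push a (Bag.bind t fun j => Bag.var j (b j)))
      h1.symm)
    rw [Bag.bind_push, Bag.push_push, Bag.bind_assoc, hom_unique hQ (h' ≫ a) (𝟙 _), Bag.push_id]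
    refine (Bag.bind_pure _).symm.trans ?_
    congr 1
    funext j
    rw [Bag.bind_var, Bag.push_var]
    congr 1
    exact hom_unique hQ _ _
  rw [hM] at back
  have h2 := bag_conj (zs := zs ∘ M.lab) L.arrow p c' h
  have h3 := back.trans (congrArg
    (fun t => Bag.push a (Bag.bind t fun j => Bag.var j (b j))) h2)
  rw [Bag.bind_push, Bag.push_push, Bag.bind_assoc] at h3
  refine ⟨⟨⟨p, fun j => b (p j) ≫ c' j, h ≫ a, isPermuted_of_bag _ _ _ ?_⟩, hlab⟩⟩
  rw [h3]
  congr 2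
  funext j
  rw [Bag.bind_var, Bag.push_var]

theorem hom_unique' (hQ : Q.IsTidy) {L M : LabArrow X} (φ ψ : L ⟶ M) : φ = ψ :=
  Subtype.ext (elt_hom_unique hQ _ _)

/-- The isomorphism class of a labelled arrow. -/
def toClass (L : LabArrow X) : Quotient (isIsomorphicSetoid (LabArrow X)) := Quotient.mk _ L

theorem toClass_eq_of_hom (hQ : Q.IsTidy) {L M : LabArrow X} (φ : L ⟶ M) :
    L.toClass = M.toClass := by
  obtain ⟨a⟩ := (equiv_discrete_iff.1 hQ.discrete).2 _ _ φ.1.tgtMap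
  obtain ⟨ψ⟩ := hom_of_nrm_eq hQ (𝟙 _) φ.1.tgtMap
    (nrm_eq_of_hom hQ φ φ.1.tgtMap (𝟙 _)).symm
  exact Quotient.sound (s := isIsomorphicSetoid (LabArrow X))
    ⟨⟨φ, ψ, hom_unique' hQ _ _, hom_unique' hQ _ _⟩⟩

theorem toClass_eq_of_nrm (hQ : Q.IsTidy) {L M : LabArrow X} {y : Q.Obj}
    (h : L.arrow.tgt ⟶ y) (h' : M.arrow.tgt ⟶ y) (hN : L.nrm h = M.nrm h') :
    L.toClass = M.toClass := by
  obtain ⟨φ⟩ := hom_of_nrm_eq hQ h h' hN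
  exact toClass_eq_of_hom hQ φ

theorem hom_of_toClass_eq {L M : LabArrow X} (h : L.toClass = M.toClass) : Nonempty (L ⟶ M) :=
  (Quotient.exact (s := isIsomorphicSetoid (LabArrow X)) h).map fun i => i.hom

theorem nrm_eq_of_toClass_eq (hQ : Q.IsTidy) {L M : LabArrow X} (hL : L.toClass = M.toClass)
    {y : Q.Obj} (h : L.arrow.tgt ⟶ y) (h' : M.arrow.tgt ⟶ y) : L.nrm h = M.nrm h' := by
  obtain ⟨φ⟩ := hom_of_toClass_eq hL
  exact nrm_eq_of_hom hQ φ h h'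

/-- An arrow whose inputs are labelled by their classes. -/
def ofElt (α : Elt Q) : LabArrow (Over.mk (𝟙 (ObjClass Q))) := ⟨α, fun j => cls (α.src j), fun _ => rfl⟩

end LabArrow

theorem elt_hom_symm (hQ : Q.IsTidy) {α β : Elt Q} (φ : α ⟶ β) : Nonempty (β ⟶ α) := by
  have φ' : LabArrow.ofElt α ⟶ LabArrow.ofElt β :=
    ⟨φ, fun j => cls_eq_of_hom hQ (φ.srcMap j)⟩
  obtain ⟨ψ⟩ := LabArrow.hom_of_toClass_eq (LabArrow.toClass_eq_of_hom hQ φ').symm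
  exact ⟨ψ.1⟩

theorem Tree.rename_fix {A B : Type} {fs gs : B → Elt Q} {zs : A → Q.Obj} {y : Q.Obj}
    (φ : B → B) (h : ∀ b, fs b = gs (φ b)) (hf : gs = fs) (T : Tree fs zs y)
    (hT : T.rename φ h = hf ▸ T) : ∀ b ∈ T.nodes, φ b = b := by
  subst hf
  dsimp only at hT
  induction T with
  | edge l a => simp [Tree.nodes]
  | node b g hg a ch ih =>
    simp only [Tree.rename, Tree.node.injEq, heq_eq_eq, true_and] at hT
    intro c hc
    simp only [Tree.nodes, Multiset.mem_cons, Multiset.mem_sum, Finset.mem_univ] at hc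
    rcases hc with rfl | ⟨i, -, hi⟩
    · exact hT.1
    · exact ih i (congrFun hT.2 i) c hi

theorem slice_freelySymmetric : (slice Q).FreelySymmetric := by
  intro k fs f C σ h
  have C' : Config fs f := C
  have h1 : fs ∘ σ = fs := by
    have := congrArg (fun a : (sliceData Q).Arrow => (⟨a.arity, a.src⟩ : Σ n, Fin n → Elt Q)) h
    exact eq_of_heq (Sigma.mk.inj this).2
  have key : ∀ (gs : Fin k → Elt Q) (hg : gs = fs) (D : Config gs f),
      (Arrow.mk (Q := sliceData Q) D) = Arrow.mk (Q := sliceData Q) (src := fs) C →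
      D.tree = hg ▸ (show Config fs f from C).tree := by
    rintro _ rfl D hD
    have : D = C := arr_inj hD
    rw [this]
  have h2 := key (fs ∘ σ) h1 _ h
  have h3 := Tree.rename_fix σ.symm _ h1 _ h2
  rw [(show Config fs f from C).nodes_eq] at h3
  refine Equiv.ext fun i => ?_
  have := h3 (σ i) (by simp)
  simpa using this.symm

theorem slice_isTidy (hQ : Q.IsTidy) : (slice Q).IsTidy where
  freelySymmetric := slice_freelySymmetric
  discrete := equiv_discrete_iff.2 ⟨fun _ _ => ⟨fun φ ψ => elt_hom_unique hQ φ ψ⟩,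
    fun _ _ φ => elt_hom_symm hQ φ⟩

end SymMulticat
end Opetopic

namespace Opetopic

theorem over_w_apply {S : Type u} {X Y : Over S} (h : X ⟶ Y) (x : X.left) :
    Y.hom (h.left x) = X.hom x := by
  rw [← Over.w h]; rfl

namespace SymMulticat
open SymMulticatData

variable {Q : SymMulticat.{u}}

namespace LabArrow

variable {X Y : Over (ObjClass Q)}

/-- Changing labels. -/
def relabel (h : X ⟶ Y) (L : LabArrow X) : LabArrow Y where
  arrow := L.arrow
  lab j := h.left (L.lab j)
  compat j := (over_w_apply h _).trans (L.compat j)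

/-- The identity labelled by `x`. -/
noncomputable def unit (x : X.left) : LabArrow X where
  arrow := ⟨Q.ι (𝟙 (rep (X.hom x)))⟩
  lab _ := x
  compat _ := (cls_rep _).symm

/-- The composite of a family of labelled arrows with an arrow. -/
def flatten (α : Elt Q) (M : ∀ _ : Fin α.arity, LabArrow X)
    (c : ∀ i, (M i).arrow.tgt ⟶ α.src i) : LabArrow X where
  arrow := ⟨Q.comp α.arr fun i => Q.comp (Q.ι (c i)) fun _ => (M i).arrow.arr⟩
  lab := concat fun i => concat fun _ => (M i).lab
  compat _ := (M _).compat _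

end LabArrow

/-- The set of isomorphism classes of source-labelled arrows. -/
def TObj (X : Over (ObjClass Q)) : Type u := Quotient (isIsomorphicSetoid (LabArrow X))

/-- The class of the target. -/
def TObj.tgt (hQ : Q.IsTidy) {X : Over (ObjClass Q)} (t : TObj X) : ObjClass Q :=
  Quotient.lift (s := isIsomorphicSetoid (LabArrow X)) (fun L => cls L.arrow.tgt)
    (fun _ _ h => cls_eq_of_hom hQ h.some.hom.1.tgtMap) t

/-- The action of `T_Q` on objects. -/
def tObj (hQ : Q.IsTidy) (X : Over (ObjClass Q)) : Over (ObjClass Q) :=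
  Over.mk (Y := TObj X) (↾(TObj.tgt hQ))

variable (hQ : Q.IsTidy) {X Y Z : Over (ObjClass Q)}

theorem tObj_hom (L : LabArrow X) :
    (tObj hQ X).hom (L.toClass : TObj X) = cls L.arrow.tgt := rfl

/-- The normal form of an element of `T_Q X`. -/
noncomputable def nf (t : TObj X) (y : Q.Obj) (h : (tObj hQ X).hom t = cls y) :
    Bag (fun x : X.left => rep (X.hom x)) y :=
  LabArrow.nrm (Quotient.out (s := isIsomorphicSetoid (LabArrow X)) t) (conn (by
    rw [← tObj_hom hQ, ← h]
    congr 1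
    exact Quotient.out_eq (s := isIsomorphicSetoid (LabArrow X)) t))

variable {hQ}

theorem nf_toClass (L : LabArrow X) (y : Q.Obj) (h) (a : L.arrow.tgt ⟶ y) :
    nf hQ (L.toClass : TObj X) y h = L.nrm a :=
  LabArrow.nrm_eq_of_toClass_eq hQ
    (Quotient.out_eq (s := isIsomorphicSetoid (LabArrow X)) (L.toClass : TObj X)) _ _

theorem tObj_ind {p : TObj X → Prop} (h : ∀ L : LabArrow X, p L.toClass) (t : TObj X) : p t :=
  Quotient.ind (s := isIsomorphicSetoid (LabArrow X)) h t

theorem nf_push (t : TObj X) {y y' : Q.Obj} (h h') (a : y ⟶ y') :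
    Bag.push a (nf hQ t y h) = nf hQ t y' h' := by
  induction t using tObj_ind with
  | h L =>
  rw [nf_toClass L y h (conn h), nf_toClass L y' h' (conn h'), LabArrow.nrm_push]
  congr 1
  exact hom_unique hQ _ _

theorem tObj_ext {t t' : TObj X} {y : Q.Obj} (h h') (hn : nf hQ t y h = nf hQ t' y h') :
    t = t' := by
  induction t using tObj_ind with
  | h L =>
  induction t' using tObj_ind with
  | h M =>
  rw [nf_toClass L y h (conn h), nf_toClass M y h' (conn h')] at hn
  exact LabArrow.toClass_eq_of_nrm hQ _ _ hn

theorem var_congr (hQ : Q.IsTidy) {x x' : X.left} (h : x = x') {y : Q.Obj}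
    (a : rep (X.hom x) ⟶ y) (b : rep (X.hom x') ⟶ y) :
    Bag.var (zs := fun x : X.left => rep (X.hom x)) x a = Bag.var x' b := by
  subst h
  rw [hom_unique hQ a b]

namespace LabArrow

/-- Labels together with the objects they label. -/
abbrev Lb (X : Over (ObjClass Q)) : Type u := { p : X.left × Q.Obj // X.hom p.1 = cls p.2 }

/-- The labelled arrow `L` as an arrow with named inputs. -/
def lb (L : LabArrow X) : Bag (fun p : Lb X => p.1.2) L.arrow.tgt :=
  Bag.mk (fun p : Lb X => p.1.2) (fun j => ⟨(L.lab j, L.arrow.src j), L.compat j⟩) L.arrow.arr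

theorem nrm_eq_lb (L : LabArrow X) {y : Q.Obj} (h : L.arrow.tgt ⟶ y) :
    L.nrm h = Bag.push h (Bag.bind L.lb fun p => Bag.var p.1.1 (conn ((cls_rep _).trans p.2))) := by
  unfold nrm
  congr 1

theorem lb_flatten (α : Elt Q) (M : ∀ _ : Fin α.arity, LabArrow X)
    (c : ∀ i, (M i).arrow.tgt ⟶ α.src i) :
    (flatten α M c).lb = Bag.bind (Bag.of α.arr) fun i => Bag.push (c i) (M i).lb :=
  (Bag.bind_mk (ws := α.src) (zs := fun p : Lb X => p.1.2) id α.arr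
    (fun i => Bag.push (c i) (M i).lb)
    (fun i => concat fun _ : Fin 1 => fun j =>
      ⟨((M i).lab j, (M i).arrow.src j), (M i).compat j⟩)
    (fun i => Q.comp (Q.ι (c i)) fun _ => (M i).arrow.arr)
    (fun i => Bag.push_mk (c i) _ _)).symm

theorem nrm_flatten (α : Elt Q) (M : ∀ _ : Fin α.arity, LabArrow X)
    (c : ∀ i, (M i).arrow.tgt ⟶ α.src i) {y : Q.Obj} (h : α.tgt ⟶ y) :
    (flatten α M c).nrm h = Bag.push h (Bag.bind (Bag.of α.arr) fun i => (M i).nrm (c i)) := by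
  refine (nrm_eq_lb _ _).trans (congrArg (Bag.push h) ?_)
  refine (congrArg (fun t => Bag.bind t fun p : Lb X =>
    Bag.var p.1.1 (conn ((cls_rep _).trans p.2))) (lb_flatten α M c)).trans ?_
  refine (Bag.bind_assoc (Bag.of α.arr) (fun i => Bag.push (c i) (M i).lb) _).trans
    (congrArg (Bag.bind _) (funext fun i => ?_))
  rw [Bag.bind_push, nrm_eq_lb]

end LabArrow

variable (hQ) in
/-- The composite of the labels of a labelled arrow with that arrow. -/
noncomputable def muAux (L : LabArrow (tObj hQ X)) : LabArrow X :=
  LabArrow.flatten L.arrow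
    (fun i => Quotient.out (s := isIsomorphicSetoid (LabArrow X)) (L.lab i))
    (fun i => conn (by
      rw [← tObj_hom hQ, ← L.compat i]
      congr 1
      exact Quotient.out_eq (s := isIsomorphicSetoid (LabArrow X)) (L.lab i)))

theorem nrm_muAux (L : LabArrow (tObj hQ X)) {y : Q.Obj} (h : L.arrow.tgt ⟶ y) :
    (muAux hQ L).nrm h = Bag.bind (L.nrm h) fun t => nf hQ t (rep ((tObj hQ X).hom t))
      (cls_rep _).symm := by
  refine (LabArrow.nrm_flatten _ _ _ h).trans ?_
  unfold LabArrow.nrm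
  rw [Bag.bind_push, Bag.bind_assoc]
  congr 2
  funext i
  rw [Bag.bind_var, nf_push _ _ (L.compat i)]
  rfl

variable (hQ) in
/-- The action of `T_Q` on morphisms. -/
def tMap (h : X ⟶ Y) : tObj hQ X ⟶ tObj hQ Y :=
  Over.homMk (↾(Quotient.map (sa := isIsomorphicSetoid (LabArrow X))
      (sb := isIsomorphicSetoid (LabArrow Y)) (LabArrow.relabel h)
      (fun _ _ ⟨i⟩ => ⟨⟨⟨i.hom.1, fun j => congrArg h.left (i.hom.2 j)⟩,
        ⟨i.inv.1, fun j => congrArg h.left (i.inv.2 j)⟩,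
        Subtype.ext (show i.hom.1 ≫ i.inv.1 = 𝟙 _ from congrArg Subtype.val i.hom_inv_id),
        Subtype.ext (show i.inv.1 ≫ i.hom.1 = 𝟙 _ from
          congrArg Subtype.val i.inv_hom_id)⟩⟩)))
    (by
      ext t
      induction t using tObj_ind with
      | h L => rfl)

theorem tMap_toClass (h : X ⟶ Y) (L : LabArrow X) :
    (tMap hQ h).left (L.toClass : TObj X) = (L.relabel h).toClass := rfl

theorem nf_tMap (h : X ⟶ Y) (t : TObj X) (y : Q.Obj) (h1) (h2) :
    nf hQ ((tMap hQ h).left t) y h1 = Bag.bind (nf hQ t y h2)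
      fun x => Bag.var (zs := fun x : Y.left => rep (Y.hom x)) (h.left x)
        (conn (by rw [over_w_apply])) := by
  induction t using tObj_ind with
  | h L =>
  rw [nf_toClass L y h2 (conn h2)]
  refine (nf_toClass (L.relabel h) y h1 (conn h2)).trans ?_
  unfold LabArrow.nrm
  rw [Bag.bind_push, Bag.bind_assoc]
  refine congrArg (Bag.push (conn h2)) (congrArg (Bag.bind _) ?_)
  funext j
  rw [Bag.bind_var, Bag.push_var]
  exact var_congr hQ rfl _ _

variable (hQ) in
/-- The unit of `T_Q`. -/
noncomputable def tEta (X : Over (ObjClass Q)) : X ⟶ tObj hQ X :=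
  Over.homMk (↾(fun x => (LabArrow.unit x).toClass)) (by ext x; exact cls_rep _)

theorem nf_tEta (x : X.left) (y : Q.Obj) (h) (a : rep (X.hom x) ⟶ y) :
    nf hQ ((tEta hQ X).left x) y h = Bag.var x a := by
  refine (nf_toClass (LabArrow.unit x) y h a).trans ?_
  unfold LabArrow.nrm
  have h1 : Bag.of (LabArrow.unit x).arrow.arr =
    Bag.var (zs := fun _ : Fin 1 => rep (X.hom x)) 0 (𝟙 _) := by
    refine Bag.mk_congr rfl (fun i => Subsingleton.elim (α := Fin 1) _ _) rfl
  refine (congrArg (fun t => Bag.push a (Bag.bind t _)) h1).trans ?_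
  refine (congrArg (Bag.push a) (Bag.bind_var (ws := fun _ : Fin 1 => rep (X.hom x))
    (0 : Fin 1) (𝟙 _) fun j => Bag.var (zs := fun x : X.left => rep (X.hom x))
      ((LabArrow.unit x).lab j) (conn ((cls_rep _).trans ((LabArrow.unit x).compat j))))).trans ?_
  rw [Bag.push_id, Bag.push_var]
  exact var_congr hQ rfl _ _

variable (hQ) in
/-- The multiplication of `T_Q`. -/
noncomputable def tMu (X : Over (ObjClass Q)) : tObj hQ (tObj hQ X) ⟶ tObj hQ X :=
  Over.homMk (↾(Quotient.lift (s := isIsomorphicSetoid (LabArrow (tObj hQ X)))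
      (fun L => (muAux hQ L).toClass) (fun L M ⟨i⟩ => by
        refine LabArrow.toClass_eq_of_nrm hQ i.hom.1.tgtMap (𝟙 _) ?_
        refine (nrm_muAux L _).trans (Eq.trans ?_ (nrm_muAux M (𝟙 _)).symm)
        rw [LabArrow.nrm_eq_of_hom hQ i.hom _ (𝟙 _)])))
    (by
      ext t
      induction t using tObj_ind with
      | h L => rfl)

theorem nf_tMu (t : TObj (tObj hQ X)) (y : Q.Obj) (h h') :
    nf hQ ((tMu hQ X).left t) y h = Bag.bind (nf hQ t y h')
      fun t => nf hQ t (rep ((tObj hQ X).hom t)) (cls_rep _).symm := by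
  induction t using tObj_ind with
  | h L =>
  rw [nf_toClass L y h' (conn h'), ← nrm_muAux]
  exact nf_toClass (muAux hQ L) y h (conn h')

theorem over_ext {S : Type u} {X Y : Over S} {f g : X ⟶ Y} (h : ∀ x, f.left x = g.left x) :
    f = g := by
  ext x
  exact h x

variable (hQ) in
/-- The monad `T_Q` on `Set/S`. -/
noncomputable def zetaMonad : Monad (Over (ObjClass Q)) where
  obj := tObj hQ
  map := tMap hQ
  map_id X := over_ext fun t => by
    induction t using tObj_ind with
    | h L => rfl
  map_comp f g := over_ext fun t => by
    induction t using tObj_ind with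
    | h L => rfl
  η := { app := tEta hQ
         naturality := fun X Y f => over_ext fun x => by
          have h1 : (tObj hQ Y).hom ((tEta hQ Y).left (f.left x)) = cls (rep (X.hom x)) := by
            rw [over_w_apply, over_w_apply, cls_rep]
          have h2 : (tObj hQ X).hom ((tEta hQ X).left x) = cls (rep (X.hom x)) := by
            rw [over_w_apply, cls_rep]
          refine tObj_ext (hQ := hQ) (y := rep (X.hom x))
            (t := (tEta hQ Y).left (f.left x)) (t' := (tMap hQ f).left ((tEta hQ X).left x))
            h1 ((over_w_apply _ _).trans h2) ?_
          rw [nf_tEta _ _ _ (conn (by rw [over_w_apply])), nf_tMap _ _ _ _ h2,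
            nf_tEta _ _ _ (𝟙 _), Bag.bind_var, Bag.push_id] }
  μ := { app := tMu hQ
         naturality := fun X Y f => over_ext fun t => by
          have h0 : cls (rep ((tObj hQ (tObj hQ X)).hom t)) = (tObj hQ (tObj hQ X)).hom t :=
            cls_rep _
          have h1 : (tObj hQ (tObj hQ Y)).hom ((tMap hQ (tMap hQ f)).left t) =
            cls (rep ((tObj hQ (tObj hQ X)).hom t)) := (over_w_apply _ _).trans h0.symm
          have h2 : (tObj hQ X).hom ((tMu hQ X).left t) =
            cls (rep ((tObj hQ (tObj hQ X)).hom t)) := (over_w_apply _ _).trans h0.symm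
          refine tObj_ext (hQ := hQ) (y := rep ((tObj hQ (tObj hQ X)).hom t))
            (t := (tMu hQ Y).left ((tMap hQ (tMap hQ f)).left t))
            (t' := (tMap hQ f).left ((tMu hQ X).left t))
            ((over_w_apply _ _).trans h1) ((over_w_apply _ _).trans h2) ?_
          rw [nf_tMu _ _ _ h1, nf_tMap _ _ _ _ h0.symm, nf_tMap _ _ _ _ h2,
            nf_tMu _ _ _ h0.symm, Bag.bind_assoc, Bag.bind_assoc]
          congr 1
          funext s
          rw [Bag.bind_var, nf_push _ _ ((over_w_apply _ _).trans (cls_rep _).symm)]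
          exact nf_tMap f s _ _ (cls_rep _).symm }
  left_unit X := over_ext fun t => by
    have h0 : cls (rep ((tObj hQ X).hom t)) = (tObj hQ X).hom t := cls_rep _
    have h1 : (tObj hQ (tObj hQ X)).hom ((tEta hQ (tObj hQ X)).left t) =
      cls (rep ((tObj hQ X).hom t)) := (over_w_apply _ _).trans h0.symm
    refine tObj_ext (hQ := hQ) (y := rep ((tObj hQ X).hom t))
      (t := (tMu hQ X).left ((tEta hQ (tObj hQ X)).left t)) (t' := t)
      ((over_w_apply _ _).trans h1) h0.symm ?_
    rw [nf_tMu _ _ _ h1, nf_tEta _ _ _ (𝟙 _), Bag.bind_var, Bag.push_id]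
  right_unit X := over_ext fun t => by
    have h0 : cls (rep ((tObj hQ X).hom t)) = (tObj hQ X).hom t := cls_rep _
    have h1 : (tObj hQ (tObj hQ X)).hom ((tMap hQ (tEta hQ X)).left t) =
      cls (rep ((tObj hQ X).hom t)) := (over_w_apply _ _).trans h0.symm
    refine tObj_ext (hQ := hQ) (y := rep ((tObj hQ X).hom t))
      (t := (tMu hQ X).left ((tMap hQ (tEta hQ X)).left t)) (t' := t)
      ((over_w_apply _ _).trans h1) h0.symm ?_
    rw [nf_tMu _ _ _ h1, nf_tMap _ _ _ _ h0.symm, Bag.bind_assoc]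
    refine Eq.trans (congrArg (Bag.bind _) (funext fun s => ?_)) (Bag.bind_pure _)
    rw [Bag.bind_var, nf_push _ _ ((over_w_apply _ _).trans (cls_rep _).symm),
      nf_tEta _ _ _ (𝟙 _)]
  assoc X := over_ext fun t => by
    have h0 : (tObj hQ (tObj hQ (tObj hQ X))).hom t =
      cls (rep ((tObj hQ (tObj hQ (tObj hQ X))).hom t)) := (cls_rep _).symm
    have h1 := (over_w_apply (tMap hQ (tMu hQ X)) t).trans h0
    have h2 := (over_w_apply (tMu hQ (tObj hQ X)) t).trans h0
    refine tObj_ext (hQ := hQ) (y := rep ((tObj hQ (tObj hQ (tObj hQ X))).hom t))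
      (t := (tMu hQ X).left ((tMap hQ (tMu hQ X)).left t))
      (t' := (tMu hQ X).left ((tMu hQ (tObj hQ X)).left t))
      ((over_w_apply _ _).trans h1) ((over_w_apply _ _).trans h2) ?_
    rw [nf_tMu _ _ _ h1, nf_tMap _ _ _ _ h0, nf_tMu _ _ _ h2, nf_tMu _ _ _ h0,
      Bag.bind_assoc, Bag.bind_assoc]
    congr 1
    funext s
    rw [Bag.bind_var, nf_push _ _ ((over_w_apply _ _).trans (cls_rep _).symm)]
    exact nf_tMu s _ _ (cls_rep _).symm

end SymMulticat
end Opetopic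

namespace Opetopic

theorem isPullback_over {S : Type u} {P X Y Z : Over S} {p : P ⟶ X} {q : P ⟶ Y} {f : X ⟶ Z}
    {g : Y ⟶ Z} (sq : ∀ t, f.left (p.left t) = g.left (q.left t))
    (inj : ∀ t t', p.left t = p.left t' → q.left t = q.left t' → t = t')
    (ex : ∀ x y, f.left x = g.left y → ∃ t, p.left t = x ∧ q.left t = y) :
    IsPullback p q f g := by
  have hw : p ≫ f = q ≫ g := by
    ext t
    exact sq t
  have hs : ∀ (s : PullbackCone f g) x, f.left (s.fst.left x) = g.left (s.snd.left x) :=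
    fun s x => congrArg (fun k : s.pt ⟶ Z => k.left x) s.condition
  refine ⟨⟨hw⟩, ⟨PullbackCone.IsLimit.mk hw
    (fun s => Over.homMk (↾fun x => (ex _ _ (hs s x)).choose) ?_) ?_ ?_ ?_⟩⟩
  · ext x
    have h1 := (ex _ _ (hs s x)).choose_spec.1
    exact (over_w_apply p _).symm.trans ((congrArg X.hom h1).trans (over_w_apply s.fst x))
  · intro s
    ext x
    exact (ex _ _ (hs s x)).choose_spec.1
  · intro s
    ext x
    exact (ex _ _ (hs s x)).choose_spec.2
  · intro s m h1 h2
    ext x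
    refine inj _ _ ?_ ?_
    · exact (congrArg (fun k : s.pt ⟶ X => k.left x) h1).trans
        (ex _ _ (hs s x)).choose_spec.1.symm
    · exact (congrArg (fun k : s.pt ⟶ Y => k.left x) h2).trans
        (ex _ _ (hs s x)).choose_spec.2.symm

theorem isPullback_over_elim {S : Type u} {P X Y Z : Over S} {p : P ⟶ X} {q : P ⟶ Y} {f : X ⟶ Z}
    {g : Y ⟶ Z} (h : IsPullback p q f g) :
    (∀ t, f.left (p.left t) = g.left (q.left t)) ∧
    (∀ t t', p.left t = p.left t' → q.left t = q.left t' → t = t') ∧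
    (∀ x y, f.left x = g.left y → ∃ t, p.left t = x ∧ q.left t = y) := by
  refine ⟨fun t => congrArg (fun k : P ⟶ Z => k.left t) h.w, fun t t' h1 h2 => ?_,
    fun x y hxy => ?_⟩
  · have hP : P.hom t' = P.hom t := by
      rw [← over_w_apply p, ← over_w_apply p, h1]
    let a : Over.mk (↾fun _ : PUnit.{u + 1} => P.hom t) ⟶ P :=
      Over.homMk (↾fun _ => t) (by ext; rfl)
    let b : Over.mk (↾fun _ : PUnit.{u + 1} => P.hom t) ⟶ P :=
      Over.homMk (↾fun _ => t') (by ext; exact hP)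
    have : a = b := h.hom_ext (by ext; exact h1) (by ext; exact h2)
    exact congrArg (fun k : Over.mk (↾fun _ : PUnit.{u + 1} => P.hom t) ⟶ P =>
      k.left PUnit.unit) this
  · have hY : Y.hom y = X.hom x := by
      rw [← over_w_apply f, ← over_w_apply g, hxy]
    let a : Over.mk (↾fun _ : PUnit.{u + 1} => X.hom x) ⟶ X :=
      Over.homMk (↾fun _ => x) (by ext; rfl)
    let b : Over.mk (↾fun _ : PUnit.{u + 1} => X.hom x) ⟶ Y :=
      Over.homMk (↾fun _ => y) (by ext; exact hY)
    have hab : a ≫ f = b ≫ g := by ext; exact hxy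
    refine ⟨(h.lift a b hab).left PUnit.unit, ?_, ?_⟩
    · exact congrArg (fun k : Over.mk (↾fun _ : PUnit.{u + 1} => X.hom x) ⟶ X =>
        k.left PUnit.unit) (h.lift_fst a b hab)
    · exact congrArg (fun k : Over.mk (↾fun _ : PUnit.{u + 1} => X.hom x) ⟶ Y =>
        k.left PUnit.unit) (h.lift_snd a b hab)

theorem preservesPullbacks_of_isPullback {C : Type v} [Category.{w} C] [HasPullbacks C]
    {D : Type*} [Category* D] (F : C ⥤ D)
    (h : ∀ {P X Y Z : C} (p : P ⟶ X) (q : P ⟶ Y) (f : X ⟶ Z) (g : Y ⟶ Z), IsPullback p q f g →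
      IsPullback (F.map p) (F.map q) (F.map f) (F.map g)) :
    PreservesLimitsOfShape WalkingCospan F where
  preservesLimit {K} := by
    have : PreservesLimit (cospan (K.map WalkingCospan.Hom.inl) (K.map WalkingCospan.Hom.inr)) F :=
      preservesLimit_of_preserves_limit_cone (pullbackIsPullback _ _)
        ((isLimitMapConePullbackConeEquiv F pullback.condition).symm
          (h _ _ _ _ (IsPullback.of_hasPullback _ _)).isLimit)
    exact preservesLimit_of_iso_diagram F (diagramIsoCospan K).symm

namespace SymMulticat
open SymMulticatData

variable {Q : SymMulticat.{u}}

theorem hom_symm (hQ : Q.IsTidy) {x y : Q.Obj} (a : x ⟶ y) : Nonempty (y ⟶ x) :=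
  (equiv_discrete_iff.1 hQ.discrete).2 _ _ a

variable {hQ : Q.IsTidy} {X Y Z : Over (ObjClass Q)}

namespace LabArrow

/-- Transport of labels along a morphism of arrows. -/
def pull (hQ : Q.IsTidy) {α : Elt Q} (M : LabArrow X) (φ : α ⟶ M.arrow) : LabArrow X where
  arrow := α
  lab j := M.lab (φ.perm j)
  compat j := (M.compat _).trans (cls_eq_of_hom hQ (φ.srcMap j))

theorem pull_toClass (hQ : Q.IsTidy) {α : Elt Q} (M : LabArrow X) (φ : α ⟶ M.arrow) :
    (M.pull hQ φ).toClass = M.toClass :=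
  toClass_eq_of_hom hQ (L := M.pull hQ φ) ⟨φ, fun _ => rfl⟩

theorem mk_congr {α : Elt Q} {l l' : Fin α.arity → X.left} (h : l = l') (c c') :
    (⟨α, l, c⟩ : LabArrow X) = ⟨α, l', c'⟩ := by
  subst h
  rfl

theorem lab_eq (hQ : Q.IsTidy) {α : Elt Q} {l l' : Fin α.arity → X.left} (c c')
    (h : (⟨α, l, c⟩ : LabArrow X).toClass = (⟨α, l', c'⟩ : LabArrow X).toClass) : l = l' := by
  obtain ⟨φ⟩ := hom_of_toClass_eq h
  have h1 : φ.1 = 𝟙 α := elt_hom_unique hQ _ _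
  funext j
  have h2 := φ.2 j
  rw [h1] at h2
  exact h2.symm

end LabArrow

theorem tMap_isPullback {P : Over (ObjClass Q)} {p : P ⟶ X} {q : P ⟶ Y} {f : X ⟶ Z} {g : Y ⟶ Z}
    (h : IsPullback p q f g) :
    IsPullback (tMap hQ p) (tMap hQ q) (tMap hQ f) (tMap hQ g) := by
  obtain ⟨sq, inj, ex⟩ := isPullback_over_elim h
  refine isPullback_over (fun t => ?_) (fun t t' h1 h2 => ?_) (fun s t h1 => ?_)
  · induction t using tObj_ind with
    | h L =>
    exact congrArg LabArrow.toClass (show (L.relabel p).relabel f = (L.relabel q).relabel g by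
      unfold LabArrow.relabel
      congr 1
      funext j
      exact sq _)
  · induction t using tObj_ind with
    | h L =>
    induction t' using tObj_ind with
    | h M =>
    obtain ⟨φ⟩ := LabArrow.hom_of_toClass_eq (L := L.relabel p) (M := M.relabel p) h1
    obtain ⟨ψ⟩ := LabArrow.hom_of_toClass_eq (L := L.relabel q) (M := M.relabel q) h2
    have hφ : φ.1 = ψ.1 := elt_hom_unique hQ _ _
    refine LabArrow.toClass_eq_of_hom hQ (L := L) (M := M) ⟨φ.1, fun j => ?_⟩
    refine inj _ _ (φ.2 j) ?_
    rw [hφ]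
    exact ψ.2 j
  · induction s using tObj_ind with
    | h L =>
    induction t using tObj_ind with
    | h M =>
    obtain ⟨φ⟩ := LabArrow.hom_of_toClass_eq (L := L.relabel f) (M := M.relabel g) h1
    have h2 : ∀ j, ∃ t, p.left t = L.lab j ∧ q.left t = M.lab (φ.1.perm j) :=
      fun j => ex _ _ (φ.2 j).symm
    choose l hl1 hl2 using h2
    refine ⟨LabArrow.toClass (X := P) ⟨L.arrow, l, fun j => ?_⟩, ?_, ?_⟩
    · rw [← L.compat j, ← hl1, over_w_apply]
    · refine congrArg LabArrow.toClass (?_ : _ = L)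
      obtain ⟨α, lab, c⟩ := L
      unfold LabArrow.relabel
      congr 1
      funext j
      exact hl1 j
    · refine LabArrow.toClass_eq_of_hom hQ (M := M) ⟨φ.1, fun j => ?_⟩
      exact (hl2 j).symm

theorem unit_hom {s s' : ObjClass Q} (h : s = s') :
    Nonempty ((⟨Q.ι (𝟙 (rep s))⟩ : Elt Q) ⟶ ⟨Q.ι (𝟙 (rep s'))⟩) := by
  subst h
  exact ⟨𝟙 _⟩

theorem tEta_isPullback (f : X ⟶ Y) :
    IsPullback f (tEta hQ X) (tEta hQ Y) (tMap hQ f) := by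
  refine isPullback_over (fun x => ?_) (fun x x' _ h2 => ?_) (fun y t h1 => ?_)
  · exact congrArg (fun k : X ⟶ tObj hQ Y => k.left x) ((zetaMonad hQ).η.naturality f)
  · obtain ⟨φ⟩ := LabArrow.hom_of_toClass_eq (L := LabArrow.unit x) (M := LabArrow.unit x') h2
    exact (φ.2 (0 : Fin 1)).symm
  · induction t using tObj_ind with
    | h L =>
    obtain ⟨φ⟩ := LabArrow.hom_of_toClass_eq (L := LabArrow.unit y) (M := L.relabel f) h1
    have hx : f.left (L.lab (φ.1.perm (0 : Fin 1))) = y := φ.2 (0 : Fin 1)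
    refine ⟨L.lab (φ.1.perm (0 : Fin 1)), hx, ?_⟩
    rw [← LabArrow.pull_toClass hQ L φ.1]
    obtain ⟨ψ⟩ := unit_hom (Q := Q) ((over_w_apply f _).symm.trans (congrArg Y.hom hx))
    refine LabArrow.toClass_eq_of_hom hQ (L := LabArrow.unit _) (M := L.pull hQ φ.1)
      ⟨ψ, fun j => ?_⟩
    exact congrArg (fun i : Fin 1 => L.lab (φ.1.perm i)) (Subsingleton.elim (α := Fin 1) _ _)

/-- An arrow whose inputs are labelled by the classes of a family of labelled arrows. -/
def LabArrow.ofFamily (hQ : Q.IsTidy) (α : Elt Q) (N : ∀ _ : Fin α.arity, LabArrow X)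
    (c : ∀ i, (N i).arrow.tgt ⟶ α.src i) : LabArrow (tObj hQ X) where
  arrow := α
  lab i := (N i).toClass
  compat i := cls_eq_of_hom hQ (c i)

theorem tMu_ofFamily (α : Elt Q) (N : ∀ _ : Fin α.arity, LabArrow X)
    (c : ∀ i, (N i).arrow.tgt ⟶ α.src i) :
    (tMu hQ X).left ((LabArrow.ofFamily hQ α N c).toClass : TObj (tObj hQ X)) =
      (LabArrow.flatten α N c).toClass := by
  change (muAux hQ _).toClass = _
  refine LabArrow.toClass_eq_of_nrm hQ (y := α.tgt) (𝟙 _) (𝟙 _) ?_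
  refine (LabArrow.nrm_flatten _ _ _ (𝟙 _)).trans
    (Eq.trans ?_ (LabArrow.nrm_flatten _ _ _ (𝟙 _)).symm)
  refine congrArg (Bag.push (𝟙 _)) (congrArg (Bag.bind _) (funext fun i => ?_))
  exact LabArrow.nrm_eq_of_toClass_eq hQ
    (Quotient.out_eq (s := isIsomorphicSetoid (LabArrow X)) _) _ _

theorem concat_inj {A : Type w} {n : ℕ} {m : Fin n → ℕ} {z z' : ∀ i, Fin (m i) → A}
    (h : concat z = concat z') : z = z' := by
  funext i j
  rw [← concat_apply z, ← concat_apply z', h]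

theorem concat_surj {A : Type w} {n : ℕ} {m : Fin n → ℕ} (l : Fin (∑ i, m i) → A) :
    ∃ z : ∀ i, Fin (m i) → A, concat z = l :=
  ⟨fun i j => l (finSigmaFinEquiv ⟨i, j⟩), funext fun p => by
    unfold concat
    exact congrArg l (finSigmaFinEquiv.apply_symm_apply p)⟩

theorem tObj_out (s : TObj X) : ∃ L : LabArrow X, L.toClass = s := by
  induction s using tObj_ind with
  | h L => exact ⟨L, rfl⟩

theorem eq_ofFamily (α : Elt Q) (l : Fin α.arity → TObj X) (h)
    (N : ∀ _ : Fin α.arity, LabArrow X) (c : ∀ i, (N i).arrow.tgt ⟶ α.src i)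
    (hN : ∀ i, (N i).toClass = l i) :
    (⟨α, l, h⟩ : LabArrow (tObj hQ X)) = LabArrow.ofFamily hQ α N c := by
  obtain rfl : l = fun i => (N i).toClass := funext fun i => (hN i).symm
  rfl

theorem tgt_hom {L : LabArrow (tObj hQ X)} {i} {N : LabArrow X} (h : N.toClass = L.lab i) :
    Nonempty (N.arrow.tgt ⟶ L.arrow.src i) :=
  ⟨conn (by rw [← tObj_hom hQ, h, L.compat])⟩

theorem flatten_lab_inj (hQ : Q.IsTidy) (α : Elt Q) (N : ∀ _ : Fin α.arity, LabArrow X)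
    (N' : ∀ _ : Fin α.arity, LabArrow X) (h : ∀ i, ∃ l' c', N' i = ⟨(N i).arrow, l', c'⟩)
    (c : ∀ i, (N i).arrow.tgt ⟶ α.src i) (c' : ∀ i, (N' i).arrow.tgt ⟶ α.src i)
    (he : (LabArrow.flatten α N c).toClass = (LabArrow.flatten α N' c').toClass) : N = N' := by
  choose l' hl' h using h
  obtain rfl : N' = _ := funext h
  obtain rfl : c = c' := funext fun i => hom_unique hQ _ _
  have h5 := LabArrow.lab_eq hQ _ _ he
  have h6 := concat_inj h5
  funext i
  have h7 := congrFun (concat_inj (congrFun h6 i)) 0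
  change (N i).lab = l' i at h7
  simp only [← h7]

theorem tMu_isPullback (f : X ⟶ Y) :
    IsPullback (tMap hQ (tMap hQ f)) (tMu hQ X) (tMu hQ Y) (tMap hQ f) := by
  refine isPullback_over (fun x => ?_) (fun t t' h1 h2 => ?_) (fun s t h1 => ?_)
  · exact (congrArg (fun k : tObj hQ (tObj hQ X) ⟶ tObj hQ Y => k.left x)
      ((zetaMonad hQ).μ.naturality f))
  · obtain ⟨L, rfl⟩ := tObj_out t
    obtain ⟨L', rfl⟩ := tObj_out t'
    obtain ⟨φ, h3⟩ := (LabArrow.hom_of_toClass_eq (L := L.relabel (tMap hQ f))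
      (M := L'.relabel (tMap hQ f)) h1).some
    replace h3 : ∀ i, (tMap hQ f).left (L'.lab (φ.perm i)) = (tMap hQ f).left (L.lab i) := h3
    change L.arrow ⟶ L'.arrow at φ
    have h7 := LabArrow.pull_toClass hQ L' φ
    choose N hN using fun i => tObj_out (L.lab i)
    choose K hK using fun i => tObj_out (L'.lab (φ.perm i))
    have h4 : ∀ i, Nonempty ((N i).relabel f ⟶ (K i).relabel f) := fun i => by
      refine LabArrow.hom_of_toClass_eq ?_
      have h5 := h3 i
      rw [← hN] at h5
      refine h5.symm.trans ?_
      exact congrArg (tMap hQ f).left (hK i).symm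
    let χ := fun i => (h4 i).some
    have c := fun i => (tgt_hom (hN i)).some
    have h8 := fun i => (LabArrow.pull_toClass hQ (K i) (χ i).1).trans (hK i)
    have c' := fun i => (tgt_hom (L := L'.pull hQ φ) (h8 i)).some
    have hL : L = LabArrow.ofFamily hQ L.arrow N c :=
      eq_ofFamily L.arrow L.lab L.compat N c hN
    have hL' : L'.pull hQ φ = LabArrow.ofFamily hQ L.arrow _ c' :=
      eq_ofFamily L.arrow _ _ _ c' h8
    have h9 : (tMu hQ X).left (LabArrow.ofFamily hQ L.arrow N c).toClass =
        (tMu hQ X).left (LabArrow.ofFamily hQ L.arrow _ c').toClass := by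
      rw [← hL, ← hL', h7]
      exact h2
    have h10 := (tMu_ofFamily L.arrow N c).symm.trans (h9.trans (tMu_ofFamily L.arrow _ c'))
    have h11 := flatten_lab_inj hQ _ _ _ (fun i => ⟨_, _, rfl⟩) _ _ h10
    rw [← h7, hL']
    refine (congrArg LabArrow.toClass hL).trans ?_
    exact congrArg LabArrow.toClass
      (eq_ofFamily _ _ _ _ c' fun i => congrArg LabArrow.toClass (congrFun h11 i).symm)
  · obtain ⟨L, rfl⟩ := tObj_out s
    obtain ⟨N, rfl⟩ := tObj_out t
    choose M hM using fun i => tObj_out (L.lab i)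
    have c := fun i => (tgt_hom (hM i)).some
    have hL : L = LabArrow.ofFamily hQ L.arrow M c :=
      eq_ofFamily L.arrow L.lab L.compat M c hM
    have h2 : (LabArrow.flatten L.arrow M c).toClass = (N.relabel f).toClass := by
      refine (tMu_ofFamily L.arrow M c).symm.trans (Eq.trans ?_ h1)
      rw [← hL]
    obtain ⟨φ, h3⟩ := (LabArrow.hom_of_toClass_eq h2).some
    replace h3 : ∀ j, f.left ((N.pull hQ φ).lab j) = (LabArrow.flatten L.arrow M c).lab j := h3
    obtain ⟨z, hz⟩ := concat_surj (N.pull hQ φ).lab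
    choose z' hz' using fun i => concat_surj (z i)
    have hlab : (N.pull hQ φ).lab = concat fun i => concat fun _ => z' i 0 := by
      rw [← hz]
      congr 1
      funext i
      rw [← hz' i]
      congr 1
      funext j
      exact congrArg (z' i) (Subsingleton.elim j 0)
    have hf : ∀ i j, f.left (z' i 0 j) = (M i).lab j := by
      have h4 : (concat fun i => concat fun _ : Fin 1 => fun j => f.left (z' i 0 j)) =
          concat fun i => concat fun _ : Fin 1 => (M i).lab := by
        funext p
        refine Eq.trans ?_ (h3 p)
        exact congrArg f.left (congrFun hlab p).symm
      intro i j
      exact congrFun (congrFun (concat_inj (congrFun (concat_inj h4) i)) 0) j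
    let K : ∀ _ : Fin L.arrow.arity, LabArrow X := fun i => ⟨(M i).arrow, z' i 0, fun j => by
      rw [← (M i).compat, ← hf, over_w_apply]⟩
    refine ⟨(LabArrow.ofFamily hQ L.arrow K c).toClass, ?_, ?_⟩
    · refine (?_ : _ = (LabArrow.ofFamily hQ L.arrow M c).toClass).trans
        (congrArg LabArrow.toClass hL.symm)
      refine congrArg LabArrow.toClass (eq_ofFamily L.arrow _ _ M c fun i => ?_)
      refine congrArg LabArrow.toClass (?_ : _ = (K i).relabel f)
      have h5 : (M i).lab = fun j => f.left (z' i 0 j) := funext fun j => (hf i j).symm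
      unfold LabArrow.relabel
      simp only [K, ← h5]
    · refine (tMu_ofFamily L.arrow K c).trans ?_
      rw [← LabArrow.pull_toClass hQ N φ]
      exact congrArg LabArrow.toClass (LabArrow.mk_congr hlab.symm _ _)

end SymMulticat

end Opetopic

namespace Opetopic

/-- A cartesian monad: the functor part preserves pullbacks, and the naturality squares of the unit
and of the multiplication are pullbacks. -/
structure IsCartesian {C : Type w} [Category.{v} C] (T : Monad C) : Prop where
  preservesPullbacks : PreservesLimitsOfShape WalkingCospan T.toFunctor
  unit : NatTrans.Equifibered T.η
  mult : NatTrans.Equifibered T.μ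

/-- A cartesian monad `(E, T)` on a cartesian category, that is, one with finite limits. -/
structure CartMonad where
  E : Type w
  [cat : Category.{v} E]
  [lim : HasFiniteLimits E]
  T : Monad E
  cartesian : IsCartesian T

attribute [instance] CartMonad.cat CartMonad.lim

namespace CartMonad

/-- A cartesian monad opfunctor `(U, φ) : (E₁, T₁) ⟶ (E₂, T₂)`. -/
@[ext]
structure Hom (M₁ M₂ : CartMonad.{v, w}) where
  U : M₁.E ⥤ M₂.E
  φ : M₁.T.toFunctor ⋙ U ⟶ U ⋙ M₂.T.toFunctor
  preservesPullbacks : PreservesLimitsOfShape WalkingCospan U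
  equifibered : NatTrans.Equifibered φ
  unit : ∀ X, U.map (M₁.T.η.app X) ≫ φ.app X = M₂.T.η.app (U.obj X)
  mult : ∀ X, U.map (M₁.T.μ.app X) ≫ φ.app X =
    φ.app (M₁.T.obj X) ≫ M₂.T.map (φ.app X) ≫ M₂.T.μ.app (U.obj X)

/-- The identity opfunctor. -/
def Hom.id (M : CartMonad.{v, w}) : Hom M M where
  U := 𝟭 _
  φ := { app := fun X => 𝟙 (M.T.obj X) }
  preservesPullbacks := inferInstance
  equifibered := fun X Y f => by
    have : ∀ X, IsIso (𝟙 (M.T.obj X)) := fun X => inferInstance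
    exact @IsPullback.of_vert_isIso _ _ _ _ _ _ _ _ _ _ (this X) (this Y) ⟨by simp⟩
  unit X := by simp
  mult X := by simp

/-- Composition of opfunctors. -/
def Hom.comp {M₁ M₂ M₃ : CartMonad.{v, w}} (F : Hom M₁ M₂) (G : Hom M₂ M₃) : Hom M₁ M₃ where
  U := F.U ⋙ G.U
  φ := { app := fun X => G.U.map (F.φ.app X) ≫ G.φ.app (F.U.obj X)
         naturality := fun X Y f => by
          have h1 := F.φ.naturality f
          have h2 := G.φ.naturality (F.U.map f)
          dsimp at h1 h2 ⊢
          rw [← Category.assoc, ← G.U.map_comp, h1, G.U.map_comp, Category.assoc, h2,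
            Category.assoc] }
  preservesPullbacks :=
    have := F.preservesPullbacks
    have := G.preservesPullbacks
    inferInstance
  equifibered := fun X Y f => by
    have := G.preservesPullbacks
    exact ((F.equifibered f).map G.U).paste_vert (G.equifibered (F.U.map f))
  unit X := by
    have h1 := F.unit X
    have h2 := G.unit (F.U.obj X)
    dsimp at h1 h2 ⊢
    rw [← Category.assoc, ← G.U.map_comp, h1, h2]
  mult X := by
    have h1 := F.mult X
    have h2 := G.mult (F.U.obj X)
    have h3 := G.φ.naturality (F.φ.app X)
    dsimp at h1 h2 h3 ⊢
    rw [← Category.assoc, ← G.U.map_comp, h1, G.U.map_comp, G.U.map_comp]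
    simp only [Category.assoc, Functor.map_comp]
    rw [h2, reassoc_of% h3]

/-- The category of cartesian monads and cartesian monad opfunctors. -/
instance : Category CartMonad.{v, w} where
  Hom := Hom
  id := Hom.id
  comp := Hom.comp
  id_comp F := by
    refine Hom.ext rfl (heq_of_eq ?_)
    ext X
    simp [Hom.id, Hom.comp]
  comp_id F := by
    refine Hom.ext rfl (heq_of_eq ?_)
    ext X
    simp [Hom.id, Hom.comp]
  assoc F G H := by
    refine Hom.ext rfl (heq_of_eq ?_)
    ext X
    simp [Hom.comp]

end CartMonad

section Multicat

variable {C : Type w} [Category.{v} C] [HasFiniteLimits C] {T : Monad C}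

/-- A `T`-graph `T C₀ ← C₁ → C₀` with a map of identities and a map of composition, where the
composite graph `C₁ ∘ C₁` is the pullback of `T c` and `d`. -/
structure TGraphData (T : Monad C) (C₀ : C) where
  C₁ : C
  d : C₁ ⟶ T.obj C₀
  c : C₁ ⟶ C₀
  ids : C₀ ⟶ C₁
  ids_d : ids ≫ d = T.η.app C₀
  ids_c : ids ≫ c = 𝟙 C₀
  comp : pullback (T.map c) d ⟶ C₁
  comp_d : comp ≫ d = pullback.fst _ _ ≫ T.map d ≫ T.μ.app C₀
  comp_c : comp ≫ c = pullback.snd _ _ ≫ c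

namespace TGraphData

variable {C₀ : C} (G : TGraphData T C₀)

/-- The composite of a `T`-family of arrows with an arrow. -/
noncomputable def compose {W : C} (f : W ⟶ T.obj G.C₁) (g : W ⟶ G.C₁)
    (h : f ≫ T.map G.c = g ≫ G.d) : W ⟶ G.C₁ :=
  pullback.lift f g h ≫ G.comp

theorem compose_d {W : C} (f : W ⟶ T.obj G.C₁) (g : W ⟶ G.C₁) (h) :
    G.compose f g h ≫ G.d = f ≫ T.map G.d ≫ T.μ.app C₀ := by
  unfold compose
  rw [Category.assoc, G.comp_d, pullback.lift_fst_assoc]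

theorem compose_c {W : C} (f : W ⟶ T.obj G.C₁) (g : W ⟶ G.C₁) (h) :
    G.compose f g h ≫ G.c = g ≫ G.c := by
  unfold compose
  rw [Category.assoc, G.comp_c, pullback.lift_snd_assoc]

/-- The composite graph `(C₁ ∘ C₁) ∘ C₁`. -/
noncomputable abbrev Triple : C :=
  pullback (T.map (pullback.snd (T.map G.c) G.d ≫ G.c)) G.d

theorem id_comp_aux : (G.d ≫ T.map G.ids) ≫ T.map G.c = 𝟙 G.C₁ ≫ G.d := by
  rw [Category.assoc, ← T.map_comp, G.ids_c, T.map_id, Category.comp_id, Category.id_comp]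

theorem comp_id_aux : T.η.app G.C₁ ≫ T.map G.c = (G.c ≫ G.ids) ≫ G.d := by
  rw [Category.assoc, G.ids_d]
  exact (T.η.naturality G.c).symm

theorem left_aux : (pullback.fst _ _ ≫ T.map G.comp : G.Triple ⟶ _) ≫ T.map G.c =
    pullback.snd _ _ ≫ G.d := by
  rw [Category.assoc, ← T.map_comp, G.comp_c, pullback.condition]

theorem inner_aux : (pullback.fst _ _ ≫ T.map (pullback.snd _ _) : G.Triple ⟶ _) ≫ T.map G.c =
    pullback.snd _ _ ≫ G.d := by
  rw [Category.assoc, ← T.map_comp, pullback.condition]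

theorem right_aux : (pullback.fst _ _ ≫ T.map (pullback.fst _ _) ≫ T.μ.app _ : G.Triple ⟶ _) ≫
    T.map G.c = G.compose _ _ G.inner_aux ≫ G.d := by
  have h := T.μ.naturality G.c
  dsimp at h
  simp only [Category.assoc, compose_d]
  rw [← h, ← T.map_comp_assoc, pullback.condition, T.map_comp_assoc]

end TGraphData

/-- An `(E, T)`-multicategory with given objects-object `C₀`: identities and composition satisfy the
identity laws and the associative law. -/
structure TMulticat (T : Monad C) (C₀ : C) extends TGraphData T C₀ where
  id_comp : toTGraphData.compose _ _ toTGraphData.id_comp_aux = 𝟙 C₁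
  comp_id : toTGraphData.compose _ _ toTGraphData.comp_id_aux = 𝟙 C₁
  assoc : toTGraphData.compose _ _ toTGraphData.left_aux =
    toTGraphData.compose _ _ toTGraphData.right_aux

/-- A morphism of `(E, T)`-multicategories which is the identity on objects. -/
@[ext]
structure TMulticat.Hom {C₀ : C} (G H : TMulticat T C₀) where
  hom : G.C₁ ⟶ H.C₁
  d : hom ≫ H.d = G.d
  c : hom ≫ H.c = G.c
  ids : G.ids ≫ hom = H.ids
  comp : G.comp ≫ hom = H.compose (pullback.fst _ _ ≫ T.map hom) (pullback.snd _ _ ≫ hom)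
    (by rw [Category.assoc, Category.assoc, ← T.map_comp, c, d, pullback.condition])

theorem TMulticat.Hom.compose {C₀ : C} {G H : TMulticat T C₀} (F : G.Hom H) {W : C}
    (f : W ⟶ T.obj G.C₁) (g : W ⟶ G.C₁) (h) :
    G.compose f g h ≫ F.hom = H.compose (f ≫ T.map F.hom) (g ≫ F.hom)
      (by rw [Category.assoc, Category.assoc, ← T.map_comp, F.c, F.d, h]) := by
  unfold TGraphData.compose
  rw [Category.assoc, F.comp]
  unfold TGraphData.compose
  rw [← Category.assoc]
  congr 1
  apply pullback.hom_ext
  · rw [Category.assoc, pullback.lift_fst, pullback.lift_fst_assoc, pullback.lift_fst]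
  · rw [Category.assoc, pullback.lift_snd, pullback.lift_snd_assoc, pullback.lift_snd]

instance (C₀ : C) : Category (TMulticat T C₀) where
  Hom := TMulticat.Hom
  id G :=
    { hom := 𝟙 _
      d := Category.id_comp _
      c := Category.id_comp _
      ids := Category.comp_id _
      comp := by
        unfold TGraphData.compose
        refine (Category.comp_id _).trans ((Category.id_comp _).symm.trans ?_)
        congr 1
        apply pullback.hom_ext <;> simp }
  comp F K :=
    { hom := F.hom ≫ K.hom
      d := by rw [Category.assoc, K.d, F.d]
      c := by rw [Category.assoc, K.c, F.c]
      ids := by rw [← Category.assoc, F.ids, K.ids]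
      comp := by
        rw [← Category.assoc, F.comp, K.compose]
        congr 1 <;> simp }
  id_comp F := TMulticat.Hom.ext (Category.id_comp _)
  comp_id F := TMulticat.Hom.ext (Category.comp_id _)
  assoc F G H := TMulticat.Hom.ext (Category.assoc _ _ _)

/-- The category of `(E, T)`-operads: multicategories whose objects-object is terminal. -/
abbrev Operad (T : Monad C) : Type (max v w) := TMulticat T (⊤_ C)

/-- The forgetful functor from operads to `E / T1`, sending an operad to its underlying graph
`d : C₁ ⟶ T1`. -/
noncomputable def operadForget (T : Monad C) : Operad T ⥤ Over (T.obj (⊤_ C)) where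
  obj G := Over.mk G.d
  map F := Over.homMk F.hom F.d
  map_id _ := rfl
  map_comp _ _ := rfl

end Multicat

/-- The cartesian monad `ζ(Q) = (Set/S, T_Q)` of a tidy symmetric multicategory `Q`. -/
noncomputable def zeta (Q : SymMulticat.{u}) (hQ : Q.IsTidy) : CartMonad.{u, u + 1} where
  E := Over (SymMulticat.ObjClass Q)
  T := SymMulticat.zetaMonad hQ
  cartesian :=
    { preservesPullbacks := preservesPullbacks_of_isPullback _ fun _ _ _ _ h =>
        SymMulticat.tMap_isPullback h
      unit := fun _ _ f => SymMulticat.tEta_isPullback f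
      mult := fun _ _ f => SymMulticat.tMu_isPullback f }

end Opetopic

/-! Both monads are monads of trees. An element of the free operad on a graph `X ⟶ T_Q 1` is
obtained by grafting elements of `X` onto each other along the inputs of the arrows of `Q` which
they lie over. An element of `T_{Q⁺} X` is a class of configurations whose nodes are labelled by
elements of `X`. A configuration carries more data than an abstract tree: edge labels, a numbering
of the nodes and a permutation of the leaves. Tidiness makes parallel object-morphisms equal,
passing to isomorphism classes removes the numbering, and the leaf permutation is determined by the
tree together with its composite, because `Q` is freely symmetric.

Free operads. Let `T` be a monad on `Set/S` presented by operations (`Shapes`). Trees with nodes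
from a fixed set form a monad, and composing a tree in `T` is a monad morphism `evMonadHom` to `T`.
If `T` is cartesian, this morphism is equifibered (`equifibered_evMonadHom`): a tree with labelled
leaves amounts to a shape together with a labelling of its composite. For every equifibered `M ⟶ T`,
the naturality square at `M 1 ⟶ 1` identifies `M M 1` with the composite graph `T M 1 ×_{T 1} M 1`,
so the monad structure of `M` makes `M 1 ⟶ T 1` an operad (`operadOfMonadHom`). Applied to trees
this gives the free operad. Recursive evaluation of trees is a morphism of operads (`extHom_bind`),
and it is the only one extending the given map, since every tree is a composite of one-node trees
and identities (`hom_eq_extHom`).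

Comparison. Elements of `T_Q 1` are isomorphism classes of arrows of `Q`, that is, classes of
objects of `Q⁺`. Hence `(Set/S)/T_Q 1` and the base category of `ζ(Q⁺)` are isomorphic categories,
through `overSlice` and `sliceOver`. The map `toTree` sends a class of labelled configurations to
its abstract tree. It respects units and multiplications because substituting trees for nodes is
evaluation in a free operad (`extHom_subst`). It is injective because configurations with the same
abstract tree can be superposed (`Tree.exists_zip`, `shapeTree_injective`), and surjective by
induction on trees (`exists_toTree_node`).

The monad of any other left adjoint is canonically isomorphic to the tree monad. Cartesianness is
carried over from `ζ(Q⁺)` along `overSlice`, and strict invertibility of `overSlice` yields an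
isomorphism in `CartMonad`. -/

namespace Opetopic

/-! ### The operad `M 1` of an equifibered monad morphism `M ⟶ T`. -/

section OperadOfMonadHom

variable {C : Type w} [Category.{v} C] {M T : Monad C} (ε : M ⟶ T)

theorem monadHom_naturality {X Y : C} (f : X ⟶ Y) :
    M.map f ≫ ε.app Y = ε.app X ≫ T.map f := ε.naturality f

theorem monadHom_mu (X : C) :
    M.μ.app X ≫ ε.app X = ε.app (M.obj X) ≫ T.map (ε.app X) ≫ T.μ.app X := by
  rw [ε.app_μ, monadHom_naturality, Category.assoc]

theorem monadHom_eta (X : C) : M.η.app X ≫ ε.app X = T.η.app X := ε.app_η X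

theorem exists_lift_of_equifibered {ε : M ⟶ T} (hε : NatTrans.Equifibered ε.toNatTrans)
    {W X Y : C} (f : X ⟶ Y) (a : W ⟶ M.obj Y) (b : W ⟶ T.obj X)
    (h : a ≫ ε.app Y = b ≫ T.map f) : ∃ k : W ⟶ M.obj X, k ≫ M.map f = a ∧ k ≫ ε.app X = b :=
  ⟨(hε f).lift a b h, (hε f).lift_fst a b h, (hε f).lift_snd a b h⟩

variable [HasFiniteLimits C]

/-- The composite graph of the graph `M 1 ⟶ T 1`. -/
noncomputable abbrev compDomain : C :=
  pullback (T.map (terminal.from (M.obj (⊤_ C)))) (ε.app (⊤_ C))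

/-- The comparison of `M M 1` with the composite graph of `M 1 ⟶ T 1`. -/
noncomputable def toCompDomain : M.obj (M.obj (⊤_ C)) ⟶ compDomain ε :=
  pullback.lift (ε.app _) (M.map (terminal.from _)) (ε.naturality _).symm

theorem toCompDomain_fst : toCompDomain ε ≫ pullback.fst _ _ = ε.app _ :=
  pullback.lift_fst _ _ _

theorem toCompDomain_snd : toCompDomain ε ≫ pullback.snd _ _ = M.map (terminal.from _) :=
  pullback.lift_snd _ _ _

variable {ε} (hε : NatTrans.Equifibered ε.toNatTrans)

/-- The inverse of `toCompDomain`. -/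
noncomputable def ofCompDomain : compDomain ε ⟶ M.obj (M.obj (⊤_ C)) :=
  (hε (terminal.from (M.obj (⊤_ C)))).lift (pullback.snd _ _) (pullback.fst _ _)
    pullback.condition.symm

theorem ofCompDomain_app : ofCompDomain hε ≫ ε.app _ = pullback.fst _ _ :=
  (hε _).lift_snd _ _ _

theorem ofCompDomain_map :
    ofCompDomain hε ≫ M.map (terminal.from _) = pullback.snd _ _ :=
  (hε _).lift_fst _ _ _

/-- Maps into `M M 1` are determined by their components in `T M 1` and `M 1`, because the
naturality square of `ε` at `M 1 ⟶ 1` is a pullback. -/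
theorem lift_ofCompDomain {W : C} (k : W ⟶ M.obj (M.obj (⊤_ C)))
    (f : W ⟶ T.obj (M.obj (⊤_ C))) (g : W ⟶ M.obj (⊤_ C)) (h)
    (hf : k ≫ ε.app _ = f) (hg : k ≫ M.map (terminal.from _) = g) :
    (pullback.lift f g h : W ⟶ compDomain ε) ≫ ofCompDomain hε = k := by
  refine (hε (terminal.from (M.obj (⊤_ C)))).hom_ext ?_ ?_
  · refine (Category.assoc _ _ _).trans ?_
    refine (congrArg _ (ofCompDomain_map hε)).trans ((pullback.lift_snd _ _ _).trans hg.symm)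
  · refine (Category.assoc _ _ _).trans ?_
    refine (congrArg _ (ofCompDomain_app hε)).trans ((pullback.lift_fst _ _ _).trans hf.symm)

/-- The graph `M 1 ⟶ T 1` with the unit and the multiplication of `M` as identities and
composition. -/
noncomputable abbrev graphOfMonadHom : TGraphData T (⊤_ C) where
  C₁ := M.obj (⊤_ C)
  d := ε.app _
  c := terminal.from _
  ids := M.η.app _
  ids_d := monadHom_eta ε _
  ids_c := terminal.hom_ext (C := C) _ _
  comp := ofCompDomain hε ≫ M.μ.app _
  comp_d := by
    rw [Category.assoc, monadHom_mu, ← Category.assoc, ofCompDomain_app]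
  comp_c := terminal.hom_ext (C := C) _ _

/-- Reduces operad laws to monad laws: once a composable pair is exhibited as a map `k` into `M M
1`, its composite is `k` followed by the multiplication of `M`. -/
theorem graphOfMonadHom_compose {W : C} (k : W ⟶ M.obj (M.obj (⊤_ C)))
    (f : W ⟶ T.obj (M.obj (⊤_ C))) (g : W ⟶ M.obj (⊤_ C)) (h)
    (hf : k ≫ ε.app _ = f) (hg : k ≫ M.map (terminal.from _) = g) :
    (graphOfMonadHom hε).compose f g h = k ≫ M.μ.app _ := by
  have h1 := lift_ofCompDomain hε k f g h hf hg
  exact (Category.assoc _ _ _).symm.trans (congrArg (fun t => t ≫ M.μ.app (⊤_ C)) h1)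

/-- The operad `M 1` of an equifibered morphism of monads `M ⟶ T`. -/
noncomputable def operadOfMonadHom : Operad T where
  toTGraphData := graphOfMonadHom hε
  id_comp := by
    refine (graphOfMonadHom_compose hε (M.map (M.η.app _)) _ _ _ ?_ ?_).trans (M.right_unit _)
    · exact monadHom_naturality ε _
    · refine (M.map_comp _ _).symm.trans ((congrArg M.map ?_).trans (M.map_id _))
      exact terminal.hom_ext (C := C) _ _
  comp_id := by
    refine (graphOfMonadHom_compose hε (M.η.app _) _ _ _ ?_ ?_).trans (M.left_unit _)
    · exact monadHom_eta ε _
    · exact (M.η.naturality _).symm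
  assoc := by
    let p : compDomain ε ⟶ T.obj (M.obj (⊤_ C)) := pullback.fst _ _
    let q : compDomain ε ⟶ M.obj (⊤_ C) := pullback.snd _ _
    have hp : ofCompDomain hε ≫ ε.app _ = p := ofCompDomain_app hε
    have hq : ofCompDomain hε ≫ M.map (terminal.from _) = q := ofCompDomain_map hε
    let P : (graphOfMonadHom hε).Triple ⟶ T.obj (compDomain ε) := pullback.fst _ _
    let R : (graphOfMonadHom hε).Triple ⟶ M.obj (⊤_ C) := pullback.snd _ _
    -- `Triple` maps to the pullback of `T` of the composite graph and `M 1` over `T 1`;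
    -- equifiberedness at `compDomain ε ⟶ 1` identifies that pullback with `M (compDomain ε)`.
    -- Followed by `M.map (ofCompDomain hε)`, the map `k` lands in `M M M 1`, where associativity of
    -- `M` applies.
    obtain ⟨k, hk1, hk2⟩ : ∃ k : (graphOfMonadHom hε).Triple ⟶ M.obj (compDomain ε),
        k ≫ M.map (terminal.from _) = R ∧ k ≫ ε.app _ = P :=
      exists_lift_of_equifibered hε _ R P (by
        refine pullback.condition.symm.trans ?_
        exact congrArg (fun t => _ ≫ T.map t) (terminal.hom_ext (C := C) _ _))
    -- The inner composite on the right-hand side of associativity, expressed through `k`.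
    have hin : (graphOfMonadHom hε).compose (P ≫ T.map q) R
        (by rw [← hk1, ← hk2]; simp only [Category.assoc, ← Functor.map_comp]
            rw [← monadHom_naturality]
            congr 3
            exact terminal.hom_ext (C := C) _ _) =
        k ≫ M.map q ≫ M.μ.app _ := by
      refine (graphOfMonadHom_compose hε (k ≫ M.map q) _ _ _ ?_ ?_).trans (Category.assoc _ _ _)
      · rw [Category.assoc, monadHom_naturality, ← Category.assoc, hk2]
      · rw [Category.assoc, ← M.map_comp]
        refine Eq.trans ?_ hk1
        congr 2
        exact terminal.hom_ext (C := C) _ _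
    refine (graphOfMonadHom_compose hε (k ≫ M.map (ofCompDomain hε ≫ M.μ.app _)) _ _ _ ?_ ?_).trans
      (Eq.trans ?_ (graphOfMonadHom_compose hε (k ≫ M.map (ofCompDomain hε) ≫ M.μ.app _)
        _ _ _ ?_ ?_).symm)
    · rw [Category.assoc, monadHom_naturality, ← Category.assoc, hk2]
    · rw [Category.assoc, ← M.map_comp]
      refine Eq.trans ?_ hk1
      congr 2
      exact terminal.hom_ext (C := C) _ _
    · rw [M.map_comp]
      simp only [Category.assoc]
      rw [M.assoc]
    · have h1 : (k ≫ M.map (ofCompDomain hε) ≫ M.μ.app _) ≫ ε.app _ = P ≫ T.map p ≫ T.μ.app _ := by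
        simp only [Category.assoc]
        rw [monadHom_mu, ← Category.assoc (M.map _), monadHom_naturality, Category.assoc,
          ← Category.assoc k, hk2, ← T.map_comp_assoc, hp]
      exact h1
    · refine Eq.trans ?_ hin.symm
      simp only [Category.assoc]
      have := M.μ.naturality (terminal.from (M.obj (⊤_ C)))
      dsimp at this
      rw [← this, ← M.map_comp_assoc, hq]

end OperadOfMonadHom

end Opetopic

namespace Opetopic

/-! ### Transport of cartesianness along an equivalence. -/

section Transport

universe v₁ v₂ w₁ w₂

variable {C : Type w₁} [Category.{v₁} C] {D : Type w₂} [Category.{v₂} D] {M : Monad C}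
  {K : Monad D} {U : C ⥤ D}

/-- An equivalence reflects pullbacks, so the images under `U` of the naturality squares suffice.
Pasting such an image with a naturality square of the invertible `φ` gives, by `unit` and `mult`, a
square built from pullbacks; cancelling the square of `φ` leaves the claim. -/
theorem IsCartesian.of_equivalence [U.IsEquivalence]
    (φ : M.toFunctor ⋙ U ≅ U ⋙ K.toFunctor)
    (unit : ∀ X, U.map (M.η.app X) ≫ φ.hom.app X = K.η.app (U.obj X))
    (mult : ∀ X, U.map (M.μ.app X) ≫ φ.hom.app X =
      φ.hom.app (M.obj X) ≫ K.map (φ.hom.app X) ≫ K.μ.app (U.obj X))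
    (hK : IsCartesian K) : IsCartesian M where
  preservesPullbacks := by
    have := hK.preservesPullbacks
    have : PreservesLimitsOfShape WalkingCospan (M.toFunctor ⋙ U) :=
      preservesLimitsOfShape_of_natIso φ.symm
    exact preservesLimitsOfShape_of_reflects_of_preserves M.toFunctor U
  unit X Y f := by
    refine IsPullback.of_map U (M.η.naturality f) ?_
    have h := hK.unit (U.map f)
    rw [← unit, ← unit] at h
    exact IsPullback.of_bot h
      (by rw [← U.map_comp, ← U.map_comp]; exact congrArg U.map (M.η.naturality f))
      (NatTrans.Equifibered.of_isIso φ.hom f)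
  mult X Y f := by
    refine IsPullback.of_map U (M.μ.naturality f) ?_
    have h1 : IsPullback (U.map (M.map (M.map f))) (φ.hom.app (M.obj X)) (φ.hom.app (M.obj Y))
      (K.map (U.map (M.map f))) := NatTrans.Equifibered.of_isIso φ.hom (M.map f)
    have h2 : IsPullback (K.map (U.map (M.map f))) (K.map (φ.hom.app X)) (K.map (φ.hom.app Y))
      (K.map (K.map (U.map f))) :=
      IsPullback.of_vert_isIso ⟨by
        rw [← K.map_comp, ← K.map_comp]; exact congrArg K.map (φ.hom.naturality f)⟩
    have h := h1.paste_vert (h2.paste_vert (hK.mult (U.map f)))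
    have e : ∀ X, φ.hom.app (M.obj X) ≫ K.map (φ.hom.app X) ≫ K.μ.app (U.obj X) =
      U.map (M.μ.app X) ≫ φ.hom.app X := fun X => (mult X).symm
    have h' : IsPullback (U.map (M.map (M.map f))) (U.map (M.μ.app X) ≫ φ.hom.app X)
      (U.map (M.μ.app Y) ≫ φ.hom.app Y) (K.map (U.map f)) := by
      rw [← e, ← e]; exact h
    exact IsPullback.of_bot h'
      (by rw [← U.map_comp, ← U.map_comp]; exact congrArg U.map (M.μ.naturality f))
      (NatTrans.Equifibered.of_isIso φ.hom f)

end Transport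

/-! ### Inverting opfunctors whose functor part is strictly invertible. -/

namespace CartMonad

/-- The functor parts agree only propositionally, so the transformations can be compared only up to
`eqToHom`. -/
theorem Hom.ext_of_eqToHom {M₁ M₂ : CartMonad.{v, w}} {F G : Hom M₁ M₂} (hU : F.U = G.U)
    (h : ∀ X, F.φ.app X ≫ M₂.T.map (eqToHom (congrArg (fun H => H.obj X) hU)) =
      eqToHom (congrArg (fun H => H.obj (M₁.T.obj X)) hU) ≫ G.φ.app X) : F = G := by
  obtain ⟨U, φ, _, _, _, _⟩ := F
  obtain ⟨U', φ', _, _, _, _⟩ := G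
  dsimp only at hU
  subst hU
  refine Hom.ext rfl (heq_of_eq ?_)
  ext X
  simpa using h X

variable {M K : CartMonad.{v, w}} (F : Hom M K) (V : K.E ⥤ M.E) (hUV : F.U ⋙ V = 𝟭 _)
  (hVU : V ⋙ F.U = 𝟭 _)

/-- The equality `V U X = X` as an isomorphism. -/
def unitEq (X : M.E) : V.obj (F.U.obj X) ≅ X := eqToIso (congrArg (fun H => H.obj X) hUV)

/-- The equality `U V Y = Y` as an isomorphism. -/
def counitEq (Y : K.E) : F.U.obj (V.obj Y) ≅ Y := eqToIso (congrArg (fun H => H.obj Y) hVU)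

theorem counitEq_naturality {Y Y' : K.E} (f : Y ⟶ Y') :
    F.U.map (V.map f) ≫ (counitEq F V hVU Y').hom = (counitEq F V hVU Y).hom ≫ f := by
  have := (eqToHom hVU).naturality f
  simpa [counitEq, eqToHom_app] using this

/-- A triangle identity; it is automatic, since both sides are `eqToHom` between the same objects.
-/
theorem map_unitEq (X : M.E) : F.U.map (unitEq F V hUV X).hom =
    (counitEq F V hVU (F.U.obj X)).hom := by
  simp [unitEq, counitEq, eqToHom_map]

variable (hφ : ∀ X, IsIso (F.φ.app X))

/-- The second component of the inverse of a cartesian monad opfunctor. -/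
noncomputable def invApp (Y : K.E) : V.obj (K.T.obj Y) ⟶ M.T.obj (V.obj Y) :=
  V.map (K.T.map (counitEq F V hVU Y).inv ≫ inv (F.φ.app (V.obj Y))) ≫ (unitEq F V hUV _).hom

/-- Applying `F.U` eliminates `V` from the morphism part and leaves the inverse of `φ` conjugated by
transports. The laws for the inverse opfunctor are therefore checked after applying the faithful
functor `F.U`. -/
theorem map_invApp (Y : K.E) : F.U.map (invApp F V hUV hVU hφ Y) =
    (counitEq F V hVU (K.T.obj Y)).hom ≫ K.T.map (counitEq F V hVU Y).inv ≫
      inv (F.φ.app (V.obj Y)) := by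
  unfold invApp
  rw [F.U.map_comp, map_unitEq F V hUV hVU]
  exact counitEq_naturality F V hVU _

theorem counitEq_inv_naturality {Y Y' : K.E} (f : Y ⟶ Y') :
    (counitEq F V hVU Y).inv ≫ F.U.map (V.map f) = f ≫ (counitEq F V hVU Y').inv := by
  rw [Iso.inv_comp_eq, ← Category.assoc, Iso.eq_comp_inv]
  exact counitEq_naturality F V hVU f

theorem inv_φ_naturality {X X' : M.E} (f : X ⟶ X') :
    inv (F.φ.app X) ≫ F.U.map (M.T.map f) = K.T.map (F.U.map f) ≫ inv (F.φ.app X') := by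
  rw [IsIso.inv_comp_eq, ← Category.assoc, IsIso.eq_comp_inv]
  exact F.φ.naturality f

theorem mu_inv_φ (X : M.E) : K.T.μ.app (F.U.obj X) ≫ inv (F.φ.app X) =
    K.T.map (inv (F.φ.app X)) ≫ inv (F.φ.app (M.T.obj X)) ≫ F.U.map (M.T.μ.app X) := by
  rw [IsIso.comp_inv_eq]
  have h := F.mult X
  simp only [Category.assoc, h, IsIso.inv_hom_id_assoc]
  rw [← K.T.map_comp_assoc, IsIso.inv_hom_id, K.T.map_id]
  exact (Category.id_comp _).symm

theorem faithful_of_comp_eq_id {C D : Type*} [Category* C] [Category* D] (U : C ⥤ D) (V : D ⥤ C)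
    (h : U ⋙ V = 𝟭 _) : U.Faithful := by
  have : (U ⋙ V).Faithful := by rw [h]; infer_instance
  exact Functor.Faithful.of_comp U V

/-- `invApp` as a natural transformation. -/
noncomputable def invTrans : K.T.toFunctor ⋙ V ⟶ V ⋙ M.T.toFunctor where
  app := invApp F V hUV hVU hφ
  naturality Y Y' f := by
    have := faithful_of_comp_eq_id _ _ hUV
    apply F.U.map_injective
    change F.U.map (V.map (K.T.map f) ≫ invApp F V hUV hVU hφ Y') =
      F.U.map (invApp F V hUV hVU hφ Y ≫ M.T.map (V.map f))
    rw [F.U.map_comp, F.U.map_comp, map_invApp, map_invApp]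
    simp only [Category.assoc]
    rw [inv_φ_naturality, ← K.T.map_comp_assoc, counitEq_inv_naturality, K.T.map_comp,
      ← Category.assoc, counitEq_naturality]
    simp only [Category.assoc]

theorem isIso_invTrans : IsIso (invTrans F V hUV hVU hφ) := by
  have : ∀ Y, IsIso ((invTrans F V hUV hVU hφ).app Y) := fun Y => by
    change IsIso (invApp F V hUV hVU hφ Y)
    unfold invApp
    infer_instance
  exact NatIso.isIso_of_isIso_app _

/-- The inverse of a cartesian monad opfunctor whose functor part is an isomorphism and whose
transformation is invertible. -/
noncomputable def invHom : Hom K M where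
  U := V
  φ := invTrans F V hUV hVU hφ
  preservesPullbacks := by
    -- Preservation of pullbacks by `V` comes for free from its being the inverse of an equivalence.
    let e : M.E ≌ K.E := CategoryTheory.Equivalence.mk F.U V (eqToIso hUV.symm) (eqToIso hVU)
    exact inferInstanceAs (PreservesLimitsOfShape WalkingCospan e.inverse)
  equifibered := by
    have := isIso_invTrans F V hUV hVU hφ
    exact NatTrans.Equifibered.of_isIso _
  unit Y := by
    have := faithful_of_comp_eq_id _ _ hUV
    apply F.U.map_injective
    change F.U.map (V.map (K.T.η.app Y) ≫ invApp F V hUV hVU hφ Y) = _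
    have h2 := counitEq_naturality F V hVU (K.T.η.app Y)
    have h1 := K.T.η.naturality (counitEq F V hVU Y).inv
    dsimp at h1 h2
    rw [F.U.map_comp, map_invApp, ← Category.assoc, h2, Category.assoc,
      ← Category.assoc (K.T.η.app Y), ← h1, Category.assoc, Iso.hom_inv_id_assoc,
      IsIso.comp_inv_eq]
    exact (F.unit _).symm
  mult Y := by
    have := faithful_of_comp_eq_id _ _ hUV
    apply F.U.map_injective
    change F.U.map (V.map (K.T.μ.app Y) ≫ invApp F V hUV hVU hφ Y) =
      F.U.map (invApp F V hUV hVU hφ _ ≫ M.T.map (invApp F V hUV hVU hφ Y) ≫ M.T.μ.app (V.obj Y))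
    have h1 := K.T.μ.naturality (counitEq F V hVU Y).inv
    have h2 := counitEq_naturality F V hVU (K.T.μ.app Y)
    dsimp at h1 h2
    rw [F.U.map_comp, map_invApp, ← Category.assoc, h2, Category.assoc,
      ← Category.assoc (K.T.μ.app Y), ← h1, Category.assoc, mu_inv_φ]
    rw [F.U.map_comp, F.U.map_comp, map_invApp]
    simp only [Category.assoc]
    rw [reassoc_of% (inv_φ_naturality F hφ (invApp F V hUV hVU hφ Y)), map_invApp]
    simp only [Functor.map_comp, Category.assoc]
    rw [← K.T.map_comp_assoc (counitEq F V hVU (K.T.obj Y)).inv, Iso.inv_hom_id, K.T.map_id]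
    simp

/-- An equivalence on the functor part would not be enough: morphisms of `CartMonad` are compared by
equality, so an inverse must compose to identity functors on the nose. -/
theorem isIso_of_strictInverse (F : Hom M K) (V : K.E ⥤ M.E) (hUV : F.U ⋙ V = 𝟭 _)
    (hVU : V ⋙ F.U = 𝟭 _) (hφ : ∀ X, IsIso (F.φ.app X)) : IsIso (C := CartMonad.{v, w}) (X := M) (Y := K) F := by
  refine ⟨invHom F V hUV hVU hφ, ?_, ?_⟩
  · refine Hom.ext_of_eqToHom hUV fun X => ?_
    have := faithful_of_comp_eq_id _ _ hUV
    apply F.U.map_injective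
    change F.U.map ((V.map (F.φ.app X) ≫ invApp F V hUV hVU hφ _) ≫
      M.T.map (unitEq F V hUV X).hom) = F.U.map ((unitEq F V hUV (M.T.obj X)).hom ≫ 𝟙 _)
    rw [Category.comp_id, F.U.map_comp, F.U.map_comp, map_invApp, map_unitEq F V hUV hVU]
    simp only [Category.assoc]
    rw [inv_φ_naturality, map_unitEq F V hUV hVU, ← K.T.map_comp_assoc, Iso.inv_hom_id, K.T.map_id,
      ← Category.assoc, counitEq_naturality]
    simp
  · refine Hom.ext_of_eqToHom hVU fun Y => ?_
    change (F.U.map (invApp F V hUV hVU hφ Y) ≫ F.φ.app _) ≫ K.T.map (counitEq F V hVU Y).hom =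
      (counitEq F V hVU (K.T.obj Y)).hom ≫ 𝟙 _
    rw [map_invApp]
    simp only [Category.assoc, IsIso.inv_hom_id_assoc]
    rw [← K.T.map_comp, Iso.inv_hom_id, K.T.map_id]

end CartMonad

/-! ### Independence of the choice of left adjoint. -/

section Uniqueness

variable {C : Type*} [Category* C] {D : Type*} [Category* D] {F F' : C ⥤ D} {R : D ⥤ C}

/-- The monads of two left adjoints of the same functor are isomorphic. -/
noncomputable def toMonadIso (adj : F ⊣ R) (adj' : F' ⊣ R) :
    adj.toMonad.toFunctor ≅ adj'.toMonad.toFunctor :=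
  Functor.isoWhiskerRight (adj.leftAdjointUniq adj') R

theorem toMonadIso_unit (adj : F ⊣ R) (adj' : F' ⊣ R) (X : C) :
    adj.toMonad.η.app X ≫ (toMonadIso adj adj').hom.app X = adj'.toMonad.η.app X :=
  adj.unit_leftAdjointUniq_hom_app adj' X

/-- The canonical isomorphism of left adjoints is compatible with the two counits; applying `R` to
this compatibility gives the statement. -/
theorem toMonadIso_mult (adj : F ⊣ R) (adj' : F' ⊣ R) (X : C) :
    adj.toMonad.μ.app X ≫ (toMonadIso adj adj').hom.app X =
      (toMonadIso adj adj').hom.app (adj.toMonad.obj X) ≫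
        adj'.toMonad.map ((toMonadIso adj adj').hom.app X) ≫ adj'.toMonad.μ.app X := by
  let τ := adj.leftAdjointUniq adj'
  have h1 : adj.counit.app (F.obj X) ≫ τ.hom.app X =
      τ.hom.app (R.obj (F.obj X)) ≫ F'.map (R.map (τ.hom.app X)) ≫ adj'.counit.app (F'.obj X) := by
    have h2 := adj.leftAdjointUniq_hom_app_counit adj' (F.obj X)
    have h3 := adj'.counit.naturality (τ.hom.app X)
    dsimp at h3
    rw [h3, ← h2, Category.assoc]
  have h4 := congrArg R.map h1
  simp only [Functor.map_comp] at h4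
  exact h4

end Uniqueness

end Opetopic

namespace Opetopic

/-! ### Monads on `Set/S` presented by operations, and their monads of trees. -/

section Shapes

variable {S : Type u}

theorem over_comp_left {X Y Z : Over S} (f : X ⟶ Y) (g : Y ⟶ Z) (x : X.left) :
    (f ≫ g).left x = g.left (f.left x) := rfl

/-- A presentation of a monad on `Set/S` by operations: the elements of `T Y` are operations whose
inputs are labelled by elements of `Y`, and every shape in `T 1` has a chosen operation. -/
structure Shapes (T : Monad (Over S)) where
  Op : Type u
  ar : Op → Type
  src : ∀ g, ar g → S
  tgt : Op → S
  lab : ∀ {Y : Over S} (g : Op) (l : ar g → Y.left) (_ : ∀ i, Y.hom (l i) = src g i),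
    (T.obj Y).left
  hom_lab : ∀ {Y : Over S} (g : Op) (l : ar g → Y.left) (h : ∀ i, Y.hom (l i) = src g i),
    (T.obj Y).hom (lab g l h) = tgt g
  map_lab : ∀ {Y Z : Over S} (f : Y ⟶ Z) (g : Op) (l : ar g → Y.left)
    (h : ∀ i, Y.hom (l i) = src g i), (T.map f).left (lab g l h) =
      lab g (fun i => f.left (l i)) fun i => (over_w_apply f (l i)).trans (h i)
  -- This field says that operations have no hidden symmetries. The next one says that an element
  -- lying over a labelled operation is a labelling of that same operation.
  lab_inj : ∀ {Y : Over S} (g : Op) (l l' : ar g → Y.left) (h h'), lab g l h = lab g l' h' → l = l'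
  exists_lab : ∀ {Y Z : Over S} (f : Y ⟶ Z) (t : (T.obj Y).left) (g : Op) (l : ar g → Z.left) (h),
    (T.map f).left t = lab g l h → ∃ l' h', t = lab g l' h'
  rep : (T.obj (⊤_ (Over S))).left → Op
  exists_rep : ∀ o, ∃ l h, lab (rep o) l h = o

/-- The element of the terminal object over `s`. -/
noncomputable def pt (s : S) : (⊤_ (Over S)).left :=
  (terminal.from (Over.mk (𝟙 S) : Over S)).left s

theorem hom_pt (s : S) : (⊤_ (Over S)).hom (pt s) = s :=
  over_w_apply (terminal.from (Over.mk (𝟙 S) : Over S)) s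

/-- The terminal object is only an abstract choice; through `pt` it can be treated as `S` itself. -/
theorem pt_hom {X : Over S} (f : X ⟶ ⊤_ (Over S)) (x : X.left) : f.left x = pt (X.hom x) := by
  let g : X ⟶ Over.mk (𝟙 S) := Over.homMk X.hom
  have : f = g ≫ terminal.from _ := terminal.hom_ext (C := Over S) _ _
  rw [this]
  rfl

theorem eq_pt (a : (⊤_ (Over S)).left) : a = pt ((⊤_ (Over S)).hom a) :=
  pt_hom (𝟙 (⊤_ (Over S))) a

namespace Shapes

variable {T : Monad (Over S)} (P : Shapes T)

theorem lab_congr {Y : Over S} (g : P.Op) {l l' : P.ar g → Y.left} (hl : l = l') (h h') :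
    P.lab g l h = P.lab g l' h' := by
  subst hl
  rfl

/-- The operation `g`, as an element of `T 1`. -/
noncomputable def shape (g : P.Op) : (T.obj (⊤_ (Over S))).left :=
  P.lab g (fun i => pt (P.src g i)) fun _ => hom_pt _

theorem map_lab_shape {Y : Over S} (f : Y ⟶ ⊤_ (Over S)) (g : P.Op) (l : P.ar g → Y.left) (h) :
    (T.map f).left (P.lab g l h) = P.shape g := by
  rw [P.map_lab]
  exact P.lab_congr g (funext fun i => by rw [pt_hom, h]) _ _

theorem shape_rep (o) : P.shape (P.rep o) = o := by
  obtain ⟨l, h, hl⟩ := P.exists_rep o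
  refine Eq.trans ?_ hl
  exact P.lab_congr _ (funext fun i => by rw [← h, ← eq_pt]) _ _

theorem tgt_rep (o) : P.tgt (P.rep o) = (T.obj (⊤_ (Over S))).hom o := by
  rw [← P.hom_lab (P.rep o) (fun i => pt (P.src _ i)) (fun _ => hom_pt _)]
  exact congrArg _ (P.shape_rep o)

end Shapes

/-- Trees whose nodes are labelled by elements of `B`, a node labelled by `b` being an operation
`r b`, and whose leaves are labelled by elements of `Y`. -/
inductive PTree {T : Monad (Over S)} (P : Shapes T) {B : Type u} (r : B → P.Op) (Y : Over S) :
    S → Type u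
  | leaf {s : S} (l : Y.left) (h : Y.hom l = s) : PTree P r Y s
  -- The operation `g` and the index `s` are free variables tied by equations, so that trees can be
  -- built and compared without transporting the family of children.
  | node {s : S} (b : B) (g : P.Op) (hg : g = r b) (h : P.tgt g = s)
      (ch : ∀ i : P.ar g, PTree P r Y (P.src g i)) : PTree P r Y s

namespace PTree

variable {T : Monad (Over S)} {P : Shapes T} {B : Type u} {r : B → P.Op} {X Y Z : Over S} {s : S}

/-- Trees with leaves labelled by `Y`, as an object over `S`. -/
def obj (r : B → P.Op) (Y : Over S) : Over S := Over.mk (↾fun w : Σ s, PTree P r Y s => w.1)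

/-- A tree as an element of the object of trees. -/
abbrev el (w : PTree P r Y s) : (obj r Y).left := (⟨s, w⟩ : Σ s, PTree P r Y s)

theorem obj_hom_el (w : PTree P r Y s) : (obj r Y).hom (el w) = s := rfl

/-- Replacing every leaf by a tree. -/
def bind (f : Y ⟶ obj r Z) : ∀ {s : S}, PTree P r Y s → PTree P r Z s
  | _, leaf l h => ((over_w_apply f l).trans h : (f.left l).1 = _) ▸ (f.left l).2
  | _, node b g hg h ch => node b g hg h fun i => (ch i).bind f

/-- Passing to the total space absorbs transports between fibres; this is why trees are mostly
compared through `el`. -/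
theorem el_cast {s s' : S} (h : s = s') (w : PTree P r Y s) : el (h ▸ w) = el w := by
  subst h
  rfl

theorem el_bind_leaf (f : Y ⟶ obj r Z) (l : Y.left) (h : Y.hom l = s) :
    el ((leaf (r := r) l h).bind f) = f.left l := el_cast _ _

theorem el_inj {w w' : PTree P r Y s} (h : el w = el w') : w = w' :=
  eq_of_heq (Sigma.mk.inj h).2

/-- `bind` as a morphism. -/
def bindHom (f : Y ⟶ obj r Z) : obj r Y ⟶ obj r Z :=
  Over.homMk (↾fun w : Σ s, PTree P r Y s => (⟨w.1, w.2.bind f⟩ : Σ s, PTree P r Z s)) rfl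

/-- The tree with a single edge. -/
def unitHom (r : B → P.Op) (Y : Over S) : Y ⟶ obj r Y :=
  Over.homMk (↾fun l : Y.left => (⟨Y.hom l, leaf l rfl⟩ : Σ s, PTree P r Y s)) rfl

theorem el_leaf (l : Y.left) (h : Y.hom l = s) :
    el (leaf (r := r) l h) = (unitHom r Y).left l := by
  subst h
  rfl

theorem bind_unit (w : PTree P r Y s) : w.bind (unitHom r Y) = w := by
  induction w with
  | leaf l h => exact el_inj ((el_bind_leaf _ _ _).trans (el_leaf l h).symm)
  | node b g hg h ch ih => exact congrArg _ (funext ih)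

theorem bind_cast {s s' : S} (h : s = s') (w : PTree P r Y s) (f : Y ⟶ obj r Z) :
    el ((h ▸ w).bind f) = (bindHom f).left (el w) := by
  subst h
  rfl

theorem bind_bind (w : PTree P r X s) (f : X ⟶ obj r Y) (g : Y ⟶ obj r Z) :
    (w.bind f).bind g = w.bind (f ≫ bindHom g) := by
  induction w with
  | leaf l h => exact el_inj ((bind_cast _ _ _).trans (el_bind_leaf (f ≫ bindHom g) l h).symm)
  | node b g' hg h ch ih => exact congrArg (node b g' hg h) (funext ih)

theorem bindHom_unit : bindHom (unitHom r Y) = 𝟙 _ :=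
  SymMulticat.over_ext fun w => congrArg (Sigma.mk w.1) (bind_unit w.2)

theorem unitHom_bindHom (f : Y ⟶ obj r Z) : unitHom r Y ≫ bindHom f = f :=
  SymMulticat.over_ext fun l => el_bind_leaf f l rfl

theorem bindHom_bindHom (f : X ⟶ obj r Y) (g : Y ⟶ obj r Z) :
    bindHom f ≫ bindHom g = bindHom (f ≫ bindHom g) :=
  SymMulticat.over_ext fun w => congrArg (Sigma.mk w.1) (bind_bind w.2 f g)

/-- The monad of trees. -/
def monad (r : B → P.Op) : Monad (Over S) where
  obj := obj r
  map f := bindHom (f ≫ unitHom r _)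
  map_id Y := by rw [Category.id_comp, bindHom_unit]
  map_comp f g := by
    rw [bindHom_bindHom, Category.assoc, Category.assoc, unitHom_bindHom]
  η := { app := unitHom r
         naturality := fun _ _ f => (unitHom_bindHom (f ≫ unitHom r _)).symm }
  μ := { app := fun Y => bindHom (𝟙 (obj r Y))
         naturality := fun X Y f => by
          change bindHom (bindHom (f ≫ unitHom r _) ≫ unitHom r _) ≫ bindHom (𝟙 _) =
            bindHom (𝟙 _) ≫ bindHom (f ≫ unitHom r _)
          rw [bindHom_bindHom, bindHom_bindHom, Category.assoc, unitHom_bindHom, Category.id_comp,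
            Category.comp_id] }
  assoc Y := by
    change bindHom (bindHom (𝟙 _) ≫ unitHom r _) ≫ bindHom (𝟙 _) = bindHom (𝟙 _) ≫ bindHom (𝟙 _)
    rw [bindHom_bindHom, bindHom_bindHom, Category.assoc, unitHom_bindHom, Category.id_comp,
      Category.comp_id]
  left_unit Y := unitHom_bindHom _
  right_unit Y := by
    change bindHom (unitHom r _ ≫ unitHom r _) ≫ bindHom (𝟙 _) = 𝟙 _
    rw [bindHom_bindHom, Category.assoc, unitHom_bindHom, Category.comp_id, bindHom_unit]

/-- The composite of a tree, together with its position over `S`. -/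
def evAux : ∀ {s : S}, PTree P r Y s → { t : (T.obj Y).left // (T.obj Y).hom t = s }
  | _, leaf l h => ⟨(T.η.app Y).left l, (over_w_apply (T.η.app Y) l).trans h⟩
  | _, node _ g _ h ch => ⟨(T.μ.app Y).left
      (P.lab (Y := T.obj Y) g (fun i => (ch i).evAux.1) fun i => (ch i).evAux.2),
      (over_w_apply (T.μ.app Y) _).trans ((P.hom_lab (Y := T.obj Y) _ _ _).trans h)⟩

/-- The composite of a tree. -/
def evHom (r : B → P.Op) (Y : Over S) : obj r Y ⟶ T.obj Y :=
  Over.homMk (↾fun w : Σ s, PTree P r Y s => w.2.evAux.1) (by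
    ext w
    exact w.2.evAux.2)

theorem hom_evHom (w : PTree P r Y s) : (T.obj Y).hom ((evHom r Y).left (el w)) = s :=
  w.evAux.2

theorem evHom_el_leaf (l : Y.left) (h : Y.hom l = s) :
    (evHom r Y).left (el (leaf l h)) = (T.η.app Y).left l := rfl

theorem evHom_el_node (b : B) (g : P.Op) (hg : g = r b) (h : P.tgt g = s)
    (ch : ∀ i : P.ar g, PTree P r Y (P.src g i)) :
    (evHom r Y).left (el (node b g hg h ch)) = (T.μ.app Y).left
      (P.lab (Y := T.obj Y) g (fun i => (evHom r Y).left (el (ch i)))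
        fun i => hom_evHom (ch i)) := rfl

theorem mu_nat_apply {X Y : Over S} (f : X ⟶ Y) (t : (T.obj (T.obj X)).left) :
    (T.μ.app Y).left ((T.map (T.map f)).left t) = (T.map f).left ((T.μ.app X).left t) :=
  congrArg (fun k : T.obj (T.obj X) ⟶ T.obj Y => k.left t) (T.μ.naturality f)

theorem eta_nat_apply {X Y : Over S} (f : X ⟶ Y) (t : X.left) :
    (T.map f).left ((T.η.app X).left t) = (T.η.app Y).left (f.left t) :=
  congrArg (fun k : X ⟶ T.obj Y => k.left t) (T.η.naturality f).symm

theorem mu_assoc_apply (t : (T.obj (T.obj (T.obj X))).left) :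
    (T.μ.app X).left ((T.map (T.μ.app X)).left t) =
      (T.μ.app X).left ((T.μ.app (T.obj X)).left t) :=
  congrArg (fun k : T.obj (T.obj (T.obj X)) ⟶ T.obj X => k.left t) (T.assoc X)

theorem left_unit_apply (t : (T.obj X).left) :
    (T.μ.app X).left ((T.η.app (T.obj X)).left t) = t :=
  congrArg (fun k : T.obj X ⟶ T.obj X => k.left t) (T.left_unit X)

theorem right_unit_apply (t : (T.obj X).left) :
    (T.μ.app X).left ((T.map (T.η.app X)).left t) = t :=
  congrArg (fun k : T.obj X ⟶ T.obj X => k.left t) (T.right_unit X)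

/-- At a leaf this is naturality of the unit and a unit law of `T`; at a node it is naturality and
associativity of the multiplication. -/
theorem evHom_bind (w : PTree P r Y s) (f : Y ⟶ obj r Z) :
    (evHom r Z).left (el (w.bind f)) =
      (T.μ.app Z).left ((T.map (f ≫ evHom r Z)).left ((evHom r Y).left (el w))) := by
  induction w with
  | leaf l h =>
    rw [el_bind_leaf, evHom_el_leaf, eta_nat_apply, left_unit_apply]
    rfl
  | node b g hg h ch ih =>
    refine (evHom_el_node b g hg h _).trans ?_
    rw [evHom_el_node, ← mu_nat_apply, ← mu_assoc_apply, P.map_lab, P.map_lab]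
    exact congrArg _ (P.lab_congr g (funext fun i => ih i) _ _)

theorem evHom_bind_id (w : PTree P r (obj r Y) s) :
    (evHom r Y).left (el (w.bind (𝟙 (obj r Y)))) =
      (T.μ.app Y).left ((T.map (evHom r Y)).left ((evHom r (obj r Y)).left (el w))) := by
  rw [evHom_bind, Category.id_comp]

/-- Relabelling of leaves. -/
def map (f : Y ⟶ Z) (w : PTree P r Y s) : PTree P r Z s := w.bind (f ≫ unitHom r Z)

theorem map_leaf (f : Y ⟶ Z) (l : Y.left) (h : Y.hom l = s) :
    (leaf (r := r) l h).map f = leaf (f.left l) ((over_w_apply f l).trans h) :=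
  el_inj ((el_bind_leaf (f ≫ unitHom r Z) l h).trans (el_leaf (f.left l) _).symm)

theorem map_node (f : Y ⟶ Z) (b : B) (g : P.Op) (hg : g = r b) (h : P.tgt g = s)
    (ch : ∀ i : P.ar g, PTree P r Y (P.src g i)) :
    (node b g hg h ch).map f = node b g hg h fun i => (ch i).map f := rfl

theorem evHom_map (w : PTree P r Y s) (f : Y ⟶ Z) :
    (evHom r Z).left (el (w.map f)) = (T.map f).left ((evHom r Y).left (el w)) := by
  refine (evHom_bind w (f ≫ unitHom r Z)).trans ?_
  have h : (f ≫ unitHom r Z) ≫ evHom r Z = f ≫ T.η.app Z := rfl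
  rw [h, T.map_comp, over_comp_left, right_unit_apply]

/-- The composite of trees as a morphism of monads. -/
def evMonadHom (r : B → P.Op) : monad r ⟶ T where
  app := evHom r
  naturality _ _ f := SymMulticat.over_ext fun w => evHom_map w.2 f
  app_η _ := rfl
  app_μ Y := SymMulticat.over_ext fun w =>
    (evHom_bind_id w.2).trans (congrArg (T.μ.app Y).left (evHom_map w.2 (evHom r Y)).symm)

/-- Uniqueness half of equifiberedness. The relabelled trees have the same form, and the pullback
squares of the unit and the multiplication recover the leaf labels and the composites of the
subtrees from the total composite. -/
theorem eq_of_map_eq (hT : IsCartesian T) (f : Y ⟶ Z) (w w' : PTree P r Y s) (h1 : w.map f = w'.map f)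
    (h2 : (evHom r Y).left (el w) = (evHom r Y).left (el w')) : w = w' := by
  induction w with
  | leaf l h =>
    cases w' with
    | leaf l' h' =>
      rw [map_leaf, map_leaf] at h1
      have h3 : f.left l = f.left l' := by injection h1
      have := (isPullback_over_elim (hT.unit f)).2.1 l l' h3 h2
      subst this
      rfl
    | node b' g' hg' h' ch' =>
      rw [map_leaf, map_node] at h1
      cases h1
  | node b g hg h ch ih =>
    cases w' with
    | leaf l' h' =>
      rw [map_leaf, map_node] at h1
      cases h1
    | node b' g' hg' h' ch' =>
      rw [map_node, map_node] at h1
      injection h1 with _ h3 h4 h5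
      subst h3 h4
      have h5 := eq_of_heq h5
      -- The root operations labelled by the composites of the subtrees agree in `T T Z`, which is
      -- the postponed goal, and have the same product in `T Y`; hence they agree in `T T Y`.
      have h6 := (isPullback_over_elim (hT.mult f)).2.1 _ _ ?_ h2
      · have h7 := P.lab_inj (Y := T.obj Y) _ _ _ _ _ h6
        exact congrArg _ (funext fun i => ih i _ (congrFun h5 i) (congrFun h7 i))
      · change (T.map (T.map f)).left _ = (T.map (T.map f)).left _
        rw [P.map_lab, P.map_lab]
        refine P.lab_congr g (funext fun i => ?_) _ _
        exact (evHom_map _ f).symm.trans ((congrArg (fun w => (evHom r Z).left (el w))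
          (congrFun h5 i)).trans (evHom_map _ f))

/-- Existence half of equifiberedness. At a node, `t` is lifted through the pullback square of the
multiplication to an element of `T T Y`; `exists_lab` displays it as the root operation with labels
in `T Y`, and these are the composites prescribed for the subtrees. -/
theorem exists_map_eq (hT : IsCartesian T) (f : Y ⟶ Z) (u : PTree P r Z s) (t : (T.obj Y).left)
    (h : (evHom r Z).left (el u) = (T.map f).left t) :
    ∃ w : PTree P r Y s, w.map f = u ∧ (evHom r Y).left (el w) = t := by
  induction u generalizing t with
  | leaf l h0 =>
    obtain ⟨y, hy1, hy2⟩ := (isPullback_over_elim (hT.unit f)).2.2 l t h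
    subst hy1
    refine ⟨leaf y ((over_w_apply f y).symm.trans h0), map_leaf _ _ _, hy2⟩
  | node b g hg h0 ch ih =>
    obtain ⟨y, hy1, hy2⟩ := (isPullback_over_elim (hT.mult f)).2.2 _ t h
    obtain ⟨l, hl, rfl⟩ := P.exists_lab (T.map f) y g _ _ hy1
    have h1 := (P.map_lab (T.map f) g l hl).symm.trans hy1
    have h2 := P.lab_inj _ _ _ _ _ h1
    choose w hw1 hw2 using fun i => ih i (l i) (congrFun h2 i).symm
    refine ⟨node b g hg h0 w, ?_, ?_⟩
    · rw [map_node]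
      exact congrArg _ (funext hw1)
    · rw [evHom_el_node, ← hy2]
      exact congrArg _ (P.lab_congr g (funext hw2) _ _)

theorem equifibered_evMonadHom (hT : IsCartesian T) (r : B → P.Op) :
    NatTrans.Equifibered (evMonadHom r).toNatTrans := fun Y Z f => by
  refine isPullback_over (fun t => ?_) (fun w w' h1 h2 => ?_) (fun u t h => ?_)
  · exact congrArg (fun k : obj r Y ⟶ T.obj Z => k.left t) ((evMonadHom r).naturality f)
  · obtain ⟨s, w⟩ := w
    obtain ⟨s', w'⟩ := w'
    obtain rfl : s = s' := congrArg Sigma.fst h1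
    exact congrArg _ (eq_of_map_eq hT f w w' (el_inj h1) h2)
  · obtain ⟨s, u⟩ := u
    obtain ⟨w, h1, h2⟩ := exists_map_eq hT f u t h
    exact ⟨el w, congrArg el h1, h2⟩

end PTree
end Shapes
end Opetopic

namespace Opetopic

/-! ### Multicategories over `Set/S` in terms of elements. -/

section Elements

variable {S : Type u} {T : Monad (Over S)} {C₀ : Over S}

namespace TGraphData

variable (G : TGraphData T C₀)

theorem exists_pair (t : (T.obj G.C₁).left) (g : G.C₁.left)
    (h : (T.map G.c).left t = G.d.left g) : ∃ p : (pullback (T.map G.c) G.d).left,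
      (pullback.fst (T.map G.c) G.d).left p = t ∧ (pullback.snd (T.map G.c) G.d).left p = g :=
  (isPullback_over_elim (IsPullback.of_hasPullback (T.map G.c) G.d)).2.2 t g h

/-- The composite of an arrow with a family of arrows. -/
noncomputable def cmp (t : (T.obj G.C₁).left) (g : G.C₁.left)
    (h : (T.map G.c).left t = G.d.left g) : G.C₁.left :=
  G.comp.left (G.exists_pair t g h).choose

theorem comp_left (p : (pullback (T.map G.c) G.d).left) (t : (T.obj G.C₁).left) (g : G.C₁.left) (h)
    (h1 : (pullback.fst (T.map G.c) G.d).left p = t)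
    (h2 : (pullback.snd (T.map G.c) G.d).left p = g) : G.comp.left p = G.cmp t g h := by
  unfold cmp
  congr 1
  have h3 := (G.exists_pair t g h).choose_spec
  exact (isPullback_over_elim (IsPullback.of_hasPullback (T.map G.c) G.d)).2.1 _ _
    (h1.trans h3.1.symm) (h2.trans h3.2.symm)

theorem cmp_congr {t t' : (T.obj G.C₁).left} {g g' : G.C₁.left} (ht : t = t') (hg : g = g') (h h') :
    G.cmp t g h = G.cmp t' g' h' := by
  subst ht hg
  rfl

theorem left_congr {X Y : Over S} {f g : X ⟶ Y} (h : f = g) (x : X.left) : f.left x = g.left x := by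
  rw [h]

theorem compose_left {W : Over S} (f : W ⟶ T.obj G.C₁) (g : W ⟶ G.C₁) (h) (x : W.left) :
    (G.compose f g h).left x = G.cmp (f.left x) (g.left x) (left_congr h x) :=
  G.comp_left _ _ _ _ (left_congr (pullback.lift_fst f g h) x)
    (left_congr (pullback.lift_snd f g h) x)

theorem d_cmp (t : (T.obj G.C₁).left) (g : G.C₁.left) (h) :
    G.d.left (G.cmp t g h) = (T.μ.app C₀).left ((T.map G.d).left t) := by
  obtain ⟨p, rfl, rfl⟩ := G.exists_pair t g h
  rw [← G.comp_left p _ _ h rfl rfl]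
  exact left_congr G.comp_d p

theorem d_ids (x : C₀.left) : G.d.left (G.ids.left x) = (T.η.app C₀).left x :=
  left_congr G.ids_d x

end TGraphData

namespace TMulticat

open TGraphData

variable (G : TMulticat T C₀)

theorem cmp_ids (t : (T.obj G.C₁).left) (g : G.C₁.left) (h)
    (ht : t = (T.map G.ids).left (G.d.left g)) : G.cmp t g h = g := by
  subst ht
  have := left_congr G.id_comp g
  rw [compose_left] at this
  exact this

theorem ids_cmp (g : G.C₁.left) (t : (T.obj G.C₁).left) (x : G.C₁.left) (h)
    (ht : t = (T.η.app G.C₁).left g) (hx : x = G.ids.left (G.c.left g)) : G.cmp t x h = g := by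
  subst ht hx
  have := left_congr G.comp_id g
  rw [compose_left] at this
  exact this

/-- Associativity for elements. The data `τ`, a `T`-family of composable pairs, and `g` form an
element of `Triple`. -/
theorem cmp_cmp (τ : (T.obj (pullback (T.map G.c) G.d)).left) (g : G.C₁.left)
    (h : (T.map (pullback.snd (T.map G.c) G.d ≫ G.c)).left τ = G.d.left g) (h1 h2 h3) :
    G.cmp ((T.map G.comp).left τ) g h1 =
      G.cmp ((T.μ.app G.C₁).left ((T.map (pullback.fst (T.map G.c) G.d)).left τ))
        (G.cmp ((T.map (pullback.snd (T.map G.c) G.d)).left τ) g h2) h3 := by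
  obtain ⟨p, rfl, rfl⟩ := (isPullback_over_elim (IsPullback.of_hasPullback
    (T.map (pullback.snd (T.map G.c) G.d ≫ G.c)) G.d)).2.2 τ g h
  have := left_congr G.assoc p
  rw [compose_left, compose_left] at this
  refine this.trans (G.cmp_congr rfl ?_ _ _)
  rw [compose_left]
  rfl

theorem Hom.map_cmp {G H : TMulticat T C₀} (F : G.Hom H) (t : (T.obj G.C₁).left) (g : G.C₁.left)
    (h h') : F.hom.left (G.cmp t g h) = H.cmp ((T.map F.hom).left t) (F.hom.left g) h' := by
  obtain ⟨p, rfl, rfl⟩ := G.exists_pair t g h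
  rw [← G.comp_left p _ _ h rfl rfl]
  refine (left_congr F.comp p).trans ?_
  rw [compose_left]
  rfl

/-- A morphism of multicategories from a map preserving composites of elements. -/
noncomputable def homOfCmp {G H : TMulticat T C₀} (f : G.C₁ ⟶ H.C₁) (hd : f ≫ H.d = G.d) (hc : f ≫ H.c = G.c)
    (hi : G.ids ≫ f = H.ids) (hcmp : ∀ t g h h', f.left (G.cmp t g h) =
      H.cmp ((T.map f).left t) (f.left g) h') : G ⟶ H where
  hom := f
  d := hd
  c := hc
  ids := hi
  comp := SymMulticat.over_ext fun p => by
    rw [compose_left]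
    refine Eq.trans ?_ (hcmp _ _ (left_congr pullback.condition p) _)
    exact congrArg f.left (G.comp_left p _ _ _ rfl rfl)

end TMulticat

end Elements

/-! ### The operad of trees is free. -/

section FreeOperad

open TGraphData

variable {S : Type u} {T : Monad (Over S)} (P : Shapes T) (hT : IsCartesian T)

/-- The operations labelling the nodes of trees. -/
noncomputable def Shapes.nodeOp (X : Over (T.obj (⊤_ (Over S)))) (b : X.left.left) : P.Op :=
  P.rep (X.hom.left b)

/-- The free operad on `X`. -/
noncomputable def freeOperad (X : Over (T.obj (⊤_ (Over S)))) : Operad T :=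
  operadOfMonadHom (PTree.equifibered_evMonadHom hT (P.nodeOp X))

namespace PTree

variable {P} {X : Over (T.obj (⊤_ (Over S)))} {s : S}

/-- A tree `w` whose leaves are labelled by trees encodes a composable pair: its shape, and its
composite as a `T`-family of trees. Since `toCompDomain` followed by `ofCompDomain` is the identity,
composing the pair is the multiplication of the tree monad, which grafts. -/
theorem cmp_freeOperad (w : PTree P (P.nodeOp X) (obj (P.nodeOp X) (⊤_ (Over S))) s)
    (t : (T.obj (obj (P.nodeOp X) (⊤_ (Over S)))).left)
    (u : (obj (P.nodeOp X) (⊤_ (Over S))).left) (h)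
    (ht : (evHom _ _).left (el w) = t) (hu : el (w.map (terminal.from _)) = u) :
    (freeOperad P hT X).cmp t u h = el (w.bind (𝟙 _)) := by
  let hε := PTree.equifibered_evMonadHom hT (P.nodeOp X)
  have h1 := (freeOperad P hT X).comp_left
    ((toCompDomain (evMonadHom (P.nodeOp X))).left (el w)) t u h
    ((left_congr (toCompDomain_fst (evMonadHom (P.nodeOp X))) (el w)).trans ht)
    ((left_congr (toCompDomain_snd (evMonadHom (P.nodeOp X))) (el w)).trans hu)
  have h2 : toCompDomain (evMonadHom (P.nodeOp X)) ≫ ofCompDomain hε = 𝟙 _ :=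
    lift_ofCompDomain hε (𝟙 _) _ _ _ (Category.id_comp _) (Category.id_comp _)
  refine h1.symm.trans ?_
  exact congrArg ((monad (P.nodeOp X)).μ.app (⊤_ (Over S))).left (left_congr h2 (el w))

variable {G : Operad T} (φ : X ⟶ (operadForget T).obj G)

/-- The value of `φ` at `b`, as an arrow of `G`. -/
noncomputable def gen (b : X.left.left) : G.C₁.left := φ.left.left b

theorem d_gen (b : X.left.left) : G.d.left (gen φ b) = X.hom.left b :=
  left_congr (Over.w φ) b

/-- Evaluation of a tree in an operad. -/
noncomputable def extAux : ∀ {s : S} (w : PTree P (P.nodeOp X) (⊤_ (Over S)) s),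
    { g : G.C₁.left // G.d.left g = (evHom _ _).left (el w) }
  | _, leaf l h => ⟨G.ids.left l, G.d_ids l⟩
  | _, node b g hg h ch =>
    -- The recursion carries the `d`-image of each value precisely to know that the values of the
    -- children lie over the inputs of `g`.
    have h1 : ∀ i, G.C₁.hom ((ch i).extAux.1) = P.src g i := fun i => by
      rw [← over_w_apply G.d, (ch i).extAux.2]
      exact hom_evHom (ch i)
    ⟨G.cmp (P.lab g (fun i => (ch i).extAux.1) h1) (gen φ b) (by
      rw [P.map_lab_shape, d_gen, hg]
      exact P.shape_rep _), by
      rw [G.d_cmp, P.map_lab, evHom_el_node]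
      exact congrArg _ (P.lab_congr g (funext fun i => (ch i).extAux.2) _ _)⟩

/-- Evaluation of trees in an operad. -/
noncomputable def extHom : obj (P.nodeOp X) (⊤_ (Over S)) ⟶ G.C₁ :=
  Over.homMk (↾fun w : Σ s, PTree P (P.nodeOp X) (⊤_ (Over S)) s => (w.2.extAux φ).1) (by
    ext w
    refine (over_w_apply G.d _).symm.trans ?_
    exact (congrArg _ (w.2.extAux φ).2).trans (hom_evHom w.2))

theorem d_extHom (w : PTree P (P.nodeOp X) (⊤_ (Over S)) s) :
    G.d.left ((extHom φ).left (el w)) = (evHom _ _).left (el w) := (w.extAux φ).2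

theorem hom_extHom (w : PTree P (P.nodeOp X) (⊤_ (Over S)) s) :
    G.C₁.hom ((extHom φ).left (el w)) = s := over_w_apply (extHom φ) (el w)

theorem extHom_leaf (l : (⊤_ (Over S)).left) (h : (⊤_ (Over S)).hom l = s) :
    (extHom φ).left (el (leaf (r := P.nodeOp X) l h)) = G.ids.left l := rfl

theorem extHom_node (b : X.left.left) (g : P.Op) (hg : g = P.nodeOp X b) (h : P.tgt g = s)
    (ch : ∀ i : P.ar g, PTree P (P.nodeOp X) (⊤_ (Over S)) (P.src g i)) (h') :
    (extHom φ).left (el (node b g hg h ch)) =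
      G.cmp (P.lab g (fun i => (extHom φ).left (el (ch i))) fun i => hom_extHom φ (ch i))
        (gen φ b) h' := rfl

theorem map_c_lab {Y : Over S} (f : Y ⟶ ⊤_ (Over S)) (b : X.left.left) (g : P.Op)
    (hg : g = P.nodeOp X b) (l : P.ar g → Y.left) (h) :
    (T.map f).left (P.lab g l h) = G.d.left (gen φ b) := by
  rw [P.map_lab_shape, d_gen, hg]
  exact P.shape_rep _

/-- Evaluation turns grafting into composition, hence is a morphism of operads. A leaf needs an
identity law of `G`, a node the associative law together with the induction hypothesis for the
children. -/
theorem extHom_bind (w : PTree P (P.nodeOp X) (obj (P.nodeOp X) (⊤_ (Over S))) s) (h) :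
    (extHom φ).left (el (w.bind (𝟙 _))) =
      G.cmp ((T.map (extHom φ)).left ((evHom _ _).left (el w)))
        ((extHom φ).left (el (w.map (terminal.from _)))) h := by
  have hc : ∀ {s : S} (w : PTree P (P.nodeOp X) (obj (P.nodeOp X) (⊤_ (Over S))) s),
      (T.map G.c).left ((T.map (extHom φ)).left ((evHom _ _).left (el w))) =
        G.d.left ((extHom φ).left (el (w.map (terminal.from _)))) := fun w => by
    rw [d_extHom, evHom_map, ← over_comp_left, ← T.map_comp]
    exact left_congr (congrArg T.map (terminal.hom_ext (C := Over S) _ _)) _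
  induction w with
  | leaf l h0 =>
    symm
    rw [el_bind_leaf]
    refine TMulticat.ids_cmp G ((extHom φ).left l) _ _ _ ?_ ?_
    · rw [evHom_el_leaf, eta_nat_apply]
    · rw [map_leaf, extHom_leaf]
      congr 1
      rw [pt_hom, pt_hom, over_w_apply]
  | node b g hg h0 ch ih =>
    -- For each child, `p i` pairs the evaluated trees at its leaves with the value of its own
    -- shape; composing this pair gives the value of the grafted child. The labelled operation `τ`
    -- collects the pairs into the `T`-family needed for associativity.
    choose p hp1 hp2 using fun i => G.exists_pair _ _ (hc (ch i))
    have hp0 : ∀ i, (pullback (T.map G.c) G.d).hom (p i) = P.src g i := fun i => by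
      rw [← over_w_apply (pullback.snd (T.map G.c) G.d), hp2]
      exact hom_extHom φ _
    let τ := P.lab (Y := pullback (T.map G.c) G.d) g p hp0
    have hτ2 : (T.map (pullback.snd (T.map G.c) G.d)).left τ =
        P.lab g (fun i => (extHom φ).left (el ((ch i).map (terminal.from _))))
          fun i => hom_extHom φ _ :=
      (P.map_lab _ _ _ _).trans (P.lab_congr g (funext hp2) _ _)
    have hτ1 : (T.map (pullback.fst (T.map G.c) G.d)).left τ = (T.map (T.map (extHom φ))).left
        (P.lab (Y := T.obj (obj (P.nodeOp X) (⊤_ (Over S)))) g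
          (fun i => (evHom _ _).left (el (ch i))) fun i => hom_evHom _) :=
      (P.map_lab _ _ _ _).trans (Eq.trans (P.lab_congr g (funext hp1) _ _)
        (P.map_lab (T.map (extHom φ)) _ _ _).symm)
    have hτ3 : (T.map G.comp).left τ = P.lab g
        (fun i => (extHom φ).left (el ((ch i).bind (𝟙 _)))) fun i => hom_extHom φ _ :=
      (P.map_lab _ _ _ _).trans (P.lab_congr g (funext fun i =>
        (G.comp_left (p i) _ _ (hc (ch i)) (hp1 i) (hp2 i)).trans (ih i (hc (ch i))).symm) _ _)
    have key := TMulticat.cmp_cmp G τ (gen φ b) (map_c_lab φ _ b g hg _ _)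
      (by rw [hτ3]; exact map_c_lab φ _ b g hg _ _) (by rw [hτ2]; exact map_c_lab φ _ b g hg _ _)
      (by
        rw [G.d_cmp, ← mu_nat_apply]
        congr 1
        rw [← over_comp_left, ← over_comp_left, ← T.map_comp, ← T.map_comp, pullback.condition])
    refine Eq.trans (extHom_node φ b g hg h0 _ (map_c_lab φ _ b g hg _ _)) ?_
    refine (G.cmp_congr hτ3.symm rfl _ _).trans (key.trans (G.cmp_congr ?_ ?_ _ _))
    · rw [hτ1, evHom_el_node, mu_nat_apply]
    · refine (G.cmp_congr hτ2 rfl _ (map_c_lab φ _ b g hg _ _)).trans ?_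
      exact (extHom_node φ b g hg h0 (fun i => (ch i).map (terminal.from _)) _).symm

/-- Evaluation of trees as a morphism of operads. -/
noncomputable def extOperadHom : freeOperad P hT X ⟶ G :=
  TMulticat.homOfCmp (G := freeOperad P hT X) (extHom φ)
    (SymMulticat.over_ext fun w => d_extHom φ w.2) (terminal.hom_ext (C := Over S) _ _)
    (SymMulticat.over_ext fun l => rfl) (fun t u h h' => by
      obtain ⟨s, u⟩ := u
      -- Every composable pair in the operad of trees comes from a tree of trees.
      obtain ⟨w, rfl, rfl⟩ := exists_map_eq hT (terminal.from _) u t h.symm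
      rw [cmp_freeOperad hT w _ _ h rfl rfl]
      exact extHom_bind φ w h')

/-- The tree with a single node. -/
noncomputable def single (r : X.left.left → P.Op) (b : X.left.left) :
    PTree P r (⊤_ (Over S)) (P.tgt (r b)) :=
  node b (r b) rfl rfl fun i => leaf (pt (P.src (r b) i)) (hom_pt _)

theorem evHom_single (b : X.left.left) :
    (evHom _ _).left (el (single (P.nodeOp X) b)) = X.hom.left b := by
  refine (evHom_el_node _ _ _ _ _).trans ?_
  have h := P.map_lab (T.η.app (⊤_ (Over S))) (P.nodeOp X b) (fun i => pt (P.src _ i))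
    fun i => hom_pt _
  refine (congrArg (T.μ.app (⊤_ (Over S))).left h.symm).trans ?_
  rw [right_unit_apply]
  exact P.shape_rep _

theorem tgt_nodeOp (b : X.left.left) : P.tgt (P.nodeOp X b) = X.left.hom b :=
  (P.tgt_rep _).trans (over_w_apply X.hom b)

/-- The trees with a single node. -/
noncomputable def singleLeft (X : Over (T.obj (⊤_ (Over S)))) :
    X.left ⟶ obj (P.nodeOp X) (⊤_ (Over S)) :=
  Over.homMk (↾fun b : X.left.left =>
    (⟨_, single (P.nodeOp X) b⟩ : Σ s, PTree P (P.nodeOp X) (⊤_ (Over S)) s))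
      (by ext b; exact tgt_nodeOp b)

theorem singleLeft_evHom : singleLeft X ≫ evHom (P.nodeOp X) (⊤_ (Over S)) = X.hom :=
  SymMulticat.over_ext fun b => evHom_single b

/-- The inclusion of `X` in the free operad on `X`. -/
noncomputable def singleHom (X : Over (T.obj (⊤_ (Over S)))) :
    X ⟶ (operadForget T).obj (freeOperad P hT X) :=
  Over.homMk (singleLeft X) singleLeft_evHom

/-- All children are leaves, which evaluate to identities, so this is an identity law of `G`. -/
theorem extHom_single (b : X.left.left) :
    (extHom φ).left (el (single (P.nodeOp X) b)) = gen φ b := by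
  refine (extHom_node φ b _ rfl rfl _ (map_c_lab φ _ b _ rfl _ _)).trans ?_
  refine TMulticat.cmp_ids G _ _ _ ?_
  rw [d_gen]
  have h := P.map_lab G.ids (P.nodeOp X b) (fun i => pt (P.src _ i)) fun i => hom_pt _
  refine h.symm.trans (congrArg _ ?_)
  exact P.shape_rep _

/-- One-node trees generate: grafting the subtrees onto the root alone rebuilds the tree. The
witness `w` is that root with its leaves labelled by the subtrees. -/
theorem cmp_single (b : X.left.left) (g : P.Op) (hg : g = P.nodeOp X b) (h : P.tgt g = s)
    (ch : ∀ i : P.ar g, PTree P (P.nodeOp X) (⊤_ (Over S)) (P.src g i)) (h') :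
    el (node b g hg h ch) = (freeOperad P hT X).cmp
      (P.lab (Y := obj (P.nodeOp X) (⊤_ (Over S))) g (fun i => el (ch i)) fun i => obj_hom_el (ch i))
        (el (single (P.nodeOp X) b)) h' := by
  subst hg h
  let w : PTree P (P.nodeOp X) (obj (P.nodeOp X) (⊤_ (Over S))) (P.tgt (P.nodeOp X b)) :=
    node b _ rfl rfl fun i => leaf (el (ch i)) (obj_hom_el (ch i))
  refine Eq.trans ?_ (cmp_freeOperad hT w _ _ h' ?_ ?_).symm
  · refine congrArg el ?_
    exact congrArg (node b _ rfl rfl) (funext fun i => el_inj (el_bind_leaf (𝟙 _) _ _).symm)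
  · refine (evHom_el_node _ _ _ _ _).trans ?_
    have h := P.map_lab (T.η.app (obj (P.nodeOp X) (⊤_ (Over S)))) (P.nodeOp X b)
      (fun i => el (ch i)) fun i => obj_hom_el (ch i)
    refine (congrArg (T.μ.app _).left h.symm).trans ?_
    rw [right_unit_apply]
  · refine congrArg el ?_
    refine congrArg (node b _ rfl rfl) (funext fun i => ?_)
    refine (map_leaf _ _ _).trans ?_
    have : (terminal.from (obj (P.nodeOp X) (⊤_ (Over S)))).left (el (ch i)) =
        pt (P.src (P.nodeOp X b) i) := pt_hom _ _
    congr 1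

/-- Uniqueness of the extension. Leaves are identities and nodes are composites by `cmp_single`, and
a morphism of operads preserves both. -/
theorem hom_eq_extHom (F : freeOperad P hT X ⟶ G)
    (hF : ∀ b, F.hom.left (el (single (P.nodeOp X) b)) = gen φ b)
    (w : PTree P (P.nodeOp X) (⊤_ (Over S)) s) : F.hom.left (el w) = (extHom φ).left (el w) := by
  induction w with
  | leaf l h =>
    rw [extHom_leaf, ← left_congr F.ids l]
    refine congrArg F.hom.left (el_leaf l h)
  | node b g hg h ch ih =>
    have hc : ((T.map (freeOperad P hT X).c).left (P.lab (Y := obj (P.nodeOp X) (⊤_ (Over S))) g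
      (fun i => el (ch i)) fun i => obj_hom_el (ch i))) = (freeOperad P hT X).d.left
        (el (single (P.nodeOp X) b)) := by
      refine (P.map_lab_shape _ _ _ _).trans (Eq.trans ?_ (evHom_single b).symm)
      rw [hg]
      exact P.shape_rep _
    have hl := P.map_lab F.hom g (fun i => el (ch i)) fun i => obj_hom_el (ch i)
    refine (congrArg F.hom.left (cmp_single hT b g hg h ch hc)).trans ?_
    refine (TMulticat.Hom.map_cmp F _ _ hc ((congrArg _ hl).trans
      ((map_c_lab φ _ b g hg _ _).trans (congrArg _ (hF b).symm)))).trans ?_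
    refine Eq.trans ?_ (extHom_node φ b g hg h ch (map_c_lab φ _ b g hg _ _)).symm
    exact G.cmp_congr (hl.trans (P.lab_congr g (funext ih) _ _)) (hF b) _ _

end PTree

open PTree

/-- The universal property of the free operad. -/
noncomputable def freeOperadEquiv (X : Over (T.obj (⊤_ (Over S)))) (G : Operad T) :
    (freeOperad P hT X ⟶ G) ≃ (X ⟶ (operadForget T).obj G) where
  toFun F := singleHom hT X ≫ (operadForget T).map F
  invFun φ := extOperadHom hT φ
  left_inv F := TMulticat.Hom.ext (SymMulticat.over_ext fun w =>
    (hom_eq_extHom hT (singleHom hT X ≫ (operadForget T).map F) F (fun _ => rfl) w.2).symm)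
  right_inv φ := Over.OverMorphism.ext (SymMulticat.over_ext fun b => extHom_single φ b)

/-- The free operad functor. -/
noncomputable def freeFunctor : Over (T.obj (⊤_ (Over S))) ⥤ Operad T :=
  Adjunction.leftAdjointOfEquiv (G := operadForget T) (F_obj := freeOperad P hT)
    (freeOperadEquiv P hT) fun _ _ _ _ _ => by
      simp only [freeOperadEquiv, Equiv.coe_fn_mk, Functor.map_comp, Category.assoc]

/-- The free operad functor is left adjoint to the forgetful functor. -/
noncomputable def freeAdjunction : freeFunctor P hT ⊣ operadForget T :=
  Adjunction.adjunctionOfEquivLeft _ _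

end FreeOperad

end Opetopic

/-! ### The presentation of `T_Q` by arrows of `Q`, and the abstract trees underlying concrete ones.
-/

namespace Opetopic
namespace PTree

variable {S : Type u} {T : Monad (Over S)} {P : Shapes T} {C : Type u} {r : C → P.Op} {Y : Over S}
  {s s' : S}

theorem el_leaf_congr {l l' : Y.left} (hl : l = l') (h : Y.hom l = s) (h' : Y.hom l' = s') :
    el (leaf (r := r) l h) = el (leaf (r := r) l' h') := by
  subst hl h h'
  rfl

theorem el_node_congr {b b' : C} (hb : b = b') (g : P.Op) (hg : g = r b) (hg' : g = r b')
    (h : P.tgt g = s) (h' : P.tgt g = s') {ch ch' : ∀ i : P.ar g, PTree P r Y (P.src g i)}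
    (hc : ∀ i, el (ch i) = el (ch' i)) : el (node b g hg h ch) = el (node b' g hg' h' ch') := by
  subst hb h h'
  obtain rfl : ch = ch' := funext fun i => el_inj (hc i)
  rfl

end PTree

namespace SymMulticat
open SymMulticatData

variable {Q : SymMulticat.{u}} (hQ : Q.IsTidy) {X Y Z : Over (ObjClass Q)}

/-- The isomorphism class of the arrow underlying a labelled arrow. -/
def opClass (t : TObj Y) : ObjClass (slice Q) :=
  Quotient.lift (s := isIsomorphicSetoid (LabArrow Y)) (fun L => cls (Q := slice Q) L.arrow)
    (fun _ _ h => cls_eq_of_hom (slice_isTidy hQ) h.some.hom.1) t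

/-- The presentation of `T_Q` whose operations are the arrows of `Q`. -/
noncomputable def shapes : Shapes (zetaMonad hQ) where
  Op := Elt Q
  ar α := Fin α.arity
  src α i := cls (α.src i)
  tgt α := cls α.tgt
  lab {Y} α l h := (⟨α, l, h⟩ : LabArrow Y).toClass
  hom_lab _ _ _ := rfl
  map_lab _ _ _ _ := rfl
  -- This rests on tidiness: an arrow has no endomorphism in `elt(Q)` other than the identity.
  lab_inj _ _ _ h h' e := LabArrow.lab_eq hQ h h' e
  exists_lab f t α l h e := by
    induction t using tObj_ind with
    | h L =>
    obtain ⟨φ⟩ := LabArrow.hom_of_toClass_eq (L := ⟨α, l, h⟩) (M := L.relabel f) e.symm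
    exact ⟨_, (L.pull hQ φ.1).compat, (LabArrow.pull_toClass hQ L φ.1).symm⟩
  -- The operation of a shape is the representative chosen for its class among the objects of `Q⁺`.
  -- The nodes of abstract trees are thus labelled by the very arrows that occur in normal forms for
  -- `ζ(Q⁺)`.
  rep o := SymMulticat.rep (Q := slice Q) (opClass hQ o)
  exists_rep o := by
    induction o using tObj_ind with
    | h L =>
    let φ : (SymMulticat.rep (Q := slice Q) (opClass hQ L.toClass) : Elt Q) ⟶ L.arrow :=
      conn (Q := slice Q) (cls_rep _)
    exact ⟨_, (L.pull hQ φ).compat, LabArrow.pull_toClass hQ L φ⟩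

variable {hQ}

theorem lab_eq_of_hom {α β : Elt Q} (φ : α ⟶ β) (l : Fin β.arity → Y.left)
    (h : ∀ i, Y.hom (l i) = cls (β.src i)) (h') :
    (shapes hQ).lab (Y := Y) α (fun i => l (φ.perm i)) h' = (shapes hQ).lab (Y := Y) β l h :=
  LabArrow.pull_toClass hQ ⟨β, l, h⟩ φ

theorem pt_cls {x y : Q.Obj} (hQ : Q.IsTidy) (a : x ⟶ y) : pt (cls x) = pt (cls y) := by
  rw [cls_eq_of_hom hQ a]

variable (hQ) in
/-- The isomorphism classes of arrows of `Q` are the elements of `T_Q 1`. -/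
noncomputable def opEquiv : TObj (⊤_ (Over (ObjClass Q))) ≃ ObjClass (slice Q) where
  toFun := opClass hQ
  invFun := Quotient.lift (s := isIsomorphicSetoid (slice Q).Obj)
    (fun α : Elt Q => (⟨α, fun i => pt (cls (α.src i)), fun _ => hom_pt _⟩ :
      LabArrow (⊤_ (Over (ObjClass Q)))).toClass) (fun α β ⟨i⟩ =>
        LabArrow.toClass_eq_of_hom hQ (L := ⟨α, _, _⟩) (M := ⟨β, _, _⟩)
          ⟨i.hom, fun j => pt_cls hQ (EltHom.srcMap i.hom j)⟩)
  left_inv t := by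
    induction t using tObj_ind with
    | h L =>
    obtain ⟨α, l, h⟩ := L
    refine congrArg LabArrow.toClass (LabArrow.mk_congr (funext fun i => ?_) _ _)
    rw [← h, ← eq_pt]
  right_inv s := by
    induction s using Quotient.ind with
    | _ α => rfl

open PTree

variable {A B B' : Type} {C : Type u} {fs : B → Elt Q} {zs : A → Q.Obj} {y : Q.Obj}
  {r : C → (shapes hQ).Op}

theorem tObj_hom_evHom {s : ObjClass Q} (w : PTree (shapes hQ) r Y s) :
    (tObj hQ Y).hom ((evHom r Y).left (el w)) = s := hom_evHom w

namespace Tree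

variable (lam : B → C) (hl : ∀ b, fs b = r (lam b)) (κ : A → Y.left)
  (hκ : ∀ a, Y.hom (κ a) = cls (zs a))

/-- The abstract tree underlying a tree with edges labelled by object-morphisms. -/
def toPTree : ∀ {y : Q.Obj}, Tree fs zs y → PTree (shapes hQ) r Y (cls y)
  | _, edge l a => .leaf (κ l) ((hκ l).trans (cls_eq_of_hom hQ a))
  | _, node b g hg a ch => .node (lam b) g (hg.trans (hl b)) (cls_eq_of_hom hQ a)
      fun i => (ch i).toPTree

/-- Abstract trees ignore edge labels. The two sides lie over `cls y'` and `cls y`, equal classes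
with different descriptions, hence the use of `el`. -/
theorem el_toPTree_postcomp {y' : Q.Obj} (t : Tree fs zs y) (a : y ⟶ y') :
    el ((t.postcomp a).toPTree lam hl κ hκ) = el (t.toPTree lam hl κ hκ) := by
  cases t with
  | edge l b => exact el_leaf_congr rfl _ _
  | node b g hg c ch => exact el_node_congr (P := shapes hQ) rfl g _ _ _ _ fun _ => rfl

theorem toPTree_rename {gs : B' → Elt Q} (φ : B' → B) (h : ∀ b, gs b = fs (φ b))
    (t : Tree gs zs y) : (t.rename φ h).toPTree lam hl κ hκ =
      t.toPTree (fun b => lam (φ b)) (fun b => (h b).trans (hl _)) κ hκ := by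
  induction t with
  | edge l b => rfl
  | node b g hg c ch ih => exact congrArg _ (funext ih)

theorem toPTree_map (f : Y ⟶ Z) (t : Tree fs zs y) : (t.toPTree lam hl κ hκ).map f =
    t.toPTree lam hl (fun a => f.left (κ a)) fun a => (over_w_apply f _).trans (hκ a) := by
  induction t with
  | edge l b => exact map_leaf _ _ _
  | node b g hg c ch ih => exact congrArg _ (funext ih)

theorem toPTree_graft {A' : Type} {ws : A' → Q.Obj} (t : Tree fs ws y)
    (U : ∀ l, Tree fs zs (ws l)) :
    (t.graft U).toPTree lam hl κ hκ = (t.toPTree (Y := PTree.obj r Y) lam hl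
      (fun a => el ((U a).toPTree lam hl κ hκ)) fun _ => rfl).bind (𝟙 _) := by
  induction t with
  | edge l a =>
    exact el_inj ((el_toPTree_postcomp lam hl κ hκ (U l) a).trans
      (el_bind_leaf (𝟙 (PTree.obj r Y)) _ _).symm)
  | node b g hg c ch ih => exact congrArg _ (funext ih)

theorem toPTree_graft_edge {A' : Type} {ws : A' → Q.Obj} (t : Tree fs ws y) (p : A' → A)
    (a : ∀ l, zs (p l) ⟶ ws l) :
    (t.graft fun l => edge (p l) (a l)).toPTree lam hl κ hκ = t.toPTree lam hl
      (fun l => κ (p l)) fun l => (hκ _).trans (cls_eq_of_hom hQ (a l)) := by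
  induction t with
  | edge l a => rfl
  | node b g hg c ch ih => exact congrArg _ (funext ih)

/-- Composition in `T_Q` of the abstract tree is composition in `Q` of the concrete one. Normal
forms turn the multiplication into `Bag.bind`, so both sides obey the same recursion. -/
theorem nf_toPTree (t : Tree fs zs y) :
    nf hQ ((evHom r Y).left (el (t.toPTree lam hl κ hκ))) y (tObj_hom_evHom _) =
      Bag.bind t.ev fun l => Bag.var (zs := fun x : Y.left => rep (Y.hom x)) (κ l)
        (conn ((cls_rep _).trans (hκ l))) := by
  induction t with
  | edge l a =>
    rw [ev_edge, Bag.bind_var, Bag.push_var]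
    exact nf_tEta _ _ _ _
  | @node y b g hg a ch ih =>
    rw [ev_node, Bag.bind_push, Bag.bind_assoc]
    let L : LabArrow (tObj hQ Y) := ⟨g, fun i => (evHom r Y).left
      (el ((ch i).toPTree lam hl κ hκ)), fun i => tObj_hom_evHom _⟩
    have h0 : (tObj hQ (tObj hQ Y)).hom (L.toClass : TObj (tObj hQ Y)) = cls y :=
      cls_eq_of_hom hQ a
    refine (nf_tMu (hQ := hQ) (L.toClass : TObj (tObj hQ Y)) y
      ((over_w_apply (tMu hQ Y) _).trans h0) h0).trans ?_
    rw [nf_toClass L y h0 a]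
    unfold LabArrow.nrm
    rw [Bag.bind_push, Bag.bind_assoc]
    refine congrArg (Bag.push a) (congrArg (Bag.bind _) (funext fun i => ?_))
    rw [Bag.bind_var, nf_push _ _ (tObj_hom_evHom _)]
    exact ih i

end Tree

/-- Both sides have the same normal form at `f.tgt`. This transfers the condition that a
configuration composes to `f` to abstract trees. -/
theorem evHom_toPTree {f : Elt Q} (t : Tree fs f.src f.tgt) (ht : t.ev = Bag.of f.arr)
    (lam : B → C) (hl : ∀ b, fs b = r (lam b)) (κ : Fin f.arity → Y.left)
    (hκ : ∀ a, Y.hom (κ a) = cls (f.src a)) :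
    (evHom r Y).left (el (t.toPTree lam hl κ hκ)) = (shapes hQ).lab (Y := Y) f κ hκ := by
  refine tObj_ext (hQ := hQ) (tObj_hom_evHom _) rfl ((t.nf_toPTree lam hl κ hκ).trans ?_)
  rw [ht]
  refine Eq.trans ?_ (nf_toClass (⟨f, κ, hκ⟩ : LabArrow Y) f.tgt rfl (𝟙 _)).symm
  exact (Bag.push_id _).symm

end SymMulticat
end Opetopic

/-! ### Abstract trees of configurations with named nodes. -/

namespace Opetopic

namespace SymMulticat
open SymMulticatData PTree

variable {Q : SymMulticat.{u}} {hQ : Q.IsTidy} {Y Z : Over (ObjClass Q)} {C : Type u}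
   {r : C → (shapes hQ).Op} {y : Elt Q}

theorem Tree.toPTree_congr {A B : Type} {fs : B → Elt Q} {zs : A → Q.Obj} {y : Q.Obj}
    {lam lam' : B → C} (h : lam = lam') (hl : ∀ b, fs b = r (lam b)) (hl' : ∀ b, fs b = r (lam' b))
    (κ : A → Y.left) (hκ : ∀ a, Y.hom (κ a) = cls (zs a)) (t : Tree fs zs y) :
    t.toPTree lam hl κ hκ = t.toPTree lam' hl' κ hκ := by
  subst h
  rfl

/-- The abstract tree of a configuration for `y` with named nodes, the inputs of `y` being
labelled by elements of `Y`. -/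
def bagTree (κ : Fin y.arity → Y.left) (hκ : ∀ i, Y.hom (κ i) = cls (y.src i))
    (b : Bag (Q := slice Q) r y) : PTree (shapes hQ) r Y (cls y.tgt) :=
  Quotient.lift (s := bagSetoid (Q := slice Q) r y)
    (fun b => Tree.toPTree b.nm (fun _ => rfl) κ hκ (Config.tree (fs := r ∘ b.nm) b.arr)) (by
      rintro ⟨nm, f⟩ ⟨nm', f'⟩ ⟨e, h, hf⟩
      dsimp only at e h hf ⊢
      have h1 := hf.trans (sliceData_re (Q := Q) e _ f)
      rw [h1]
      refine Eq.trans ?_ (Tree.toPTree_rename nm' (fun _ => rfl) κ hκ e.symm _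
        (Config.tree (fs := r ∘ nm) f)).symm
      congr 1
      funext i
      simp [h]) b

theorem bagTree_map (κ : Fin y.arity → Y.left) (hκ : ∀ i, Y.hom (κ i) = cls (y.src i))
    (f : Y ⟶ Z) (b : Bag (Q := slice Q) r y) : (bagTree κ hκ b).map f =
      bagTree (fun i => f.left (κ i)) (fun i => (over_w_apply f _).trans (hκ i)) b := by
  obtain ⟨n, nm, D, rfl⟩ := Bag.exists_rep b
  exact Tree.toPTree_map _ _ _ _ _ _

theorem evHom_bagTree (κ : Fin y.arity → Y.left) (hκ : ∀ i, Y.hom (κ i) = cls (y.src i))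
    (b : Bag (Q := slice Q) r y) :
    (evHom r Y).left (el (bagTree κ hκ b)) = (shapes hQ).lab (Y := Y) y κ hκ := by
  obtain ⟨n, nm, D, rfl⟩ := Bag.exists_rep b
  exact evHom_toPTree (Config.tree (fs := r ∘ nm) D) (Config.ev_eq (fs := r ∘ nm) D) nm _ κ hκ

/-- Pushing along `a` substitutes the configuration into a one-node tree, which renames the leaves
by `a.perm` and alters edge labels; only the renaming is visible in the abstract tree. -/
theorem el_bagTree_push {y' : Elt Q} (κ : Fin y'.arity → Y.left)
    (hκ : ∀ i, Y.hom (κ i) = cls (y'.src i)) (b : Bag (Q := slice Q) r y) (a : y ⟶ y') :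
    el (bagTree κ hκ (Bag.push (Q := slice Q) a b)) = el (bagTree (fun i => κ (a.perm i))
      (fun i => (hκ _).trans (cls_eq_of_hom hQ (a.srcMap i))) b) := by
  obtain ⟨n, nm, D, rfl⟩ := Bag.exists_rep b
  refine (congrArg (fun t => el (bagTree κ hκ t)) (Bag.push_mk (Q := slice Q) a nm D)).trans ?_
  let D' : Config (r ∘ nm) y := D
  have h1 : (Config.comp (Config.ofHom a) fun _ => D').tree =
      ((D'.tree.rename (fun j => finSigmaFinEquiv ⟨(0 : Fin 1), j⟩)
        (fun j => (concat_apply (fun _ => r ∘ nm) 0 j).symm)).graft fun i =>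
          Tree.edge (a.perm i) (a.srcMap i)).postcomp a.tgtMap := rfl
  refine (congrArg (fun t => el (Tree.toPTree (concat fun _ : Fin 1 => nm) (fun _ => rfl) κ hκ t))
    h1).trans ?_
  refine (Tree.el_toPTree_postcomp _ _ _ _ _ _).trans ?_
  refine congrArg el ((Tree.toPTree_graft_edge _ _ _ _ _ _ _).trans ?_)
  refine (Tree.toPTree_rename _ _ _ _ _ _ _).trans ?_
  exact Tree.toPTree_congr (funext fun j => concat_apply (fun _ => nm) 0 j) _ _ _ _ D'.tree

/-- The abstract tree of a configuration with named nodes. -/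
noncomputable abbrev shapeTree (b : Bag (Q := slice Q) r y) :
    PTree (shapes hQ) r (⊤_ (Over (ObjClass Q))) (cls y.tgt) :=
  bagTree (fun i => pt (cls (y.src i))) (fun _ => hom_pt _) b

/-- With leaves labelled only by their classes, even the renaming by `a.perm` disappears, since
corresponding inputs have the same class. Hence the choice of representative of an arrow does not
matter. -/
theorem el_shapeTree_push {y' : Elt Q} (b : Bag (Q := slice Q) r y) (a : y ⟶ y') :
    el (shapeTree (Bag.push (Q := slice Q) a b)) = el (shapeTree b) := by
  refine (el_bagTree_push _ _ b a).trans ?_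
  congr 2
  exact funext fun i => pt_cls hQ (a.srcMap i)

theorem el_shapeTree_var (l : C) (a : (show Elt Q from r l) ⟶ y) :
    el (shapeTree (Bag.var (Q := slice Q) (zs := r) l a)) = el (PTree.node (r := r) (P := shapes hQ) l (r l) rfl rfl
      fun i => .leaf (pt ((shapes hQ).src (r l) i)) (hom_pt _)) := by
  refine el_node_congr (P := shapes hQ) rfl (r l) _ _ _ _ fun i => ?_
  exact el_leaf_congr (pt_cls hQ (a.srcMap i)) _ _

end SymMulticat
end Opetopic

/-! ### Substitution of trees as evaluation in a free operad. -/

namespace Opetopic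
namespace SymMulticat
open SymMulticatData PTree

variable {Q : SymMulticat.{u}} {hQ : Q.IsTidy} {hT : IsCartesian (zetaMonad hQ)}
  {X X' : Over ((zetaMonad hQ).obj (⊤_ (Over (ObjClass Q))))}
  (φ : X ⟶ (operadForget (zetaMonad hQ)).obj (freeOperad (shapes hQ) hT X'))

variable (hQ X) in
/-- The arrows of `Q` labelling the nodes of trees. -/
noncomputable abbrev nodeArrow (x : X.left.left) : Elt Q := (shapes hQ).nodeOp X x

/-- Substituting trees for the nodes of a tree is evaluation in a free operad. -/
theorem extHom_subst {A B B' B'' : Type} {fs : B → Elt Q} {gs : B' → Elt Q} {hs : B'' → Elt Q}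
    {zs : A → Q.Obj} {y : Q.Obj} (t : Tree fs zs y) (x : B → X.left.left)
    (lam : B' → X'.left.left) (hl : ∀ b, gs b = (shapes hQ).nodeOp X' (lam b))
    (lam' : B'' → X.left.left) (hl' : ∀ b, hs b = (shapes hQ).nodeOp X (lam' b))
    (κ : A → (⊤_ (Over (ObjClass Q))).left)
    (hκ : ∀ a, (⊤_ (Over (ObjClass Q))).hom (κ a) = cls (zs a))
    (R : ∀ b (g : Elt Q), g = fs b → Tree gs g.src g.tgt)
    (hR : ∀ b g hg, (R b g hg).ev = Bag.of g.arr)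
    (hR' : ∀ b g hg, el ((R b g hg).toPTree lam hl (fun i => pt (cls (g.src i)))
      fun _ => hom_pt _) = gen φ (x b))
    (R' : ∀ b (g : Elt Q), g = fs b → Tree hs g.src g.tgt)
    (hR'' : ∀ b g hg, ∃ (b' : B'') (α : Elt Q) (hα : α = hs b') (ψ : α ⟶ g), R' b g hg =
      Tree.node b' α hα ψ.tgtMap (fun i => Tree.edge (ψ.perm i) (ψ.srcMap i)) ∧ lam' b' = x b) :
    (extHom φ).left (el ((t.subst R').toPTree lam' hl' κ hκ)) =
      el ((t.subst R).toPTree lam hl κ hκ) := by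
  induction t with
  | edge l a =>
    refine (extHom_leaf φ _ _).trans ?_
    exact (el_leaf _ _).symm
  | node b g hg a ch ih =>
    obtain ⟨b', α, hα, ψ, h1, h2⟩ := hR'' b g hg
    -- The substituted children serve as leaf labels of the tree put in place of the root. The
    -- resulting tree of trees `w` grafts to the right-hand side, and its shape is the value of `φ`
    -- at the root.
    let κ' : Fin g.arity → (PTree.obj ((shapes hQ).nodeOp X') (⊤_ (Over (ObjClass Q)))).left :=
      fun i => el (((ch i).subst R).toPTree lam hl κ hκ)
    have hκ' : ∀ i, (PTree.obj ((shapes hQ).nodeOp X') (⊤_ (Over (ObjClass Q)))).hom (κ' i) =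
      cls (g.src i) := fun i => rfl
    let w := (R b g hg).toPTree lam hl κ' hκ'
    have hw : el (((Tree.node b g hg a ch).subst R).toPTree lam hl κ hκ) = el (w.bind (𝟙 _)) := by
      refine (Tree.el_toPTree_postcomp _ _ _ _ ((R b g hg).graft _) a).trans ?_
      exact congrArg el (Tree.toPTree_graft _ _ _ _ _ _)
    have hu : el (w.map (terminal.from _)) = gen φ (x b) := by
      refine Eq.trans (congrArg el ?_) (hR' b g hg)
      refine (Tree.toPTree_map _ _ _ _ _ _).trans ?_
      congr 1
      exact funext fun i => (pt_hom _ _).trans (congrArg pt (hκ' i))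
    -- On the left the root is replaced by one node labelled by an arrow `α` with a morphism `ψ : α
    -- ⟶ g`, so its children are those of `g` permuted by `ψ`; `lab_eq_of_hom` undoes the
    -- permutation in `hlab`.
    let chl : ∀ i, PTree (shapes hQ) ((shapes hQ).nodeOp X) (⊤_ (Over (ObjClass Q)))
        (cls (α.src i)) := fun i =>
      (((ch (ψ.perm i)).subst R').postcomp (ψ.srcMap i)).toPTree lam' hl' κ hκ
    have hL : el (((Tree.node b g hg a ch).subst R').toPTree lam' hl' κ hκ) =
        el (PTree.node (P := shapes hQ) (lam' b') α (hα.trans (hl' b'))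
          (cls_eq_of_hom hQ ψ.tgtMap) chl) := by
      refine (Tree.el_toPTree_postcomp _ _ _ _ ((R' b g hg).graft _) a).trans ?_
      rw [h1]
      rfl
    have hκψ : ∀ i, (PTree.obj ((shapes hQ).nodeOp X') (⊤_ (Over (ObjClass Q)))).hom
        (κ' (ψ.perm i)) = cls (α.src i) := fun i => (hκ' _).trans (cls_eq_of_hom hQ (ψ.srcMap i))
    have hlab : (shapes hQ).lab (Y := (freeOperad (shapes hQ) hT X').C₁) α
        (fun i => (extHom φ).left (el (chl i))) (fun i => hom_extHom φ (chl i)) =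
        (shapes hQ).lab (Y := (freeOperad (shapes hQ) hT X').C₁) g κ' hκ' := by
      refine Eq.trans ((shapes hQ).lab_congr α (funext fun i => ?_) _ hκψ)
        (lab_eq_of_hom ψ κ' hκ' hκψ)
      refine (congrArg (extHom φ).left (Tree.el_toPTree_postcomp _ _ _ _ _ _)).trans ?_
      exact ih (ψ.perm i)
    have hc := map_c_lab (P := shapes hQ) φ (freeOperad (shapes hQ) hT X').c (lam' b') α (hα.trans (hl' b'))
      (fun i => (extHom φ).left (el (chl i))) fun i => hom_extHom φ (chl i)
    refine (congrArg (extHom φ).left hL).trans ?_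
    refine (extHom_node (P := shapes hQ) φ (lam' b') α (hα.trans (hl' b')) _ chl hc).trans ?_
    have hg2 : gen φ (lam' b') = gen φ (x b) := by rw [h2]
    have hc' := hc
    rw [hlab, hg2] at hc'
    refine ((freeOperad (shapes hQ) hT X').cmp_congr hlab hg2 hc hc').trans ?_
    refine Eq.trans ?_ hw.symm
    exact cmp_freeOperad hT w _ _ hc' (evHom_toPTree _ (hR b g hg) _ _ _ _) hu

theorem Config.treeAt_ofHom {B : Type} {gs : B → Elt Q} {α f : Elt Q} (ψ : α ⟶ f)
    (b : Fin 1 → B) (h : ∀ i, α = gs (b i)) (g : Elt Q) (hg : g = f) :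
    ∃ χ : α ⟶ g, (Config.ofHom ψ).treeAt b h g hg =
      Tree.node (b 0) α (h 0) χ.tgtMap fun i => Tree.edge (χ.perm i) (χ.srcMap i) := by
  subst hg
  exact ⟨ψ, rfl⟩

/-- Serves both naturality and multiplicativity of `toTree`: in the first case the `U a` are
one-node configurations, in the second they are normal forms of elements of `T_{Q⁺} X`. -/
theorem extHom_shapeTree {C : Type u} {ws : C → Elt Q} {y : Elt Q} (b : Bag (Q := slice Q) ws y)
    (x : C → X.left.left) (c : ∀ a, nodeArrow hQ X (x a) ⟶ ws a)
    (U : ∀ a, Bag (Q := slice Q) ((shapes hQ).nodeOp X') (ws a))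
    (hU : ∀ a, el (shapeTree (U a)) = gen φ (x a)) :
    (extHom φ).left (el (shapeTree (hQ := hQ) (r := (shapes hQ).nodeOp X)
      (Bag.bind (Q := slice Q) (zs := (shapes hQ).nodeOp X) b fun a =>
        Bag.var (Q := slice Q) (zs := (shapes hQ).nodeOp X) (x a) (c a)))) =
      el (shapeTree (hQ := hQ) (r := (shapes hQ).nodeOp X') (Bag.bind (Q := slice Q) b U)) := by
  obtain ⟨n, nm, D, rfl⟩ := Bag.exists_rep b
  choose m nm' E hE using fun i => Bag.exists_rep (U (nm i))
  have e1 := Bag.bind_mk (Q := slice Q) nm D U nm' E hE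
  have e2 := Bag.bind_mk (Q := slice Q) nm D (zs := (shapes hQ).nodeOp X)
    (fun a => Bag.var (Q := slice Q) (zs := (shapes hQ).nodeOp X) (x a) (c a))
    (fun i _ => x (nm i)) (fun i => (slice Q).ι (c (nm i))) (fun _ => rfl)
  refine (congrArg (fun b => (extHom φ).left (el (shapeTree b))) e2).trans
    (Eq.trans ?_ (congrArg (fun b => el (shapeTree b)) e1.symm))
  refine extHom_subst φ (Config.tree (fs := ws ∘ nm) D) (fun i => x (nm i)) _ _ _ _ _ _
    _ (fun b g hg => Config.treeAt_ev _ _ _ _ _) (fun b g hg => ?_) _ (fun b g hg => ?_)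
  · subst hg
    refine Eq.trans (congrArg el ?_) (hU (nm b))
    refine (Tree.toPTree_rename _ _ _ _ _ _ _).trans ?_
    refine Eq.trans ?_ (congrArg shapeTree (hE b).symm)
    exact Tree.toPTree_congr (funext fun j => concat_apply _ b j) _ _ _ _ _
  · obtain ⟨χ, hχ⟩ := Config.treeAt_ofHom
      (gs := concat fun i (_ : Fin 1) => nodeArrow hQ X (x (nm i))) (c (nm b)) (fun j => finSigmaFinEquiv ⟨b, j⟩)
      (fun j => (concat_apply (fun i (_ : Fin 1) => nodeArrow hQ X (x (nm i))) b j).symm) g hg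
    exact ⟨_, _, _, χ, hχ, concat_apply (fun i (_ : Fin 1) => x (nm i)) b 0⟩

end SymMulticat
end Opetopic

/-! ### The base categories, and the comparison map `toTree`. -/

namespace Opetopic
namespace SymMulticat
open SymMulticatData PTree

variable {Q : SymMulticat.{u}} (hQ : Q.IsTidy)

/-- The objects over `T_Q 1`, as objects over the set of isomorphism classes of arrows. -/
noncomputable def overSlice :
    Over ((zetaMonad hQ).obj (⊤_ (Over (ObjClass Q)))) ⥤ Over (ObjClass (slice Q)) where
  obj X := Over.mk (Y := X.left.left) (↾fun x => opClass hQ (X.hom.left x))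
  map {X Y} f := Over.homMk f.left.left (by
    ext x
    exact congrArg (opClass hQ) (TGraphData.left_congr (Over.w f) x))

/-- The objects over the set of isomorphism classes of arrows, as objects over `T_Q 1`. -/
noncomputable def sliceOver :
    Over (ObjClass (slice Q)) ⥤ Over ((zetaMonad hQ).obj (⊤_ (Over (ObjClass Q)))) where
  obj Z := Over.mk (Y := Over.mk (Y := Z.left)
      (↾fun z => (tObj hQ (⊤_ (Over (ObjClass Q)))).hom ((opEquiv hQ).symm (Z.hom z))))
    (Over.homMk (↾fun z => (opEquiv hQ).symm (Z.hom z)) rfl)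
  map {Z W} f := Over.homMk (Over.homMk f.left (by
      ext z
      exact congrArg (fun s => (tObj hQ (⊤_ (Over (ObjClass Q)))).hom ((opEquiv hQ).symm s))
        (over_w_apply f z))) (by
    apply over_ext
    intro z
    exact congrArg (opEquiv hQ).symm (over_w_apply f z))

theorem sliceOver_overSlice_obj (Z : Over (ObjClass (slice Q))) :
    (overSlice hQ).obj ((sliceOver hQ).obj Z) = Z := by
  have : (overSlice hQ).obj ((sliceOver hQ).obj Z) = Over.mk Z.hom :=
    congrArg (fun f : Z.left ⟶ ObjClass (slice Q) => Over.mk f)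
      (by ext z; exact (opEquiv hQ).apply_symm_apply (Z.hom z))
  exact this

theorem over_mk_mk_congr {S : Type u} {W : Over S} {A : Type u} {h h' : A ⟶ S} (e : h = h')
    (k : Over.mk h ⟶ W) (k' : Over.mk h' ⟶ W) (e' : ∀ a : A, k.left a = k'.left a) :
    Over.mk k = Over.mk k' := by
  subst e
  obtain rfl : k = k' := over_ext e'
  rfl

/-- The map from `X.left` to the object classes is determined by the map to `T_Q 1`, so forgetting
it loses nothing and `X` is recovered as an equal object, not merely an isomorphic one. -/
theorem overSlice_sliceOver_obj (X : Over ((zetaMonad hQ).obj (⊤_ (Over (ObjClass Q))))) :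
    (sliceOver hQ).obj ((overSlice hQ).obj X) = X := by
  refine over_mk_mk_congr (W := (zetaMonad hQ).obj (⊤_ (Over (ObjClass Q)))) (A := X.left.left)
    (h' := X.left.hom) ?_ _ X.hom ?_
  · ext x
    refine (congrArg (tObj hQ (⊤_ (Over (ObjClass Q)))).hom
      ((opEquiv hQ).symm_apply_apply (X.hom.left x))).trans ?_
    exact over_w_apply X.hom x
  · intro x
    exact (opEquiv hQ).symm_apply_apply (X.hom.left x)

/-- The round trips leave underlying sets unchanged, so the `eqToHom` terms arising from them act on
elements as casts along `rfl`. -/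
theorem over_eqToHom_left {S : Type u} {X Y : Over S} (h : X = Y) (h' : X.left = Y.left)
    (x : X.left) : (eqToHom h).left x = cast h' x := by
  subst h
  rfl

theorem over_over_eqToHom_left {S : Type u} {W : Over S} {X Y : Over W} (h : X = Y)
    (h' : X.left.left = Y.left.left) (x : X.left.left) :
    (eqToHom h).left.left x = cast h' x := by
  subst h
  rfl

theorem sliceOver_comp_overSlice : sliceOver hQ ⋙ overSlice hQ = 𝟭 _ :=
  CategoryTheory.Functor.ext (sliceOver_overSlice_obj hQ) fun Z W f => over_ext fun z => by
    have h1 := over_eqToHom_left (sliceOver_overSlice_obj hQ Z) rfl z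
    have h2 := over_eqToHom_left (sliceOver_overSlice_obj hQ W).symm rfl (f.left z)
    refine Eq.trans ?_ (h2.symm.trans (congrArg (fun z => (eqToHom
      (sliceOver_overSlice_obj hQ W).symm).left (f.left z)) h1.symm))
    rfl

theorem overSlice_comp_sliceOver : overSlice hQ ⋙ sliceOver hQ = 𝟭 _ :=
  CategoryTheory.Functor.ext (overSlice_sliceOver_obj hQ) fun X Y f =>
    Over.OverMorphism.ext (over_ext fun z => by
    have h1 := over_over_eqToHom_left (overSlice_sliceOver_obj hQ X) rfl z
    have h2 := over_over_eqToHom_left (overSlice_sliceOver_obj hQ Y).symm rfl (f.left.left z)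
    refine Eq.trans ?_ (h2.symm.trans (congrArg (fun z => (eqToHom
      (overSlice_sliceOver_obj hQ Y).symm).left.left (f.left.left z)) h1.symm))
    rfl)

theorem zetaMonad_isCartesian : IsCartesian (zetaMonad hQ) := (zeta Q hQ).cartesian

/-- The adjunction between operads and graphs. -/
noncomputable def operadAdjunction :
    freeFunctor (shapes hQ) (zetaMonad_isCartesian hQ) ⊣ operadForget (zetaMonad hQ) :=
  freeAdjunction _ _

variable {hQ} {X X' : Over ((zetaMonad hQ).obj (⊤_ (Over (ObjClass Q))))}

/-- The normal form of an element of `T_{Q⁺} X`. -/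
noncomputable def sliceNf (t : TObj ((overSlice hQ).obj X)) (y : Elt Q)
    (h : (tObj (slice_isTidy hQ) ((overSlice hQ).obj X)).hom t = cls (Q := slice Q) y) :
    Bag (Q := slice Q) (nodeArrow hQ X) y := nf (slice_isTidy hQ) t y h

variable (X) in
/-- The abstract tree of an element of `T_{Q⁺} X`. -/
noncomputable def toTree : (zetaMonad (slice_isTidy hQ)).obj ((overSlice hQ).obj X) ⟶
    (overSlice hQ).obj ((operadAdjunction hQ).toMonad.obj X) :=
  Over.homMk (↾fun t : TObj ((overSlice hQ).obj X) =>
    el (shapeTree (hQ := hQ) (r := (shapes hQ).nodeOp X) (sliceNf t (rep (Q := slice Q)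
      ((tObj (slice_isTidy hQ) ((overSlice hQ).obj X)).hom t)) (cls_rep _).symm))) (by
    ext t
    -- The composite of the tree of a configuration for an arrow is that arrow.
    refine (congrArg (opClass hQ) (evHom_bagTree _ _ _)).trans ?_
    exact cls_rep (Q := slice Q) _)

/-- The tree may be computed from the normal form at any arrow `y` of the class, since changing `y`
is a push. -/
theorem toTree_eq (t : TObj ((overSlice hQ).obj X)) (y : Elt Q)
    (h : (tObj (slice_isTidy hQ) ((overSlice hQ).obj X)).hom t = cls (Q := slice Q) y) :
    (toTree X).left t = el (shapeTree (hQ := hQ) (r := (shapes hQ).nodeOp X) (sliceNf t y h)) := by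
  have := nf_push (hQ := slice_isTidy hQ) t (cls_rep _).symm h
    (conn (Q := slice Q) ((cls_rep _).trans h))
  refine Eq.trans ?_ (congrArg (fun b => el (shapeTree (hQ := hQ) (r := (shapes hQ).nodeOp X) b))
    this)
  exact (el_shapeTree_push _ _).symm

theorem toTree_tEta (x : X.left.left) :
    (toTree X).left ((tEta (slice_isTidy hQ) ((overSlice hQ).obj X)).left x) =
      el (single ((shapes hQ).nodeOp X) x) := by
  have h0 : (tObj (slice_isTidy hQ) ((overSlice hQ).obj X)).hom
    ((tEta (slice_isTidy hQ) ((overSlice hQ).obj X)).left x) =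
      cls (Q := slice Q) (nodeArrow hQ X x) := (over_w_apply _ _).trans (cls_rep _).symm
  refine (toTree_eq _ _ h0).trans ?_
  refine (congrArg (fun b => el (shapeTree (hQ := hQ) (r := (shapes hQ).nodeOp X) b))
    (nf_tEta (hQ := slice_isTidy hQ) (X := (overSlice hQ).obj X) x _ h0 (𝟙 _))).trans ?_
  exact el_shapeTree_var x (𝟙 (nodeArrow hQ X x))

theorem toTree_tMap (f : X ⟶ X') (t : TObj ((overSlice hQ).obj X)) :
    (toTree X').left ((tMap (slice_isTidy hQ) ((overSlice hQ).map f)).left t) =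
      ((operadAdjunction hQ).toMonad.map f).left.left ((toTree X).left t) := by
  have h0 := (cls_rep ((tObj (slice_isTidy hQ) ((overSlice hQ).obj X)).hom t)).symm
  have h1 := (over_w_apply (tMap (slice_isTidy hQ) ((overSlice hQ).map f)) t).trans h0
  let b := sliceNf t _ h0
  refine (toTree_eq _ _ h1).trans ?_
  refine (congrArg (fun b => el (shapeTree (hQ := hQ) (r := (shapes hQ).nodeOp X') b))
    (nf_tMap (hQ := slice_isTidy hQ) ((overSlice hQ).map f) t _ h1 h0)).trans ?_
  -- The normal form `b` is rewritten as a substitution of variables, the shape required by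
  -- `extHom_shapeTree`.
  refine Eq.trans ?_ (congrArg (fun b => (extHom (f ≫ singleHom (zetaMonad_isCartesian hQ) X')).left
    (el (shapeTree (hQ := hQ) (r := (shapes hQ).nodeOp X) b))) (Bag.bind_pure (Q := slice Q) b))
  refine (extHom_shapeTree (f ≫ singleHom (zetaMonad_isCartesian hQ) X') b id (fun _ => 𝟙 _) _
    fun a => ?_).symm
  exact el_shapeTree_var _ _

/-- The multiplication of the free operad monad is evaluation along the identity. The normal forms
of the two sides substitute, respectively, configurations and single nodes standing for their trees,
which is what `extHom_shapeTree` compares. -/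
theorem toTree_tMu (t : TObj (tObj (slice_isTidy hQ) ((overSlice hQ).obj X))) :
    (toTree X).left ((tMu (slice_isTidy hQ) ((overSlice hQ).obj X)).left t) =
      ((operadAdjunction hQ).toMonad.μ.app X).left.left
        ((toTree ((operadAdjunction hQ).toMonad.obj X)).left
          ((tMap (slice_isTidy hQ) (toTree X)).left t)) := by
  have h0 := (cls_rep ((tObj (slice_isTidy hQ)
    (tObj (slice_isTidy hQ) ((overSlice hQ).obj X))).hom t)).symm
  have h1 := (over_w_apply (tMu (slice_isTidy hQ) ((overSlice hQ).obj X)) t).trans h0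
  have h2 := (over_w_apply (tMap (slice_isTidy hQ) (toTree X)) t).trans h0
  let b := nf (slice_isTidy hQ) t _ h0
  refine (toTree_eq _ _ h1).trans ?_
  refine (congrArg (fun b => el (shapeTree (hQ := hQ) (r := (shapes hQ).nodeOp X) b))
    (nf_tMu (hQ := slice_isTidy hQ) t _ h1 h0)).trans ?_
  refine Eq.trans ?_ (congrArg (((operadAdjunction hQ).toMonad.μ.app X).left.left)
    (toTree_eq _ _ h2)).symm
  refine Eq.trans ?_ (congrArg (fun b => (extHom (𝟙 ((operadAdjunction hQ).toMonad.obj X))).left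
    (el (shapeTree (hQ := hQ)
      (r := (shapes hQ).nodeOp ((operadAdjunction hQ).toMonad.obj X)) b)))
      (nf_tMap (hQ := slice_isTidy hQ) (toTree X) t _ h2 h0)).symm
  refine (extHom_shapeTree (hT := zetaMonad_isCartesian hQ)
    (𝟙 ((operadAdjunction hQ).toMonad.obj X)) b
    (fun t => (toTree X).left t) _ _ fun a => ?_).symm
  rfl

end SymMulticat
end Opetopic

/-! ### Injectivity of the comparison. -/

namespace Opetopic
namespace SymMulticat
open SymMulticatData PTree

variable {Q : SymMulticat.{u}} {hQ : Q.IsTidy} {Y : Over (ObjClass Q)} {C : Type u}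
  {r : C → (shapes hQ).Op}

theorem Tree.rename_congr_of_mem {A B B' : Type} {fs : B → Elt Q} {gs : B' → Elt Q}
    {zs : A → Q.Obj} {y : Q.Obj} (φ ψ : B → B') (h : ∀ b, fs b = gs (φ b))
    (h' : ∀ b, fs b = gs (ψ b)) (t : Tree fs zs y) (ht : ∀ b ∈ t.nodes, φ b = ψ b) :
    t.rename φ h = t.rename ψ h' := by
  induction t with
  | edge l a => rfl
  | node b g hg a ch ih =>
    have h1 : φ b = ψ b := ht b (by simp [nodes])
    have h2 : ∀ i, (ch i).rename φ h = (ch i).rename ψ h' := fun i => ih i fun c hc =>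
      ht c (Multiset.mem_cons_of_mem (Multiset.mem_sum.2 ⟨i, Finset.mem_univ i, hc⟩))
    simp only [rename, h1, h2]

/-- Trees with the same underlying abstract tree can be superposed. -/
theorem Tree.exists_zip {A B B' : Type} {fs : B → Elt Q} {gs : B' → Elt Q} {zs : A → Q.Obj}
    {y : Q.Obj} (lam : B → C) (hl : ∀ b, fs b = r (lam b)) (lam' : B' → C)
    (hl' : ∀ b, gs b = r (lam' b)) (κ : A → Y.left) (hκ : ∀ a, Y.hom (κ a) = cls (zs a))
    (inj : Function.Injective κ) (t : Tree fs zs y) (t' : Tree gs zs y)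
    (h : t.toPTree lam hl κ hκ = t'.toPTree lam' hl' κ hκ) :
    ∃ t'' : Tree (fun p : { p : B × B' // lam p.1 = lam' p.2 } => fs p.1.1) zs y,
      t''.rename (gs := fs) (fun p : { p : B × B' // lam p.1 = lam' p.2 } => p.1.1)
        (fun _ => rfl) = t ∧
      t''.rename (gs := gs) (fun p : { p : B × B' // lam p.1 = lam' p.2 } => p.1.2)
        (fun p => (hl _).trans ((congrArg r p.2).trans (hl' _).symm)) = t' := by
  induction t with
  | edge l a =>
    cases t' with
    | edge l' a' =>
      injection h with _ h1
      obtain rfl := inj h1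
      -- Edge labels are forgotten in the abstract tree; they agree because parallel
      -- object-morphisms are equal.
      obtain rfl := hom_unique hQ a a'
      exact ⟨edge l a, rfl, rfl⟩
    | node b' g' hg' a' ch' => injection h
  | node b g hg a ch ih =>
    cases t' with
    | edge l' a' => injection h
    | node b' g' hg' a' ch' =>
      injection h with _ h1 h2 h3
      subst h2
      have h3 := eq_of_heq h3
      obtain rfl := hom_unique hQ a a'
      choose u hu hu' using fun i => ih i (ch' i) (congrFun h3 i)
      refine ⟨node ⟨(b, b'), h1⟩ g hg a u, ?_, ?_⟩
      · exact congrArg (node b g hg a) (funext hu)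
      · exact congrArg (node b' g hg' a) (funext hu')

/-- A multiset of pairs whose components enumerate two finite types is the graph of a bijection. -/
theorem exists_equiv_of_multiset {B B' : Type} [Fintype B] [Fintype B'] (p : B × B' → Prop)
    (m : Multiset { x : B × B' // p x }) (h : m.map (fun x => x.1.1) = Finset.univ.val)
    (h' : m.map (fun x => x.1.2) = Finset.univ.val) :
    ∃ σ : B ≃ B', (∀ b, p (b, σ b)) ∧ ∀ x ∈ m, σ x.1.1 = x.1.2 := by
  have h1 : ∀ b, ∃ x ∈ m, x.1.1 = b := fun b => Multiset.mem_map.1 (by rw [h]; simp)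
  have h2 : ∀ b, ∃ x ∈ m, x.1.2 = b := fun b => Multiset.mem_map.1 (by rw [h']; simp)
  have i1 : ∀ x ∈ m, ∀ x' ∈ m, x.1.1 = x'.1.1 → x = x' := fun x hx x' hx' =>
    Multiset.inj_on_of_nodup_map (by rw [h]; exact Finset.univ.nodup) x hx x' hx'
  have i2 : ∀ x ∈ m, ∀ x' ∈ m, x.1.2 = x'.1.2 → x = x' := fun x hx x' hx' =>
    Multiset.inj_on_of_nodup_map (by rw [h']; exact Finset.univ.nodup) x hx x' hx'
  choose s hs hs1 using h1
  have key : ∀ x ∈ m, s x.1.1 = x := fun x hx => i1 _ (hs _) _ hx (hs1 _)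
  refine ⟨Equiv.ofBijective (fun b => (s b).1.2) ⟨fun b b' hb => ?_, fun c => ?_⟩, fun b => ?_,
    fun x hx => congrArg (fun x => x.1.2) (key x hx)⟩
  · rw [← hs1 b, ← hs1 b', i2 _ (hs b) _ (hs b') hb]
  · obtain ⟨x, hx, rfl⟩ := h2 c
    exact ⟨x.1.1, congrArg (fun x => x.1.2) (key x hx)⟩
  · have := (s b).2
    rw [← Prod.mk.eta (p := (s b).1), hs1] at this
    exact this

/-- Superposing the two trees gives one tree with nodes named by pairs. Each projection enumerates
the nodes of a configuration exactly once, so the pairs form the graph of a bijection, and that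
bijection is the renumbering identifying the bags. -/
theorem bagTree_injective {y : Elt Q} (κ : Fin y.arity → Y.left)
    (hκ : ∀ i, Y.hom (κ i) = cls (y.src i)) (inj : Function.Injective κ)
    (b b' : Bag (Q := slice Q) r y) (h : bagTree κ hκ b = bagTree κ hκ b') : b = b' := by
  obtain ⟨n, nm, D, rfl⟩ := Bag.exists_rep b
  obtain ⟨n', nm', D', rfl⟩ := Bag.exists_rep b'
  obtain ⟨t, ht, ht'⟩ := Tree.exists_zip (r := r) nm (fun _ => rfl) nm' (fun _ => rfl) κ hκ inj
    (Config.tree (fs := r ∘ nm) D) (Config.tree (fs := r ∘ nm') D') h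
  have h1 := (Tree.nodes_rename _ _ t).symm.trans
    ((congrArg Tree.nodes ht).trans (Config.nodes_eq (fs := r ∘ nm) D))
  have h2 := (Tree.nodes_rename _ _ t).symm.trans
    ((congrArg Tree.nodes ht').trans (Config.nodes_eq (fs := r ∘ nm') D'))
  obtain ⟨σ, hσ, hσ'⟩ := exists_equiv_of_multiset _ _ h1 h2
  refine Bag.mk_eq_mk.2 ⟨σ.symm, fun i => ?_, ?_⟩
  · refine Eq.trans ?_ (hσ (σ.symm i)).symm
    exact congrArg nm' (σ.apply_symm_apply i).symm
  · refine Eq.trans ?_ (sliceData_re (Q := Q) (fs := r ∘ nm) (gs := r ∘ nm') σ.symm _ D).symm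
    refine Config.ext (fs := r ∘ nm') ?_
    refine ht'.symm.trans ?_
    refine Eq.trans ?_ (congrArg (fun t => Tree.rename (gs := r ∘ nm') σ
      (fun i => congrArg r (hσ i)) t) ht)
    refine Eq.trans ?_ (Tree.rename_rename _ _ _ _ t).symm
    exact Tree.rename_congr_of_mem _ _ _ _ t fun p hp => (hσ' p hp).symm

/-- Classes do not distinguish leaves, so the inputs of `y` are relabelled by their positions. The
two relabelled trees have the same shape and the same composite, namely `y` with its positions,
hence coincide by `eq_of_map_eq`; now `bagTree_injective` applies. -/
theorem shapeTree_injective {y : Elt Q} (b b' : Bag (Q := slice Q) r y)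
    (h : shapeTree (hQ := hQ) (r := r) b = shapeTree (hQ := hQ) (r := r) b') : b = b' := by
  let Y : Over (ObjClass Q) := Over.mk (Y := ULift.{u} (Fin y.arity)) (↾fun i => cls (y.src i.down))
  let κ : Fin y.arity → Y.left := fun i => ⟨i⟩
  have hκ : ∀ i, Y.hom (κ i) = cls (y.src i) := fun _ => rfl
  refine bagTree_injective κ hκ (fun i j hij => congrArg ULift.down hij) b b' ?_
  have key : ∀ b : Bag (Q := slice Q) r y, (bagTree κ hκ b).map (terminal.from Y) =
      shapeTree (hQ := hQ) (r := r) b := fun b => by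
    refine (bagTree_map _ _ _ _).trans ?_
    congr 1
    exact funext fun i => pt_hom _ _
  refine eq_of_map_eq (zeta Q hQ).cartesian (terminal.from Y) _ _
    ((key b).trans (h.trans (key b').symm)) ?_
  exact (evHom_bagTree _ _ _).trans (evHom_bagTree _ _ _).symm

theorem toTree_injective (X : Over ((zetaMonad hQ).obj (⊤_ (Over (ObjClass Q))))) :
    Function.Injective (toTree X).left := by
  intro t t' h
  have h0 := (cls_rep ((tObj (slice_isTidy hQ) ((overSlice hQ).obj X)).hom t)).symm
  have h1 : (tObj (slice_isTidy hQ) ((overSlice hQ).obj X)).hom t' =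
      (tObj (slice_isTidy hQ) ((overSlice hQ).obj X)).hom t :=
    (over_w_apply (toTree X) t').symm.trans
      ((congrArg ((overSlice hQ).obj ((operadAdjunction hQ).toMonad.obj X)).hom h.symm).trans
        (over_w_apply (toTree X) t))
  refine tObj_ext (hQ := slice_isTidy hQ) h0 (h1.trans h0) ?_
  refine shapeTree_injective (hQ := hQ) (r := (shapes hQ).nodeOp X) _ _ (el_inj ?_)
  exact (toTree_eq t _ h0).symm.trans (h.trans (toTree_eq t' _ (h1.trans h0)))

end SymMulticat
end Opetopic

/-! ### Surjectivity of the comparison. -/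

namespace Opetopic
namespace SymMulticat
open SymMulticatData PTree

variable {Q : SymMulticat.{u}}

theorem Bag.bind_of {A : Type w} {B : Type v} {ws : A → Q.Obj} {zs : B → Q.Obj} {y : Q.Obj} {n : ℕ}
    (nm : Fin n → A) (f : Q.Hom (ws ∘ nm) y) (U : ∀ a, Bag zs (ws a)) :
    Bag.bind (Bag.of f) (fun i => U (nm i)) = Bag.bind (Bag.mk ws nm f) U := rfl

theorem Bag.bind_of_eqToHom {A : Type w} {zs : A → Q.Obj} {y : Q.Obj} {n : ℕ} {x : Fin n → Q.Obj}
    (nm : Fin n → A) (h : ∀ i, zs (nm i) = x i) (f : Q.Hom x y) :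
    Bag.bind (Bag.of f) (fun i => Bag.var (nm i) (eqToHom (h i))) =
      Bag.mk zs nm (re (Equiv.refl _) h f) := by
  obtain rfl : zs ∘ nm = x := funext h
  refine Eq.trans ?_ (congrArg (Bag.mk zs nm) (re_refl _ f).symm)
  exact Bag.bind_pure (Bag.mk zs nm f)

theorem Bag.exists_of_push {n : ℕ} {x : Fin n → Q.Obj} {y y' : Q.Obj} (f : Q.Hom x y)
    (a : y ⟶ y') : ∃ f' : Q.Hom x y', Bag.push a (Bag.of f) = Bag.of f' := by
  have hk : ∑ _i : Fin 1, n = n := by simp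
  have h : ∀ i, i = (concat fun _ : Fin 1 => (id : Fin n → Fin n)) ((finCongr hk).symm i) :=
    fun i => by rw [fin_one_concat _ hk, Equiv.apply_symm_apply]; rfl
  let F : Q.Hom (x ∘ concat fun _ : Fin 1 => (id : Fin n → Fin n)) y' :=
    Q.comp (Q.ι a) fun _ => f
  refine ⟨re (x := x ∘ concat fun _ : Fin 1 => (id : Fin n → Fin n)) (x' := x)
    (finCongr hk).symm (fun i => congrArg x (h i)) F, (Bag.push_mk a id f).trans ?_⟩
  exact (Bag.mk_re (zs := x) _ id F _ (fun i => congrArg x (h i)) h).symm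

/-- Inputs of a composite are named by their places in the concatenated list; the `eqToHom` is there
because the entry of `concat z` at such a place equals `z i j` only propositionally. -/
theorem Bag.bind_of_of {n : ℕ} {x : Fin n → Q.Obj} {y : Q.Obj} (g : Q.Hom x y) {m : Fin n → ℕ}
    {z : ∀ i, Fin (m i) → Q.Obj} (f : ∀ i, Q.Hom (z i) (x i)) :
    Bag.bind (Bag.of g) (fun i => Bag.bind (Bag.of (f i)) fun j =>
      Bag.var (zs := concat z) (finSigmaFinEquiv ⟨i, j⟩) (eqToHom (concat_apply z i j))) =
      Bag.of (Q.comp g f) := by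
  have h : ∀ i j, concat z (finSigmaFinEquiv ⟨i, j⟩) = z i j := concat_apply z
  refine (Bag.bind_mk (ws := x) id g _ (fun i j => finSigmaFinEquiv ⟨i, j⟩)
    (fun i => re (Equiv.refl _) (h i) (f i)) fun i => Bag.bind_of_eqToHom _ (h i) (f i)).trans ?_
  refine Bag.mk_congr rfl (fun p => ?_) ?_
  · obtain ⟨⟨i, j⟩, rfl⟩ := finSigmaFinEquiv.surjective p
    exact concat_apply (fun i j => (finSigmaFinEquiv ⟨i, j⟩ : Fin (∑ i, m i))) i j
  · have key : ∀ (z' : ∀ i, Fin (m i) → Q.Obj) (hz : ∀ i j, z' i j = z i j),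
        (⟨Q.comp g fun i => re (Equiv.refl _) (hz i) (f i)⟩ : Q.Arrow) = ⟨Q.comp g f⟩ := by
      intro z' hz
      obtain rfl : z' = z := funext fun i => funext (hz i)
      congr 2
      exact funext fun i => re_refl _ _
    exact key _ h

/-- A composite of height two, as a tree. -/
theorem exists_twoLevel {B : Type} {fs : B → Elt Q} {g : Elt Q} {k : Fin g.arity → Elt Q}
    (c : ∀ i, (k i).tgt ⟶ g.src i) : ∃ f : Q.Hom (concat fun i => (k i).src) g.tgt,
      ∀ (b : B) (hb : g = fs b) (d : Fin g.arity → B) (hd : ∀ i, k i = fs (d i)),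
        (Tree.node (zs := concat fun i => (k i).src) b g hb (𝟙 _) fun i =>
          Tree.node (d i) (k i) (hd i) (c i) fun j =>
            Tree.edge (finSigmaFinEquiv ⟨i, j⟩)
              (eqToHom (concat_apply (fun i => (k i).src) i j))).ev = Bag.of f := by
  choose f hf using fun i => Bag.exists_of_push (k i).arr (c i)
  refine ⟨Q.comp g.arr f, fun b hb d hd => ?_⟩
  rw [Tree.ev_node, Bag.push_id, ← Bag.bind_of_of]
  refine congrArg (Bag.bind _) (funext fun i => ?_)
  rw [Tree.ev_node, ← hf, Bag.bind_push]
  rfl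

variable {hQ : Q.IsTidy} {X : Over ((zetaMonad hQ).obj (⊤_ (Over (ObjClass Q))))}

/-- An arrow of the slice labelled by elements of `X`. -/
def LabArrow.ofConfig {n : ℕ} {fs : Fin n → Elt Q} {f : Elt Q} (D : Config fs f)
    (Z : Over (ObjClass (slice Q))) (x : Fin n → Z.left)
    (hx : ∀ i, Z.hom (x i) = cls (Q := slice Q) (fs i)) : LabArrow (Q := slice Q) Z where
  arrow := { arity := n, src := fs, tgt := f, arr := D }
  lab := x
  compat := hx

/-- When the nodes already carry the chosen representatives, normalisation changes nothing and
`toTree` can be read off the configuration. -/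
theorem toTree_ofConfig {n : ℕ} {fs : Fin n → Elt Q} {f : Elt Q} (D : Config fs f)
    (x : Fin n → X.left.left) (h : ∀ i, fs i = nodeArrow hQ X (x i)) (hx) :
    (toTree X).left (LabArrow.ofConfig D ((overSlice hQ).obj X) x hx).toClass =
      el (D.tree.toPTree (r := (shapes hQ).nodeOp X) x h (fun i => pt (cls (f.src i)))
        fun _ => hom_pt _) := by
  obtain rfl : fs = nodeArrow hQ X ∘ x := funext h
  let L := LabArrow.ofConfig D ((overSlice hQ).obj X) x hx
  have h0 : (tObj (slice_isTidy hQ) ((overSlice hQ).obj X)).hom (L.toClass : TObj _) =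
    cls (Q := slice Q) f := tObj_hom (hQ := slice_isTidy hQ) L
  have h1 := Bag.bind_pure (Q := slice Q) (Bag.mk (Q := slice Q) (nodeArrow hQ X) x D)
  have h2 : sliceNf (hQ := hQ) (L.toClass : TObj _) f h0 = Bag.push (Q := slice Q) (𝟙 f)
      (Bag.mk (Q := slice Q) (nodeArrow hQ X) x D) := by
    refine (nf_toClass (hQ := slice_isTidy hQ) L f h0 (𝟙 f)).trans ?_
    refine congrArg (Bag.push (Q := slice Q) (𝟙 f)) (Eq.trans ?_ h1)
    refine Eq.trans ?_ (Bag.bind_of (Q := slice Q) x D _)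
    refine congrArg (Bag.bind (Q := slice Q) (Bag.of (Q := slice Q) D)) (funext fun j => ?_)
    exact var_congr (slice_isTidy hQ) rfl _ _
  refine (toTree_eq _ f h0).trans ?_
  rw [h2]
  refine (el_shapeTree_push _ _).trans ?_
  rfl

theorem exists_toTree_leaf (l : (⊤_ (Over (ObjClass Q))).left) {s : ObjClass Q}
    (h : (⊤_ (Over (ObjClass Q))).hom l = s) : ∃ t, (toTree X).left t =
      el (PTree.leaf (P := shapes hQ) (r := (shapes hQ).nodeOp X) l h) := by
  -- A leaf comes from the configuration without nodes, a nullary arrow of `Q⁺` with target an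
  -- identity of `Q`.
  let D : Config (Q := Q) (n := 0) Fin.elim0 ⟨Q.ι (𝟙 (rep s))⟩ :=
    { tree := Tree.edge 0 (𝟙 (rep s))
      nodes_eq := rfl
      isPermuted := isPermuted_iff.2 (Bag.mk_congr rfl
        (fun i => Subsingleton.elim (α := Fin 1) _ _) rfl) }
  refine ⟨_, (toTree_ofConfig D (fun i => i.elim0) (fun i => i.elim0) fun i => i.elim0).trans ?_⟩
  refine el_leaf_congr (P := shapes hQ) ?_ _ _
  rw [eq_pt l, h]
  exact congrArg pt (cls_rep s)

/-- The image of `toTree` is closed under evaluating configurations whose nodes are labelled by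
elements of the image, because `toTree` respects multiplication. -/
theorem toTree_tMu_ofConfig {n : ℕ} {fs : Fin n → Elt Q} {f : Elt Q} (D : Config fs f)
    (x : Fin n → TObj ((overSlice hQ).obj X)) (h : ∀ i, fs i =
      nodeArrow hQ ((operadAdjunction hQ).toMonad.obj X) ((toTree X).left (x i))) : ∃ t,
    (toTree X).left t = (extHom (𝟙 ((operadAdjunction hQ).toMonad.obj X))).left
      (el (D.tree.toPTree (r := (shapes hQ).nodeOp ((operadAdjunction hQ).toMonad.obj X))
        (fun i => (toTree X).left (x i)) h (fun i => pt (cls (f.src i))) fun _ => hom_pt _)) := by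
  have hx : ∀ i, ((zetaMonad (slice_isTidy hQ)).obj ((overSlice hQ).obj X)).hom (x i) =
      cls (Q := slice Q) (fs i) := fun i => by
    rw [h]
    exact (over_w_apply (toTree X) (x i)).symm.trans (cls_rep (Q := slice Q) _).symm
  refine ⟨_, (toTree_tMu (LabArrow.ofConfig D _ x hx).toClass).trans ?_⟩
  refine congrArg ((operadAdjunction hQ).toMonad.μ.app X).left.left ?_
  exact toTree_ofConfig D (fun i => (toTree X).left (x i)) h _

/-- The tree is the evaluation of a two-level configuration: the one-node tree of `b` below, the
given subtrees above. All of these lie in the image of `toTree`. -/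
theorem exists_toTree_node {s : ObjClass Q} (b : X.left.left) (g : Elt Q)
    (hg : g = nodeArrow hQ X b) (h : cls g.tgt = s)
    (ch : ∀ i : Fin g.arity, PTree (shapes hQ) ((shapes hQ).nodeOp X) (⊤_ (Over (ObjClass Q)))
      (cls (g.src i)))
    (hch : ∀ i, ∃ t, (toTree X).left t = el (ch i)) : ∃ t, (toTree X).left t =
      el (PTree.node (P := shapes hQ) (r := (shapes hQ).nodeOp X) b g hg h ch) := by
  choose t ht using hch
  let M := (operadAdjunction hQ).toMonad
  -- Node `0` is the root and node `i + 1` stands for the subtree at input `i`.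
  let x : Fin (g.arity + 1) → TObj ((overSlice hQ).obj X) :=
    Fin.cons ((tEta (slice_isTidy hQ) ((overSlice hQ).obj X)).left b) t
  let fs : Fin (g.arity + 1) → Elt Q := fun i => nodeArrow hQ (M.obj X) ((toTree X).left (x i))
  have hx0 : (toTree X).left (x 0) = el (single ((shapes hQ).nodeOp X) b) := toTree_tEta b
  have hx1 : ∀ i, (toTree X).left (x (Fin.succ i)) = el (ch i) := ht
  have hb : g = fs 0 := by
    refine hg.trans (congrArg (shapes hQ).rep ?_)
    exact (evHom_single b).symm.trans (congrArg (evHom _ _).left hx0.symm)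
  -- The composite of a subtree matches the input of `g` only up to isomorphism; `conn (hc i)`
  -- labels the edge between them.
  have hc : ∀ i, cls (fs (Fin.succ i)).tgt = cls (g.src i) := fun i => by
    refine ((shapes hQ).tgt_rep _).trans ?_
    refine (congrArg (fun w => ((zetaMonad hQ).obj (⊤_ (Over (ObjClass Q)))).hom
      ((evHom _ _).left w)) (hx1 i)).trans (hom_evHom (ch i))
  obtain ⟨f, hf⟩ := exists_twoLevel (fs := fs) (g := g) (k := fun i => fs (Fin.succ i))
    fun i => conn (hc i)
  let D : Config fs ⟨f⟩ :=
    { tree := Tree.node 0 g hb (𝟙 _) fun i => Tree.node (Fin.succ i) (fs (Fin.succ i)) rfl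
        (conn (hc i)) fun j => Tree.edge (finSigmaFinEquiv ⟨i, j⟩)
          (eqToHom (concat_apply (fun i => (fs (Fin.succ i)).src) i j))
      nodes_eq := by
        rw [Fin.univ_succ, Finset.cons_val, Finset.map_val]
        simp only [Tree.nodes, Finset.sum_const_zero]
        exact congrArg (Multiset.cons 0) ((congrArg Multiset.sum
          (Multiset.map_map (fun a : Fin (g.arity + 1) => ({a} : Multiset _)) Fin.succ
            Finset.univ.val).symm).trans (Multiset.sum_map_singleton _))
      isPermuted := isPermuted_iff.2 (hf 0 hb Fin.succ fun _ => rfl) }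
  obtain ⟨t, h1⟩ := toTree_tMu_ofConfig D x fun _ => rfl
  refine ⟨t, h1.trans ?_⟩
  let G := freeOperad (shapes hQ) (zetaMonad_isCartesian hQ) X
  let φ : M.obj X ⟶ (operadForget (zetaMonad hQ)).obj G := 𝟙 _
  let chl : ∀ i : Fin g.arity, PTree (shapes hQ) ((shapes hQ).nodeOp (M.obj X))
      (⊤_ (Over (ObjClass Q))) (cls (g.src i)) := fun i =>
    .node (P := shapes hQ) ((toTree X).left (x (Fin.succ i))) (fs (Fin.succ i)) rfl (hc i)
      fun j => .leaf (pt (cls (concat (fun i => (fs (Fin.succ i)).src) (finSigmaFinEquiv ⟨i, j⟩))))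
        ((hom_pt _).trans (congrArg cls (concat_apply (fun i => (fs (Fin.succ i)).src) i j)))
  -- Each upper node is a one-node tree naming a whole subtree, so it evaluates to that subtree.
  have hchl : ∀ i, (extHom φ).left (el (chl i)) = el (ch i) := fun i => by
    refine Eq.trans (congrArg (extHom φ).left ?_)
      ((extHom_single φ ((toTree X).left (x (Fin.succ i)))).trans (hx1 i))
    refine el_node_congr (P := shapes hQ) rfl (fs (Fin.succ i)) _ _ _ _ fun j => ?_
    exact el_leaf_congr (congrArg (fun x => pt (cls x))
      (concat_apply (fun i => (fs (Fin.succ i)).src) i j)) _ _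
  have hcl := map_c_lab (P := shapes hQ) φ G.c ((toTree X).left (x 0)) g hb
    (fun i => (extHom φ).left (el (chl i))) fun i => hom_extHom φ (chl i)
  have hlab : (shapes hQ).lab (Y := G.C₁) g (fun i => (extHom φ).left (el (chl i)))
      (fun i => hom_extHom φ (chl i)) = (shapes hQ).lab (Y := G.C₁) g (fun i => el (ch i))
        fun _ => rfl := (shapes hQ).lab_congr g (funext hchl) _ _
  have hcl' := hcl
  have hgen : gen φ ((toTree X).left (x 0)) = el (single ((shapes hQ).nodeOp X) b) := hx0
  rw [hlab, hgen] at hcl'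
  refine (extHom_node (P := shapes hQ) φ ((toTree X).left (x 0)) g hb rfl chl hcl).trans ?_
  refine (G.cmp_congr hlab hgen hcl hcl').trans ?_
  exact (cmp_single (P := shapes hQ) (zetaMonad_isCartesian hQ) b g hg h ch hcl').symm

theorem toTree_surjective : Function.Surjective (toTree X).left := by
  rintro ⟨s, w⟩
  induction w with
  | leaf l h => exact exists_toTree_leaf l h
  | node b g hg h ch ih => exact exists_toTree_node b g hg h ch ih

end SymMulticat
end Opetopic

/-! ### Assembling the isomorphism in `CartMonad`. -/

namespace Opetopic
namespace SymMulticat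
open SymMulticatData PTree

variable {Q : SymMulticat.{u}} (hQ : Q.IsTidy)
  (X : Over ((zetaMonad hQ).obj (⊤_ (Over (ObjClass Q)))))

instance isIso_toTree : IsIso (toTree X) := by
  have : IsIso ((Over.forget _).map (toTree X)) :=
    (isIso_iff_bijective (toTree X).left).2 ⟨toTree_injective X, toTree_surjective⟩
  exact isIso_of_reflects_iso (toTree X) (Over.forget _)

/-- The free operad monad is isomorphic to the monad of the slice. -/
noncomputable def toTreeIso : overSlice hQ ⋙ (zetaMonad (slice_isTidy hQ)).toFunctor ≅
    (operadAdjunction hQ).toMonad.toFunctor ⋙ overSlice hQ :=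
  NatIso.ofComponents (fun X => asIso (toTree X)) fun f => over_ext fun t => toTree_tMap f t

theorem toTreeIso_unit :
    (overSlice hQ).map ((operadAdjunction hQ).toMonad.η.app X) ≫ (toTreeIso hQ).inv.app X =
      (zetaMonad (slice_isTidy hQ)).η.app ((overSlice hQ).obj X) := by
  have h : (zetaMonad (slice_isTidy hQ)).η.app ((overSlice hQ).obj X) ≫ toTree X =
      (overSlice hQ).map ((operadAdjunction hQ).toMonad.η.app X) :=
    over_ext fun x => toTree_tEta x
  rw [← h]
  exact (Category.assoc _ _ _).trans
    ((congrArg _ (IsIso.hom_inv_id (toTree X))).trans (Category.comp_id _))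

theorem toTreeIso_mult :
    (overSlice hQ).map ((operadAdjunction hQ).toMonad.μ.app X) ≫ (toTreeIso hQ).inv.app X =
      (toTreeIso hQ).inv.app ((operadAdjunction hQ).toMonad.obj X) ≫
        (zetaMonad (slice_isTidy hQ)).map ((toTreeIso hQ).inv.app X) ≫
          (zetaMonad (slice_isTidy hQ)).μ.app ((overSlice hQ).obj X) := by
  have h : (zetaMonad (slice_isTidy hQ)).μ.app ((overSlice hQ).obj X) ≫
      (toTreeIso hQ).hom.app X = (zetaMonad (slice_isTidy hQ)).map ((toTreeIso hQ).hom.app X) ≫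
        (toTreeIso hQ).hom.app ((operadAdjunction hQ).toMonad.obj X) ≫
          (overSlice hQ).map ((operadAdjunction hQ).toMonad.μ.app X) :=
    over_ext fun t => toTree_tMu t
  have h1 : (zetaMonad (slice_isTidy hQ)).map ((toTreeIso hQ).inv.app X) ≫
      (zetaMonad (slice_isTidy hQ)).map ((toTreeIso hQ).hom.app X) = 𝟙 _ := by
    rw [← CategoryTheory.Functor.map_comp, Iso.inv_hom_id_app, CategoryTheory.Functor.map_id]
  rw [← cancel_mono ((toTreeIso hQ).hom.app X), Category.assoc, Category.assoc, Category.assoc, h,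
    Iso.inv_hom_id_app, reassoc_of% h1, Iso.inv_hom_id_app_assoc]
  exact Category.comp_id _

instance isEquivalence_overSlice : (overSlice hQ).IsEquivalence :=
  (CategoryTheory.Equivalence.mk (overSlice hQ) (sliceOver hQ) (eqToIso (overSlice_comp_sliceOver hQ).symm)
    (eqToIso (sliceOver_comp_overSlice hQ))).isEquivalence_functor

variable {hQ} {F : Over ((zetaMonad hQ).obj (⊤_ (Over (ObjClass Q)))) ⥤ Operad (zetaMonad hQ)}
  (adj : F ⊣ operadForget (zetaMonad hQ))

/-- The monad induced by a left adjoint to the forgetful functor from operads, compared with the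
monad of the slice. -/
noncomputable def operadMonadIso : adj.toMonad.toFunctor ⋙ overSlice hQ ≅
    overSlice hQ ⋙ (zetaMonad (slice_isTidy hQ)).toFunctor :=
  Functor.isoWhiskerRight (toMonadIso adj (operadAdjunction hQ)) (overSlice hQ) ≪≫
    (toTreeIso hQ).symm

theorem operadMonadIso_hom_app : (operadMonadIso adj).hom.app X =
    (overSlice hQ).map ((toMonadIso adj (operadAdjunction hQ)).hom.app X) ≫
      (toTreeIso hQ).inv.app X := rfl

theorem operadMonadIso_unit : (overSlice hQ).map (adj.toMonad.η.app X) ≫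
    (operadMonadIso adj).hom.app X =
      (zetaMonad (slice_isTidy hQ)).η.app ((overSlice hQ).obj X) := by
  rw [← toTreeIso_unit, ← toMonadIso_unit adj (operadAdjunction hQ), operadMonadIso_hom_app,
    CategoryTheory.Functor.map_comp, Category.assoc]

theorem operadMonadIso_mult : (overSlice hQ).map (adj.toMonad.μ.app X) ≫
    (operadMonadIso adj).hom.app X = (operadMonadIso adj).hom.app (adj.toMonad.obj X) ≫
      (zetaMonad (slice_isTidy hQ)).map ((operadMonadIso adj).hom.app X) ≫
        (zetaMonad (slice_isTidy hQ)).μ.app ((overSlice hQ).obj X) := by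
  have h := congrArg (overSlice hQ).map (toMonadIso_mult adj (operadAdjunction hQ) X)
  rw [CategoryTheory.Functor.map_comp, CategoryTheory.Functor.map_comp, CategoryTheory.Functor.map_comp] at h
  have h1 := (toTreeIso hQ).inv.naturality ((toMonadIso adj (operadAdjunction hQ)).hom.app X)
  rw [operadMonadIso_hom_app, operadMonadIso_hom_app, CategoryTheory.Functor.map_comp, reassoc_of% h,
    toTreeIso_mult]
  simp only [Category.assoc]
  refine congrArg (_ ≫ ·) ?_
  exact (congrArg (· ≫ (zetaMonad (slice_isTidy hQ)).map ((toTreeIso hQ).inv.app X) ≫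
    (zetaMonad (slice_isTidy hQ)).μ.app ((overSlice hQ).obj X)) h1).trans (Category.assoc _ _ _)

/-- Cartesianness of the free operad monad is not verified on trees; it is inherited from `ζ(Q⁺)`
along the equivalence `overSlice`. -/
theorem isCartesian_operadMonad : IsCartesian adj.toMonad :=
  IsCartesian.of_equivalence (operadMonadIso adj) (fun X => operadMonadIso_unit X adj)
    (fun X => operadMonadIso_mult X adj) (zeta (slice Q) (slice_isTidy hQ)).cartesian

theorem equifibered_operadMonadIso : NatTrans.Equifibered (operadMonadIso adj).hom :=
  NatTrans.Equifibered.of_isIso _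

/-- The comparison of the free operad monad with the monad of the slice. -/
noncomputable def operadMonadHom :
    (⟨_, adj.toMonad, isCartesian_operadMonad adj⟩ : CartMonad.{u, u + 1}).Hom
      (zeta (slice Q) (slice_isTidy hQ)) where
  U := overSlice hQ
  φ := (operadMonadIso adj).hom
  preservesPullbacks :=
    inferInstanceAs (PreservesLimitsOfShape WalkingCospan (overSlice hQ))
  equifibered := equifibered_operadMonadIso adj
  unit X := operadMonadIso_unit X adj
  mult X := operadMonadIso_mult X adj

theorem isIso_operadMonadHom : IsIso (C := CartMonad.{u, u + 1})
    (X := ⟨_, adj.toMonad, isCartesian_operadMonad adj⟩)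
    (Y := zeta (slice Q) (slice_isTidy hQ)) (operadMonadHom adj) :=
  CartMonad.isIso_of_strictInverse _ (sliceOver hQ) (overSlice_comp_sliceOver hQ)
    (sliceOver_comp_overSlice hQ) fun X => inferInstanceAs (IsIso ((operadMonadIso adj).hom.app X))

end SymMulticat
end Opetopic

theorem mainTheorem3 (Q : Opetopic.SymMulticat.{u}) (hQ : Q.IsTidy) :
    (Opetopic.operadForget (Opetopic.zeta Q hQ).T).IsRightAdjoint ∧
      ∀ (F : Over ((Opetopic.zeta Q hQ).T.obj (⊤_ (Opetopic.zeta Q hQ).E)) ⥤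
          Opetopic.Operad (Opetopic.zeta Q hQ).T)
        (adj : F ⊣ Opetopic.operadForget (Opetopic.zeta Q hQ).T),
        ∃ h : Opetopic.IsCartesian adj.toMonad,
          Nonempty ((⟨_, adj.toMonad, h⟩ : Opetopic.CartMonad.{u, u + 1}) ≅
            Opetopic.zeta (Opetopic.SymMulticat.slice Q) (Opetopic.SymMulticat.slice_isTidy hQ)) :=
  ⟨⟨_, ⟨Opetopic.SymMulticat.operadAdjunction hQ⟩⟩, fun _ adj =>
    ⟨Opetopic.SymMulticat.isCartesian_operadMonad (hQ := hQ) adj,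
      have := Opetopic.SymMulticat.isIso_operadMonadHom (hQ := hQ) adj
      ⟨@asIso _ _ _ _ _ this⟩⟩⟩
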